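/- Let $\mathbb K$ be a field of characteristic $0$ and let $q\in\mathbb K^\times$ not be a root of unity. Let $I$ be a finite totally ordered set and $(d_{ij})_{i,j\in I}$ a symmetric integer matrix with $d_{ii}=2$ and $d_{ij}\le 0$ for $i\ne j$. Put $\zeta_{ij}(x)=\frac{x-q^{-d_{ij}}}{x-1}$. *Algebras.* $\widetilde U^+$ is the $\mathbb K$-algebra generated by $e_{i,k}$ ($i\in I$, $k\in\mathbb Z$) modulo the coefficients of $e_i(z)e_j(w)(zq^{-d_{ij}}-w)=e_j(w)e_i(z)(z-wq^{-d_{ij}})$ for all $i,j\in I$, where $e_i(z)=\sum_k e_{i,k}z^{-k}$; and $\widetilde U^-$ is generated by $f_{i,k}$ modulo the coefficients of $f_i(z)f_j(w)(z-wq^{-d_{ij}})=f_j(w)f_i(z)(zq^{-d_{ij}}-w)$ for all $i,j\in I$, where $f_i(z)=\sum_k f_{i,k}z^{-k}$. Let $\mathcal V=\mathcal V^+=\mathcal V^-=\bigoplus_{\mathbf n\in\mathbb N^I}\mathcal V_{\mathbf n}$, where $\mathcal V_{\mathbf n}$ consists of the rational functions $R=r/\prod_{i<j}\prod_{a\le n_i,\,b\le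 n_j}(z_{ia}-z_{jb})$ with $r$ a Laurent polynomial in the variables $z_{ia}$ ($i\in I$, $1\le a\le n_i$), symmetric in $z_{i1},\dots,z_{in_i}$ for each $i$ separately. The product on $\mathcal V^+$ is, for $R$ of degree $\mathbf n$ and $R'$ of degree $\mathbf n'$, $$R*R'=\frac1{\mathbf n!\,\mathbf n'!}\,\mathrm{Sym}\Big[R(\dots,z_{i1},\dots,z_{in_i},\dots)\,R'(\dots,z_{i,n_i+1},\dots,z_{i,n_i+n'_i},\dots)\prod_{i,j\in I}\ \prod_{a\le n_i}\ \prod_{n_j<b\le n_j+n'_j}\zeta_{ij}\Big(\frac{z_{ia}}{z_{jb}}\Big)\Big],$$ where $\mathbf n!=\prod_i n_i!$ and $\mathrm{Sym}$ is the sum over all permutations of the variables of each colour $i$ separately; on $\mathcal V^-$ one replaces $\zeta_{ij}(z_{ia}/z_{jb})$ by $\zeta_{ji}(z_{jb}/z_{ia})$. Let $\widetilde\Upsilon^\pm:\widetilde U^\pm\to\mathcal V^\pm$ be the algebra homomorphisms with $e_{i,k}\mapsto z_{i1}^k$, respectively $f_{i,k}\mapsto z_{i1}^k$; put $K^\pm=\ker\widetilde\Upsilon^\pm$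 and $\mathring{\mathcal S}^\pm=\operatorname{Im}\widetilde\Upsilon^\pm$. *Pairings.* Let $\langle\cdot,\cdot\rangle_{\widetilde U\mathcal V}:\widetilde U^+\otimes\mathcal V^-\to\mathbb K$ and $\langle\cdot,\cdot\rangle_{\mathcal V\widetilde U}:\mathcal V^+\otimes\widetilde U^-\to\mathbb K$ be the pairings given by $$\langle e_{i_1,k_1}\cdots e_{i_N,k_N},R\rangle_{\widetilde U\mathcal V}=\int_{|z_1|\gg\dots\gg|z_N|}\frac{z_1^{k_1}\cdots z_N^{k_N}R(z_1,\dots,z_N)}{\prod_{a<b}\zeta_{i_bi_a}(z_b/z_a)}\prod_a Dz_a,$$ $$\langle R,f_{i_1,-k_1}\cdots f_{i_N,-k_N}\rangle_{\mathcal V\widetilde U}=\int_{|z_1|\ll\dots\ll|z_N|}\frac{z_1^{-k_1}\cdots z_N^{-k_N}R(z_1,\dots,z_N)}{\prod_{a<b}\zeta_{i_ai_b}(z_a/z_b)}\prod_a Dz_a$$ if $R\in\mathcal V_{\mathbf n}$ and, for every $i\in I$, exactly $n_i$ of the indices $i_1,\dots,i_N$ equal $i$; and by $0$ if $R\in\mathcal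 V_{\mathbf n}$ for any other $\mathbf n$. Here $\int$ denotes the constant term of the expansion in the indicated region, and $z_a$ is plugged into one of the variables of colour $i_a$ of $R$, distinct $a$ being plugged into distinct variables. *Wheel conditions.* A distinguished zig-zag of multiplicity $m\ge1$ consists of $i\ne j$ in $I$ and integers $s,t,s',t'$ such that, for some integers $k,l\ge0$ with $k+l=-d_{ij}$, $$t=s+2(k+m-1),\quad t'=s'+2(l+m-1),\quad t'=s-d_{ij}+2(m-1),\quad t=s'-d_{ij}+2(m-1).$$ Let $\mathcal S^+=\mathcal S^-\subset\mathcal V$ consist of those elements such that, for every component $R\in\mathcal V_{\mathbf n}$ and every distinguished zig-zag with $k+m\le n_i$ and $l+m\le n_j$, the specialization of the numerator $r$ of $R$ at $z_{i1}=xq^s,\ z_{i2}=xq^{s+2},\dots,\ z_{i,k+m}=xq^t$, $z_{j1}=yq^{s'},\ z_{j2}=yq^{s'+2},\dots,\ z_{j,l+m}=yq^{t'}$ is divisible by $(x-y)^m$ as a Laurent polynomial. **Proposition.** The homomorphisms $\widetilde\Upsilon^\pm$ and the two pairings exist and are uniquely determined by the above, and $$\langle K^+,\mathcal S^-\rangle_{\widetilde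 U\mathcal V}=0=\langle\mathcal S^+,K^-\rangle_{\mathcal V\widetilde U}.$$ Moreover $\mathring{\mathcal S}^\pm\subseteq\mathcal S^\pm$. Hence the pairings descend to pairings $\mathring{\mathcal S}^+\otimes\mathcal S^-\to\mathbb K$ and $\mathcal S^+\otimes\mathring{\mathcal S}^-\to\mathbb K$, and these two have the same restriction to $\mathring{\mathcal S}^+\otimes\mathring{\mathcal S}^-$. -/

import Mathlib

noncomputable section

namespace QLoop

/-- A symmetric (generalized) Cartan matrix: `2` on the diagonal, symmetric, with non-positive
integers off the diagonal. -/
structure IsSymmetricCartan {I : Type*} (d : I → I → ℤ) : Prop where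
  diag : ∀ i, d i i = 2
  symm : ∀ i j, d i j = d j i
  off_diag : ∀ i j, i ≠ j → d i j ≤ 0

/-- The sign `±` decorating the two halves of the constructions. -/
inductive Half
  | plus
  | minus

/-! ### The quadratic algebras -/

section Quadratic

variable {K : Type*} [Field K] (q : Kˣ) {I : Type*} (d : I → I → ℤ)

/-- The defining relations between the generators (`e_{i,k}` for `plus`, `f_{i,k}` for `minus`),
as a relation on the free algebra. With `e_i(z) = ∑ e_{i,k} z^{-k}`, they are the coefficients of
`z^{-k} w^{-l}` in
`e_i(z) e_j(w) (z q^{-d_ij} - w) = e_j(w) e_i(z) (z - w q^{-d_ij})`, respectively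
`f_i(z) f_j(w) (z - w q^{-d_ij}) = f_j(w) f_i(z) (z q^{-d_ij} - w)`, i.e. of the identities
`e_i(z) e_j(w) ζ_ji(w/z) = e_j(w) e_i(z) ζ_ij(z/w)` and
`f_i(z) f_j(w) ζ_ij(z/w) = f_j(w) f_i(z) ζ_ji(w/z)` multiplied by `z - w`. -/
inductive QuadRel : Half → FreeAlgebra K (I × ℤ) → FreeAlgebra K (I × ℤ) → Prop
  | e (i j : I) (k l : ℤ) :
      QuadRel .plus
        (((q ^ (-d i j) : Kˣ) : K) • (FreeAlgebra.ι K (i, k + 1) * FreeAlgebra.ι K (j, l))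
          - FreeAlgebra.ι K (i, k) * FreeAlgebra.ι K (j, l + 1))
        (FreeAlgebra.ι K (j, l) * FreeAlgebra.ι K (i, k + 1)
          - ((q ^ (-d i j) : Kˣ) : K) • (FreeAlgebra.ι K (j, l + 1) * FreeAlgebra.ι K (i, k)))
  | f (i j : I) (k l : ℤ) :
      QuadRel .minus
        (FreeAlgebra.ι K (i, k + 1) * FreeAlgebra.ι K (j, l)
          - ((q ^ (-d i j) : Kˣ) : K) • (FreeAlgebra.ι K (i, k) * FreeAlgebra.ι K (j, l + 1)))
        (((q ^ (-d i j) : Kˣ) : K) • (FreeAlgebra.ι K (j, l) * FreeAlgebra.ι K (i, k + 1))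
          - FreeAlgebra.ι K (j, l + 1) * FreeAlgebra.ι K (i, k))

/-- The algebra `Ũ_q^±(Lg)`: the free algebra on symbols indexed by `I × ℤ`, modulo the quadratic
relations. -/
abbrev QuadAlg (h : Half) : Type _ := RingQuot (QuadRel q d h)

/-- The generator `e_{i,k}` of `Ũ_q^+(Lg)`, respectively `f_{i,k}` of `Ũ_q^-(Lg)`. -/
def gen (h : Half) (i : I) (k : ℤ) : QuadAlg q d h :=
  RingQuot.mkAlgHom K (QuadRel q d h) (FreeAlgebra.ι K (i, k))

end Quadratic

/-! ### Rational functions and Laurent polynomials in finitely many variables -/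

section Functions

variable (K : Type*) [Field K]

/-- The field `K(z_v)_{v ∈ σ}` of rational functions. -/
abbrev RatFun (σ : Type*) : Type _ := FractionRing (MvPolynomial σ K)

/-- The variable `z_v` as a rational function. -/
def ratVar {σ : Type*} (v : σ) : RatFun K σ :=
  algebraMap (MvPolynomial σ K) (RatFun K σ) (MvPolynomial.X v)

/-- Substitution `z_v ↦ u_v` into rational functions, for an algebraically independent family `u`
of elements of a field. -/
def ratSubst {K : Type*} [Field K] {σ L : Type*} [Field L] [Algebra K L] (u : σ → L)
    (hu : AlgebraicIndependent K u) : RatFun K σ →ₐ[K] L :=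
  IsFractionRing.liftAlgHom (A := MvPolynomial σ K) (g := MvPolynomial.aeval u)
    (algebraicIndependent_iff_injective_aeval.1 hu)

theorem algebraicIndependent_ratVar (σ : Type*) :
    AlgebraicIndependent K (ratVar K : σ → RatFun K σ) :=
  (MvPolynomial.algebraicIndependent_X σ K).map' (f := Algebra.algHom K _ (RatFun K σ))
    (IsFractionRing.injective (MvPolynomial σ K) (RatFun K σ))

/-- Renaming of the variables `z_v ↦ z_{f v}` along an injective map `f`. -/
def ratRename {σ τ : Type*} (f : σ ↪ τ) : RatFun K σ →ₐ[K] RatFun K τ :=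
  ratSubst (fun v => ratVar K (f v)) ((algebraicIndependent_ratVar K τ).comp f f.injective)

/-- Laurent polynomials `K[z_v^{±1}]_{v ∈ σ}`: finite linear combinations of the monomials with
exponents in `σ → ℤ`. -/
abbrev Laurent (σ : Type*) : Type _ := AddMonoidAlgebra K (σ → ℤ)

/-- The variable `z_v`, as a unit of the ring of Laurent polynomials. -/
def laurentVar {σ : Type*} [DecidableEq σ] (v : σ) : (Laurent K σ)ˣ :=
  Units.map (AddMonoidAlgebra.of K (σ → ℤ))
    (toUnits (Multiplicative.ofAdd (Pi.single v 1 : σ → ℤ)))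

/-- Substitution `z_v ↦ u_v` into Laurent polynomials, for units `u_v` of a commutative
`K`-algebra. -/
def laurentSubst {K : Type*} [Field K] {σ A : Type*} [Fintype σ] [CommRing A] [Algebra K A]
    (u : σ → Aˣ) : Laurent K σ →ₐ[K] A :=
  AddMonoidAlgebra.lift K A (σ → ℤ)
    { toFun := fun γ => ((∏ v, u v ^ (Multiplicative.toAdd γ v) : Aˣ) : A)
      map_one' := by simp
      map_mul' := fun γ γ' => by
        simp only [toAdd_mul, Pi.add_apply, zpow_add, Finset.prod_mul_distrib, Units.val_mul] }

theorem ratVar_ne_zero {σ : Type*} (v : σ) : ratVar K v ≠ 0 :=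
  (map_ne_zero_iff _ (IsFractionRing.injective (MvPolynomial σ K) (RatFun K σ))).2
    (MvPolynomial.X_ne_zero v)

/-- A Laurent polynomial, regarded as a rational function. -/
def laurentToRat (σ : Type*) [Fintype σ] : Laurent K σ →ₐ[K] RatFun K σ :=
  laurentSubst (fun v => Units.mk0 (ratVar K v) (ratVar_ne_zero K v))

end Functions

/-! ### Expansions and constant terms -/

section Expansion

variable (K : Type*) [Field K]

/-- Formal series in `z_1, …, z_N` with coefficients in `K`, with well-ordered support for the
lexicographic order of the exponents. -/
abbrev Series (N : ℕ) : Type _ := HahnSeries (Lex (Fin N → ℤ)) K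

/-- The sign relating the exponents of `z_1, …, z_N` to the lexicographic order: in `ℤ^N`,
the exponent of `z_a` is sent to `ε` times the `a`-th basis vector. For `ε = 1` the ratios
`z_a / z_b` with `a < b` are positive (small), which is the region `|z_1| ≪ ⋯ ≪ |z_N|`; for
`ε = -1` the ratios `z_b / z_a` with `a < b` are positive, which is the region
`|z_1| ≫ ⋯ ≫ |z_N|`. -/
def expVar (ε : ℤˣ) {N : ℕ} (a : Fin N) : Series K N :=
  HahnSeries.single (toLex (Pi.single a (ε : ℤ))) 1

theorem prod_expVar_pow (ε : ℤˣ) {N : ℕ} (s : Finset (Fin N)) (m : Fin N → ℕ) :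
    ∏ a ∈ s, expVar K ε a ^ m a =
      HahnSeries.single (toLex (∑ a ∈ s, m a • Pi.single a (ε : ℤ) : Fin N → ℤ)) (1 : K) := by
  classical
  induction s using Finset.induction_on with
  | empty => simp
  | insert a s ha ih =>
    rw [Finset.prod_insert ha, Finset.sum_insert ha, ih, expVar, HahnSeries.single_pow,
      HahnSeries.single_mul_single]
    simp

theorem algebraicIndependent_expVar (ε : ℤˣ) (N : ℕ) :
    AlgebraicIndependent K (expVar K ε : Fin N → Series K N) := by
  classical
  have key : ∀ (p : MvPolynomial (Fin N) K) (m : Fin N →₀ ℕ),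
      (MvPolynomial.aeval (expVar K ε) p : Series K N).coeff
        (toLex (∑ a, m a • Pi.single a (ε : ℤ) : Fin N → ℤ)) = p.coeff m := by
    intro p m
    induction p using MvPolynomial.induction_on' with
    | monomial m' c =>
      have hinj : (∑ a, m a • Pi.single a (ε : ℤ) : Fin N → ℤ) =
          ∑ a, m' a • Pi.single a (ε : ℤ) → m' = m := by
        intro h
        ext a
        have h1 := congrFun h a
        have h2 : ∀ m : Fin N →₀ ℕ,
            (∑ c, m c • Pi.single c (ε : ℤ) : Fin N → ℤ) a = (m a : ℤ) * ε := by
          intro m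
          rw [Finset.sum_apply, Finset.sum_eq_single a]
          · simp
          · intro b _ hb
            simp [Pi.single_eq_of_ne hb.symm]
          · simp
        rw [h2, h2] at h1
        exact_mod_cast (mul_right_cancel₀ ε.ne_zero h1).symm
      rw [MvPolynomial.aeval_monomial, Finsupp.prod_fintype _ _ (by simp), prod_expVar_pow,
        MvPolynomial.coeff_monomial, ← Algebra.smul_def, HahnSeries.coeff_smul,
        HahnSeries.coeff_single]
      by_cases h : m' = m
      · subst h; simp
      · rw [if_neg h, if_neg]
        · simp
        · intro h'
          exact h (hinj (toLex.injective h'))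
    | add p p' hp hp' => 
      rw [map_add, HahnSeries.coeff_add, hp, hp', MvPolynomial.coeff_add]
  intro p p' h
  ext m
  rw [← key, ← key]
  exact congrArg (fun f => HahnSeries.coeff f _) h

/-- The expansion of a rational function in the region `|z_1| ≪ ⋯ ≪ |z_N|` if `ε = 1`, and in the
region `|z_1| ≫ ⋯ ≫ |z_N|` if `ε = -1`. -/
def expand (ε : ℤˣ) (N : ℕ) : RatFun K (Fin N) →ₐ[K] Series K N :=
  ratSubst (expVar K ε) (algebraicIndependent_expVar K ε N)

/-- The constant term of the expansion of a rational function; this is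
`∫_{|z_1| ≪ ⋯ ≪ |z_N|} F ∏ Dz_a` if `ε = 1` and `∫_{|z_1| ≫ ⋯ ≫ |z_N|} F ∏ Dz_a` if `ε = -1`. -/
def constTerm (ε : ℤˣ) {N : ℕ} (F : RatFun K (Fin N)) : K :=
  (expand K ε N F).coeff 0

end Expansion

/-! ### The shuffle algebras -/

section Shuffle

variable {K : Type*} [Field K] (q : Kˣ) {I : Type*} (d : I → I → ℤ)

/-- `ζ_ij(x) = (x - q^{-d_ij}) / (x - 1)`. -/
def zeta {L : Type*} [Field L] [Algebra K L] (i j : I) (x : L) : L :=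
  (x - algebraMap K L ((q ^ (-d i j) : Kˣ) : K)) / (x - 1)

/-- The factor in the shuffle product attached to a variable `x = z_{ia}` of the first function and
a variable `y = z_{jb}` of the second one: `ζ_ij(x/y)` for `V^+` and `ζ_ji(y/x)` for `V^-`. -/
def zetaFactor {L : Type*} [Field L] [Algebra K L] (h : Half) (i j : I) (x y : L) : L :=
  match h with
  | .plus => zeta q d i j (x / y)
  | .minus => zeta q d j i (y / x)

/-- The index set of the variables `z_{ia}`, `i ∈ I`, `1 ≤ a ≤ n_i` (here `a` is counted from
`0`). -/
abbrev Var (n : I → ℕ) : Type _ := Σ i, Fin (n i)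

/-- The permutation of the variables induced by a permutation of each colour. -/
def colourPerm {n : I → ℕ} (g : ∀ i, Equiv.Perm (Fin (n i))) : Equiv.Perm (Var n) :=
  Equiv.sigmaCongrRight g

/-- The variables of the first factor of a shuffle product: `z_{ia}` with `a ≤ n_i`. -/
def leftVar (n m : I → ℕ) : Var n ↪ Var (n + m) where
  toFun v := ⟨v.1, Fin.castAdd (m v.1) v.2⟩
  inj' := by
    rintro ⟨i, a⟩ ⟨j, b⟩ h
    obtain ⟨h₁, h₂⟩ := Sigma.mk.inj_iff.1 h
    change i = j at h₁
    subst h₁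
    exact congrArg _ (Fin.castAdd_injective _ _ (eq_of_heq h₂))

/-- The variables of the second factor of a shuffle product: `z_{i,n_i+a}` with `a ≤ m_i`. -/
def rightVar (n m : I → ℕ) : Var m ↪ Var (n + m) where
  toFun v := ⟨v.1, Fin.natAdd (n v.1) v.2⟩
  inj' := by
    rintro ⟨i, a⟩ ⟨j, b⟩ h
    obtain ⟨h₁, h₂⟩ := Sigma.mk.inj_iff.1 h
    change i = j at h₁
    subst h₁
    exact congrArg _ (Fin.natAdd_injective _ _ (eq_of_heq h₂))

variable (K) in
/-- Families of rational functions, one in the variables `z_{ia}`, `a ≤ n_i`, for each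
`n ∈ ℕ^I`, almost all zero. It contains the big shuffle algebras. -/
abbrev RatSum (I : Type*) : Type _ := DirectSum (I → ℕ) (fun n => RatFun K (Var n))

variable [Fintype I]

variable (K) in
/-- Symmetrization with respect to the variables of each colour separately. -/
def symmetrize {n : I → ℕ} [DecidableEq I] (R : RatFun K (Var n)) : RatFun K (Var n) :=
  ∑ g : (∀ i, Equiv.Perm (Fin (n i))), ratRename K (colourPerm g).toEmbedding R

/-- The shuffle product of a rational function of degree `n` and one of degree `m`. -/
def shuffleFun [DecidableEq I] (h : Half) {n m : I → ℕ} (R : RatFun K (Var n))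
    (R' : RatFun K (Var m)) : RatFun K (Var (n + m)) :=
  (((∏ i, (n i).factorial : ℕ) : K) * ((∏ i, (m i).factorial : ℕ) : K))⁻¹ •
    symmetrize K
      (ratRename K (leftVar n m) R * ratRename K (rightVar n m) R' *
        ∏ v : Var n, ∏ w : Var m,
          zetaFactor q d h v.1 w.1 (ratVar K (leftVar n m v)) (ratVar K (rightVar n m w)))

/-- The shuffle product, homogeneous components. -/
def shuffleHom [DecidableEq I] (h : Half) (n m : I → ℕ) :
    RatFun K (Var n) →ₗ[K] RatFun K (Var m) →ₗ[K] RatFun K (Var (n + m)) :=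
  LinearMap.mk₂ K (shuffleFun q d h)
    (by intros; simp [shuffleFun, symmetrize, add_mul, Finset.sum_add_distrib])
    (by
      intro c R R'
      simp only [shuffleFun, symmetrize, map_smul, smul_mul_assoc, ← Finset.smul_sum]
      rw [smul_comm])
    (by intros; simp [shuffleFun, symmetrize, add_mul, mul_add, Finset.sum_add_distrib])
    (by
      intro c R R'
      simp only [shuffleFun, symmetrize, map_smul, smul_mul_assoc, mul_smul_comm,
        ← Finset.smul_sum]
      rw [smul_comm])

/-- The (bilinear) shuffle product `R * R'`, for the structure of `V^+` or of `V^-`. -/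
def shuffleMul [DecidableEq I] (h : Half) : RatSum K I →ₗ[K] RatSum K I →ₗ[K] RatSum K I :=
  DirectSum.toModule K (I → ℕ) _ fun n =>
    LinearMap.flip <| DirectSum.toModule K (I → ℕ) _ fun m =>
      LinearMap.flip <|
        (shuffleHom q d h n m).compr₂
          (DirectSum.lof K (I → ℕ) (fun p => RatFun K (Var p)) (n + m))

variable (K) in
/-- The unit `1` of the shuffle algebras, in degree `0`. -/
def shuffleOne [DecidableEq I] : RatSum K I :=
  DirectSum.lof K (I → ℕ) (fun n => RatFun K (Var n)) 0 1

variable (K) in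
/-- The element `z_{i1}^k`, in degree `ς^i`. -/
def shuffleGen [DecidableEq I] (i : I) (k : ℤ) : RatSum K I :=
  DirectSum.lof K (I → ℕ) (fun n => RatFun K (Var n)) (Pi.single i 1)
    (ratVar K ⟨i, ⟨0, by simp⟩⟩ ^ k)

variable (K) in
/-- A Laurent polynomial which is symmetric in the variables of each colour separately. -/
def IsColourSymmetric [DecidableEq I] {n : I → ℕ} (r : Laurent K (Var n)) : Prop :=
  ∀ g : (∀ i, Equiv.Perm (Fin (n i))),
    laurentSubst (fun v => laurentVar K (colourPerm g v)) r = r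

variable (K) in
/-- The denominator `∏_{i<j} ∏_{a ≤ n_i, b ≤ n_j} (z_{ia} - z_{jb})`. -/
def shuffleDen [LinearOrder I] (n : I → ℕ) : RatFun K (Var n) :=
  ∏ i : I, ∏ j ∈ Finset.univ.filter (fun j => i < j), ∏ a : Fin (n i), ∏ b : Fin (n j),
    (ratVar K ⟨i, a⟩ - ratVar K ⟨j, b⟩)

variable (K) in
/-- `r` is the numerator of `R`: `r` is a colour-symmetric Laurent polynomial and
`R = r / ∏_{i<j} ∏_{a,b} (z_{ia} - z_{jb})`. -/
def IsNumerator [LinearOrder I] {n : I → ℕ} (R : RatFun K (Var n)) (r : Laurent K (Var n)) :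
    Prop :=
  IsColourSymmetric K r ∧ R = laurentToRat K (Var n) r / shuffleDen K n

theorem IsNumerator.zero [LinearOrder I] (n : I → ℕ) :
    IsNumerator K (0 : RatFun K (Var n)) 0 :=
  ⟨fun g => by simp, by simp⟩

theorem IsNumerator.add [LinearOrder I] {n : I → ℕ} {R R' : RatFun K (Var n)}
    {r r' : Laurent K (Var n)} (h : IsNumerator K R r) (h' : IsNumerator K R' r') :
    IsNumerator K (R + R') (r + r') :=
  ⟨fun g => by rw [map_add, h.1 g, h'.1 g], by rw [h.2, h'.2, map_add, add_div]⟩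

theorem IsNumerator.smul [LinearOrder I] {n : I → ℕ} (c : K) {R : RatFun K (Var n)}
    {r : Laurent K (Var n)} (h : IsNumerator K R r) : IsNumerator K (c • R) (c • r) :=
  ⟨fun g => by rw [map_smul, h.1 g], by rw [h.2, map_smul, smul_div_assoc]⟩

variable (K) in
/-- The vector space `V = V^+ = V^-` underlying the big shuffle algebras. -/
def bigShuffle (I : Type*) [Fintype I] [LinearOrder I] : Submodule K (RatSum K I) where
  carrier := {R | ∀ n, ∃ r, IsNumerator K (R n) r}
  zero_mem' n := ⟨0, IsNumerator.zero n⟩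
  add_mem' hR hR' n := by
    obtain ⟨r, hr⟩ := hR n
    obtain ⟨r', hr'⟩ := hR' n
    exact ⟨r + r', hr.add hr'⟩
  smul_mem' c R hR n := by
    obtain ⟨r, hr⟩ := hR n
    exact ⟨c • r, hr.smul c⟩

/-! ### Wheel conditions -/

/-- The pair of progressions `{s, s+2, …, t}_i`, `{s', s'+2, …, t'}_j` is a distinguished zig-zag
of multiplicity `m ≥ 1`; here `c = d_ij`. -/
def IsDistinguished (c s t s' t' : ℤ) (m : ℕ) : Prop :=
  1 ≤ m ∧ ∃ k l : ℕ, (k : ℤ) + l = -c ∧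
    t = s + 2 * (k + m - 1) ∧ t' = s' + 2 * (l + m - 1) ∧
    t' = s - c + 2 * (m - 1) ∧ t = s' - c + 2 * (m - 1)

variable (K) in
/-- The ring of Laurent polynomials in `x`, `y` and in (a copy of) the variables `z_{ia}`. -/
abbrev SpecRing (n : I → ℕ) : Type _ := Laurent K (Bool ⊕ Var n)

/-- The values of the variables under the specialization attached to a zig-zag:
`z_{i1} = x q^s, z_{i2} = x q^{s+2}, …` (ending with `x q^t`) and
`z_{j1} = y q^{s'}, z_{j2} = y q^{s'+2}, …` (ending with `y q^{t'}`), the other variables being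
left untouched. -/
def zigzagValue [DecidableEq I] (n : I → ℕ) (i j : I) (s t s' t' : ℤ) (v : Var n) :
    (SpecRing K n)ˣ :=
  if v.1 = i ∧ s + 2 * (v.2 : ℕ) ≤ t then
    Units.map (algebraMap K (SpecRing K n)).toMonoidHom (q ^ (s + 2 * (v.2 : ℕ))) *
      laurentVar K (Sum.inl false)
  else if v.1 = j ∧ s' + 2 * (v.2 : ℕ) ≤ t' then
    Units.map (algebraMap K (SpecRing K n)).toMonoidHom (q ^ (s' + 2 * (v.2 : ℕ))) *
      laurentVar K (Sum.inl true)
  else laurentVar K (Sum.inr v)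

/-- The wheel conditions on a Laurent polynomial `r` of degree `n`: for any distinguished zig-zag
of multiplicity `m` (with at most `n_i`, respectively `n_j`, vertices of the two colours), the
specialization of `r` is divisible by `(x - y)^m`. -/
def WheelCondition [DecidableEq I] {n : I → ℕ} (r : Laurent K (Var n)) : Prop :=
  ∀ (i j : I) (s t s' t' : ℤ) (m : ℕ), i ≠ j → IsDistinguished (d i j) s t s' t' m →
    t + 2 ≤ s + 2 * n i → t' + 2 ≤ s' + 2 * n j →
      (((laurentVar K (Sum.inl false) : (SpecRing K n)ˣ) : SpecRing K n) -
          ((laurentVar K (Sum.inl true) : (SpecRing K n)ˣ) : SpecRing K n)) ^ m ∣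
        laurentSubst (zigzagValue q n i j s t s' t') r

/-- The wheel subspace `S = S^+ = S^-` of `V`. -/
def wheelShuffle [LinearOrder I] : Submodule K (bigShuffle K I) where
  carrier := {R | ∀ n, ∃ r, IsNumerator K ((R : RatSum K I) n) r ∧ WheelCondition q d r}
  zero_mem' n := ⟨0, IsNumerator.zero n, fun _ _ _ _ _ _ _ _ _ _ _ => by simp⟩
  add_mem' hR hR' n := by
    obtain ⟨r, hr, hw⟩ := hR n
    obtain ⟨r', hr', hw'⟩ := hR' n
    refine ⟨r + r', hr.add hr', fun i j s t s' t' m h₁ h₂ h₃ h₄ => ?_⟩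
    rw [map_add]
    exact dvd_add (hw i j s t s' t' m h₁ h₂ h₃ h₄) (hw' i j s t s' t' m h₁ h₂ h₃ h₄)
  smul_mem' c R hR n := by
    obtain ⟨r, hr, hw⟩ := hR n
    refine ⟨c • r, hr.smul c, fun i j s t s' t' m h₁ h₂ h₃ h₄ => ?_⟩
    rw [map_smul]
    exact (hw i j s t s' t' m h₁ h₂ h₃ h₄).trans (dvd_smul_of_dvd c dvd_rfl)

/-! ### The homomorphisms and the pairings -/

/-- `Υ` is the algebra homomorphism `Ũ_q^±(Lg) → V^±` with `e_{i,k} ↦ z_{i1}^k`, respectively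
`f_{i,k} ↦ z_{i1}^k`. -/
structure IsUpsilon [LinearOrder I] (h : Half) (Υ : QuadAlg q d h →ₗ[K] bigShuffle K I) :
    Prop where
  map_one : (Υ 1 : RatSum K I) = shuffleOne K
  map_mul : ∀ x y, (Υ (x * y) : RatSum K I) = shuffleMul q d h (Υ x) (Υ y)
  map_gen : ∀ i k, (Υ (gen q d h i k) : RatSum K I) = shuffleGen K i k

/-- `P` is the pairing `Ũ_q^+(Lg) ⊗ V^- → K` given by
`⟨e_{i_1,k_1} ⋯ e_{i_N,k_N}, R⟩ = ∫_{|z_1| ≫ ⋯ ≫ |z_N|}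
  z_1^{k_1} ⋯ z_N^{k_N} R(z_1, …, z_N) / ∏_{a<b} ζ_{i_b i_a}(z_b / z_a) ∏ Dz_a`.
The bijection `e` says which variable of `R` is replaced by `z_a`; as it respects the colours,
`n` is the degree `ς^{i_1} + ⋯ + ς^{i_N}`, and only the component of degree `n` of `R`
contributes. -/
def IsPairingUV [LinearOrder I] (P : QuadAlg q d .plus →ₗ[K] bigShuffle K I →ₗ[K] K) : Prop :=
  ∀ (N : ℕ) (i : Fin N → I) (k : Fin N → ℤ) (R : bigShuffle K I) (n : I → ℕ)
    (e : Var n ≃ Fin N), (∀ v, i (e v) = v.1) →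
    P (List.ofFn fun a => gen q d .plus (i a) (k a)).prod R =
      constTerm K (-1)
        (((∏ a, ratVar K a ^ k a) * ratRename K e.toEmbedding ((R : RatSum K I) n)) /
          ∏ a, ∏ b ∈ Finset.univ.filter (fun b => a < b),
            zeta q d (i b) (i a) (ratVar K b / ratVar K a))

/-- `P` is the pairing `V^+ ⊗ Ũ_q^-(Lg) → K` given by
`⟨R, f_{i_1,-k_1} ⋯ f_{i_N,-k_N}⟩ = ∫_{|z_1| ≪ ⋯ ≪ |z_N|}
  z_1^{-k_1} ⋯ z_N^{-k_N} R(z_1, …, z_N) / ∏_{a<b} ζ_{i_a i_b}(z_a / z_b) ∏ Dz_a`,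
with the same conventions as for the other pairing. -/
def IsPairingVU [LinearOrder I] (P : bigShuffle K I →ₗ[K] QuadAlg q d .minus →ₗ[K] K) : Prop :=
  ∀ (N : ℕ) (i : Fin N → I) (k : Fin N → ℤ) (R : bigShuffle K I) (n : I → ℕ)
    (e : Var n ≃ Fin N), (∀ v, i (e v) = v.1) →
    P R (List.ofFn fun a => gen q d .minus (i a) (-k a)).prod =
      constTerm K 1
        (((∏ a, ratVar K a ^ (-k a)) * ratRename K e.toEmbedding ((R : RatSum K I) n)) /
          ∏ a, ∏ b ∈ Finset.univ.filter (fun b => a < b),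
            zeta q d (i a) (i b) (ratVar K a / ratVar K b))

end Shuffle

end QLoop

end

/-!
The pairings turn the product of one algebra into the expansion of a kernel, and the shuffle
product of elements of degree one is the symmetrization of the same kernel. So `⟨x, Υ⁻ y⟩` and `⟨Υ⁺
x, y⟩` can be compared on words `x` and `y`: once the shuffle products are written out
(`wordElement`), both are sums, over pairs of bijections between variables and letters, of constant
terms of the same rational functions, expanded in two different regions. For each pair of
bijections the surviving poles lie along `z_v = q^{-d} z_u` for pairs `u`, `v` whose relative sizes
agree in both regions, and a constant term depends only on the directions in which the poles are
expanded (`constTerm_eq`). This gives the adjunction `⟨x, Υ⁻ y⟩ = ⟨Υ⁺ x, y⟩`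
(`pairing_compatible`). The same property of constant terms makes the pairings well defined: a
quadratic relation between two consecutive letters removes the only factors whose expansion
distinguishes the two orders of these letters (`wordPairing_relation`).

By the adjunction the kernels of `Υ^±` pair to zero with the images of `Υ^∓`, and the two descended
pairings agree. The statements about the wheel conditions therefore follow from the fact that these
conditions cut out precisely the image of `Υ^±` (`IsUpsilon.range_eq`). Multiplied by the product
of all differences of variables, this becomes a statement about Laurent polynomials which are
antisymmetric in the variables of each colour: such a polynomial satisfies the wheel conditions if
and only if it lies in the ideal generated by the products `∏ (z_v - q^{-d} z_u)` over the pairs in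
which `v` comes before `u`, one for each total order of the variables (`orderIdeal_le_wheelIdeal`,
`mem_orderIdeal_of_mem_wheelIdeal`).

The hard inclusion is checked locally at a maximal ideal. The classes of the variables in the
residue field determine integer positions, because `q` is not a root of unity, such that `z_v -
q^{-d} z_u` is invertible unless the positions of `u` and `v` differ by `-d`. The variables can be
partitioned in various ways into strings: variables of one colour at positions `p, p + 2, …, p +
2r`. Each partition gives a subtorus, on which the variables of each string form a geometric
progression. Partitions are treated in order of decreasing spread, the spread being, up to a
constant factor, the sum over the variables of the squared distance to the centre of their string.
If `h` vanishes on the subtori of all partitions of larger spread, then on the subtorus of a given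
partition `h` is divisible by the product belonging to a suitable total order, compatible with the
strings (`stringRes_dvd_of_vanishing`): for two strings of the same colour antisymmetry gives all
factors but at most one, and the last one comes from recombining the two strings into a pair of
larger spread (`exists_rejoin`); for two strings of different colours the required power of `x - y`
is exactly what a wheel condition provides, as the strings contain a distinguished zig-zag of the
right multiplicity (`exists_zigzag`). That product vanishes on the subtori of all other partitions
of at least the same spread (`stringRes_orderProd_eq_zero`), so subtracting multiples of such
products makes `h` vanish on one more subtorus. The last partition is the one into single
variables, whose subtorus is everything.
-/

noncomputable section

set_option linter.unusedSectionVars false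

namespace QLoop

/-! ### Laurent polynomials -/

section LaurentPolynomials

variable {K : Type*} [Field K] {σ τ : Type*} [Fintype σ] [DecidableEq σ]

theorem val_laurentVar (v : σ) :
    ((laurentVar K v : (Laurent K σ)ˣ) : Laurent K σ) =
      AddMonoidAlgebra.single (Pi.single v 1 : σ → ℤ) (1 : K) := rfl

theorem val_laurentVar_zpow (v : σ) (n : ℤ) :
    (((laurentVar K v) ^ n : (Laurent K σ)ˣ) : Laurent K σ) =
      AddMonoidAlgebra.single (n • Pi.single v 1 : σ → ℤ) (1 : K) := by
  rw [laurentVar, ← map_zpow, ← map_zpow, ← ofAdd_zsmul]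
  rfl

theorem single_eq_prod_laurentVar (γ : σ → ℤ) :
    (AddMonoidAlgebra.single γ (1 : K) : Laurent K σ) =
      ((∏ v, laurentVar K v ^ γ v : (Laurent K σ)ˣ) : Laurent K σ) := by
  rw [Units.coe_prod]
  simp_rw [val_laurentVar_zpow]
  rw [AddMonoidAlgebra.prod_single]
  congr 1
  · ext w
    simp [Finset.sum_apply, Pi.single_apply]
  · simp

theorem laurentSubst_single {A : Type*} [CommRing A] [Algebra K A] (u : σ → Aˣ) (γ : σ → ℤ) :
    laurentSubst u (AddMonoidAlgebra.single γ (1 : K)) = ((∏ v, u v ^ γ v : Aˣ) : A) := by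
  rw [laurentSubst, AddMonoidAlgebra.lift_single, one_smul]
  rfl

@[simp]
theorem laurentSubst_laurentVar {A : Type*} [CommRing A] [Algebra K A] (u : σ → Aˣ) (v : σ) :
    laurentSubst u ((laurentVar K v : (Laurent K σ)ˣ) : Laurent K σ) = (u v : A) := by
  rw [val_laurentVar, laurentSubst_single]
  congr 1
  rw [Finset.prod_eq_single v]
  · simp
  · intro w _ hw
    simp [Pi.single_eq_of_ne hw]
  · simp

theorem laurent_algHom_ext {A : Type*} [CommRing A] [Algebra K A]
    {f g : Laurent K σ →ₐ[K] A}
    (h : ∀ v, f ((laurentVar K v : (Laurent K σ)ˣ) : Laurent K σ) =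
      g ((laurentVar K v : (Laurent K σ)ˣ) : Laurent K σ)) : f = g := by
  apply AddMonoidAlgebra.algHom_ext _ (Subsingleton.elim _ _)
  intro γ
  have hu : ∀ v, Units.map f.toRingHom.toMonoidHom (laurentVar K v) =
      Units.map g.toRingHom.toMonoidHom (laurentVar K v) := fun v => Units.ext (h v)
  have hf : ∀ f : Laurent K σ →ₐ[K] A, f (AddMonoidAlgebra.single γ (1 : K)) =
      ((∏ v, Units.map f.toRingHom.toMonoidHom (laurentVar K v) ^ γ v : Aˣ) : A) := by
    intro f
    rw [single_eq_prod_laurentVar]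
    simp_rw [← map_zpow]
    rw [← map_prod]
    rfl
  rw [hf, hf]
  simp_rw [hu]

/-- Every homomorphism out of the Laurent polynomials is a substitution. -/
theorem algHom_laurentSubst {A B : Type*} [CommRing A] [Algebra K A] [CommRing B] [Algebra K B]
    (φ : A →ₐ[K] B) (u : σ → Aˣ) (w : σ → Bˣ) (h : ∀ v, φ (u v : A) = (w v : B))
    (p : Laurent K σ) : φ (laurentSubst u p) = laurentSubst w p := by
  have : φ.comp (laurentSubst u) = laurentSubst w :=
    laurent_algHom_ext fun v => by simp [h]
  exact DFunLike.congr_fun this p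

instance : IsDomain (Laurent K σ) := inferInstance

theorem laurentVar_injective :
    Function.Injective fun v : σ => ((laurentVar K v : (Laurent K σ)ˣ) : Laurent K σ) := by
  intro a b h
  simp only [val_laurentVar] at h
  by_contra hab
  have h1 := AddMonoidAlgebra.single_left_injective (one_ne_zero (α := K)) h
  have := congrFun h1 a
  simp [Pi.single_eq_of_ne hab] at this

/-- The variable `z_v` as an element of the ring of Laurent polynomials. -/
abbrev lvar (K : Type*) [Field K] {σ : Type*} [DecidableEq σ] (v : σ) : Laurent K σ :=
  ((laurentVar K v : (Laurent K σ)ˣ) : Laurent K σ)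

/-- The substitution `z_a ↦ z_b`. -/
def collapse (a b : σ) : Laurent K σ →ₐ[K] Laurent K σ :=
  laurentSubst fun v => if v = a then laurentVar K b else laurentVar K v

theorem collapse_lvar (a b v : σ) :
    collapse a b (lvar K v) = lvar K (if v = a then b else v) := by
  rw [collapse, laurentSubst_laurentVar]
  split_ifs <;> rfl

theorem sub_dvd_iff_collapse (a b : σ) (f : Laurent K σ) :
    lvar K a - lvar K b ∣ f ↔ collapse a b f = 0 := by
  constructor
  · rintro ⟨g, rfl⟩
    rw [map_mul, map_sub, collapse_lvar, collapse_lvar]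
    simp
  · intro h
    have key : (Ideal.Quotient.mkₐ K (Ideal.span {lvar K a - lvar K b})).comp (collapse a b) =
        Ideal.Quotient.mkₐ K (Ideal.span {lvar K a - lvar K b}) := by
      apply laurent_algHom_ext
      intro v
      rw [AlgHom.comp_apply, collapse_lvar]
      split_ifs with hv
      · subst hv
        rw [Ideal.Quotient.mkₐ_eq_mk, Ideal.Quotient.eq, Ideal.mem_span_singleton]
        exact ⟨-1, by ring⟩
      · rfl
    have := DFunLike.congr_fun key f
    rw [AlgHom.comp_apply, h, map_zero] at this
    rw [← Ideal.mem_span_singleton, ← Ideal.Quotient.eq_zero_iff_mem]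
    exact this.symm

theorem lvar_sub_ne_zero {a b : σ} (h : a ≠ b) : lvar K a - lvar K b ≠ 0 :=
  sub_ne_zero.2 fun h' => h (laurentVar_injective h')

theorem prime_lvar_sub {a b : σ} (h : a ≠ b) : Prime (lvar K a - lvar K b) := by
  refine ⟨lvar_sub_ne_zero h, ?_, ?_⟩
  · intro hu
    have := hu.map (collapse a b)
    rw [(sub_dvd_iff_collapse a b _).1 dvd_rfl] at this
    exact not_isUnit_zero this
  · intro f g hfg
    rw [sub_dvd_iff_collapse, map_mul, mul_eq_zero] at hfg
    simpa only [sub_dvd_iff_collapse] using hfg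

theorem not_sub_dvd_sub {a b c d : σ} (hcd : c ≠ d) (h : ¬(a = c ∧ b = d))
    (h' : ¬(a = d ∧ b = c)) : ¬ lvar K a - lvar K b ∣ lvar K c - lvar K d := by
  rw [sub_dvd_iff_collapse, map_sub, collapse_lvar, collapse_lvar]
  apply lvar_sub_ne_zero
  split_ifs <;> simp_all [eq_comm]

theorem prod_prime_pow_dvd {R ι : Type*} [CommRing R] [IsDomain R] [DecidableEq ι]
    (s : Finset ι) (π : ι → R) (N : ι → ℕ) (H : R) (hπ : ∀ i ∈ s, Prime (π i))
    (hne : ∀ i ∈ s, ∀ j ∈ s, i ≠ j → ¬ π i ∣ π j) (h : ∀ i ∈ s, π i ^ N i ∣ H) :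
    ∏ i ∈ s, π i ^ N i ∣ H := by
  induction s using Finset.induction_on with
  | empty => simp
  | insert a s ha ih =>
    obtain ⟨H', rfl⟩ := ih (fun i hi => hπ i (Finset.mem_insert_of_mem hi))
      (fun i hi j hj => hne i (Finset.mem_insert_of_mem hi) j (Finset.mem_insert_of_mem hj))
      (fun i hi => h i (Finset.mem_insert_of_mem hi))
    rw [Finset.prod_insert ha, mul_comm]
    apply mul_dvd_mul_left
    have hpa := hπ a (Finset.mem_insert_self a s)
    refine hpa.pow_dvd_of_dvd_mul_left _ ?_ (h a (Finset.mem_insert_self a s))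
    intro hd
    obtain ⟨i, hi, hdi⟩ := (hpa.dvd_finsetProd_iff _).1 hd
    refine hne a (Finset.mem_insert_self a s) i (Finset.mem_insert_of_mem hi) ?_
      (hpa.dvd_of_dvd_pow hdi)
    rintro rfl
    exact ha hi

end LaurentPolynomials

/-! ### Permutations of the variables and antisymmetric Laurent polynomials -/

section Permutations

variable {K : Type*} [Field K] {σ : Type*} [Fintype σ] [DecidableEq σ]

/-- The action of a permutation of the variables on Laurent polynomials. -/
def permute (g : Equiv.Perm σ) : Laurent K σ →ₐ[K] Laurent K σ :=
  laurentSubst fun v => laurentVar K (g v)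

@[simp]
theorem permute_lvar (g : Equiv.Perm σ) (v : σ) : permute g (lvar K v) = lvar K (g v) := by
  rw [permute, laurentSubst_laurentVar]

theorem permute_permute (g g' : Equiv.Perm σ) (p : Laurent K σ) :
    permute g (permute g' p) = permute (g * g') p :=
  algHom_laurentSubst (permute g) _ _ (fun v => permute_lvar g (g' v)) p

/-- A Laurent polynomial which is antisymmetric under a group of permutations of the variables. -/
def IsAnti (W : Subgroup (Equiv.Perm σ)) (h : Laurent K σ) : Prop :=
  ∀ g ∈ W, permute g h = ((Equiv.Perm.sign g : ℤ) : Laurent K σ) * h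

/-- The product of the differences `z_u - z_v` over the pairs `u`, `v` with the same label under
`f`, each pair being taken in the order given by `e`. -/
def vander (K : Type*) [Field K] {N : ℕ} (e : σ ≃ Fin N) {T : Type*} [DecidableEq T] (f : σ → T) :
    Laurent K σ :=
  ∏ p ∈ Finset.univ.filter (fun p : σ × σ => e p.1 < e p.2 ∧ f p.1 = f p.2),
    (lvar K p.1 - lvar K p.2)

theorem sub_dvd_of_anti [CharZero K] {W : Subgroup (Equiv.Perm σ)} {h : Laurent K σ}
    (hh : IsAnti W h) {u v : σ} (huv : u ≠ v) (hW : Equiv.swap u v ∈ W) :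
    lvar K u - lvar K v ∣ h := by
  rw [sub_dvd_iff_collapse]
  have h1 := congrArg (collapse u v) (hh _ hW)
  have h2 : collapse u v (permute (Equiv.swap u v) h) = collapse u v h := by
    have : (collapse (K := K) u v).comp (permute (Equiv.swap u v)) = collapse u v := by
      apply laurent_algHom_ext
      intro w
      rw [AlgHom.comp_apply, permute_lvar, collapse_lvar, collapse_lvar]
      congr 1
      by_cases h1 : w = u
      · subst h1; simp [huv.symm]
      · by_cases h2 : w = v
        · subst h2; simp [huv.symm]
        · rw [Equiv.swap_apply_of_ne_of_ne h1 h2]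
    exact DFunLike.congr_fun this h
  rw [h2, Equiv.Perm.sign_swap huv] at h1
  simp only [Units.val_neg, Units.val_one, Int.cast_neg, Int.cast_one, map_neg, neg_mul,
    one_mul] at h1
  have h3 : (2 : K) • collapse u v h = 0 := by
    rw [two_smul]
    nth_rewrite 1 [h1]
    simp
  exact (smul_eq_zero.1 h3).resolve_left two_ne_zero

theorem vander_dvd_of_anti [CharZero K] {N : ℕ} (e : σ ≃ Fin N) {T : Type*} [DecidableEq T]
    (f : σ → T) {W : Subgroup (Equiv.Perm σ)} {h : Laurent K σ}
    (hh : IsAnti W h) (hW : ∀ u v, f u = f v → Equiv.swap u v ∈ W) : vander K e f ∣ h := by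
  have := prod_prime_pow_dvd (R := Laurent K σ)
    (Finset.univ.filter (fun p : σ × σ => e p.1 < e p.2 ∧ f p.1 = f p.2))
    (fun p => lvar K p.1 - lvar K p.2) (fun _ => 1) h ?_ ?_ ?_
  · simpa [vander] using this
  · intro p hp
    simp only [Finset.mem_filter, Finset.mem_univ, true_and] at hp
    exact prime_lvar_sub fun h => by simp [h] at hp
  · rintro ⟨a, b⟩ hp ⟨c, d⟩ hp' hne
    simp only [Finset.mem_filter, Finset.mem_univ, true_and] at hp hp'
    apply not_sub_dvd_sub
    · exact fun h => by simp_all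
    · rintro ⟨rfl, rfl⟩; simp at hne
    · rintro ⟨rfl, rfl⟩; exact lt_asymm hp.1 hp'.1
  · rintro ⟨a, b⟩ hp
    simp only [Finset.mem_filter, Finset.mem_univ, true_and] at hp
    rw [pow_one]
    exact sub_dvd_of_anti hh (fun h => hp.1.ne (congrArg e h)) (hW _ _ hp.2)

theorem vander_ne_zero {N : ℕ} (e : σ ≃ Fin N) {T : Type*} [DecidableEq T] (f : σ → T) :
    vander K e f ≠ 0 := by
  apply Finset.prod_ne_zero_iff.2
  intro p hp
  simp only [Finset.mem_filter, Finset.mem_univ, true_and] at hp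
  exact lvar_sub_ne_zero fun h => by simp [h] at hp

/-- Antisymmetrization over a group of permutations of the variables. -/
def antisym (W : Subgroup (Equiv.Perm σ)) [Fintype W] :
    Laurent K σ →ₗ[K] Laurent K σ :=
  ∑ g : W, ((Equiv.Perm.sign (g : Equiv.Perm σ) : ℤ) : K) • (permute (g : Equiv.Perm σ)).toLinearMap

theorem antisym_apply (W : Subgroup (Equiv.Perm σ)) [Fintype W] (h : Laurent K σ) :
    antisym W h = ∑ g : W, ((Equiv.Perm.sign (g : Equiv.Perm σ) : ℤ) : K) •
      permute (g : Equiv.Perm σ) h := by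
  simp [antisym]

theorem intCast_mul_eq_smul (n : ℤ) (h : Laurent K σ) :
    (n : Laurent K σ) * h = (n : K) • h := by
  rw [Algebra.smul_def, map_intCast]

theorem sign_mul_sign (g : Equiv.Perm σ) :
    ((Equiv.Perm.sign g : ℤ) : K) * ((Equiv.Perm.sign g : ℤ) : K) = 1 := by
  rcases Int.units_eq_one_or (Equiv.Perm.sign g) with h | h <;> simp [h]

theorem isAnti_antisym (W : Subgroup (Equiv.Perm σ)) [Fintype W] (h : Laurent K σ) :
    IsAnti W (antisym W h) := by
  intro g hg
  rw [intCast_mul_eq_smul, antisym_apply, map_sum, Finset.smul_sum,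
    ← Equiv.sum_comp (Equiv.mulLeft (⟨g, hg⟩ : W))
      (fun x : W => ((Equiv.Perm.sign g : ℤ) : K) •
        ((Equiv.Perm.sign (x : Equiv.Perm σ) : ℤ) : K) • permute (x : Equiv.Perm σ) h)]
  apply Finset.sum_congr rfl
  intro x _
  rw [map_smul, permute_permute]
  simp only [Equiv.coe_mulLeft, Subgroup.coe_mul, Equiv.Perm.sign_mul, Units.val_mul,
    Int.cast_mul, smul_smul, ← mul_assoc, sign_mul_sign, one_mul]

theorem antisym_of_isAnti {W : Subgroup (Equiv.Perm σ)} [Fintype W] {h : Laurent K σ}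
    (hh : IsAnti W h) : antisym W h = (Fintype.card W : K) • h := by
  rw [antisym_apply]
  have : ∀ g : W, ((Equiv.Perm.sign (g : Equiv.Perm σ) : ℤ) : K) •
      permute (g : Equiv.Perm σ) h = h := by
    intro g
    rw [hh g g.2, intCast_mul_eq_smul, smul_smul, sign_mul_sign, one_smul]
  rw [Finset.sum_congr rfl fun g _ => this g]
  simp [Finset.card_univ, Nat.cast_smul_eq_nsmul]

theorem isAnti_smul {W : Subgroup (Equiv.Perm σ)} (c : K) {h : Laurent K σ} (hh : IsAnti W h) :
    IsAnti W (c • h) := fun g hg => by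
  rw [map_smul, hh g hg, mul_smul_comm]

theorem isAnti_mul {W : Subgroup (Equiv.Perm σ)} {l h : Laurent K σ}
    (hl : ∀ g ∈ W, permute g l = l) (hh : IsAnti W h) : IsAnti W (l * h) := fun g hg => by
  rw [map_mul, hl g hg, hh g hg, mul_left_comm]

end Permutations

/-! ### Partitions into strings -/

section Strings

variable {V : Type*} [Fintype V] [DecidableEq V] {I : Type*} (col : V → I) (s : V → ℤ)

/-- A partition of the set `V` of vertices, each with a colour and an integer position, into
strings: subsets of one colour whose positions are `p, p + 2, …, p + 2r`, each position occurring
once. The partition is recorded by the map `c` sending a vertex to the top vertex of its string. -/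
structure IsStrings (c : V → V) : Prop where
  idem : ∀ u, c (c u) = c u
  col : ∀ u, col (c u) = col u
  inj : ∀ u v, c u = c v → s u = s v → u = v
  top : ∀ u, s u ≤ s (c u)
  even : ∀ u, 2 ∣ s (c u) - s u
  conv : ∀ u v p, c u = c v → s u ≤ p → p ≤ s v → 2 ∣ p - s u → ∃ w, c w = c u ∧ s w = p

variable {col s} {c : V → V}

variable (s c) in
/-- The lowest position of the string of `u`. -/
def low (u : V) : ℤ :=
  (Finset.univ.filter fun v => c v = c u).inf' ⟨u, by simp⟩ s

theorem low_le {u v : V} (h : c v = c u) : low s c u ≤ s v :=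
  Finset.inf'_le _ (by simpa using h)

theorem exists_low (u : V) : ∃ v, c v = c u ∧ s v = low s c u := by
  obtain ⟨v, hv, h⟩ := Finset.exists_mem_eq_inf' (s := Finset.univ.filter fun v => c v = c u)
    ⟨u, by simp⟩ s
  exact ⟨v, by simpa using hv, h.symm⟩

theorem low_congr {u v : V} (h : c u = c v) : low s c u = low s c v := by
  unfold low
  simp_rw [h]

theorem low_eq {u w : V} (hw : c w = c u) (h : ∀ v, c v = c u → s w ≤ s v) :
    low s c u = s w := by
  obtain ⟨v, hv, hv'⟩ := exists_low (s := s) (c := c) u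
  exact le_antisymm (low_le hw) (hv' ▸ h v hv)

variable (s c) in
/-- Twice the centre of the string of `u`. -/
def centre (u : V) : ℤ := low s c u + s (c u)

variable (s c) in
/-- The sum of the squares of (twice) the distances of the vertices to the centres of their
strings. -/
def spread : ℤ := ∑ u, (2 * s u - centre s c u) ^ 2

theorem centre_congr {u v : V} (h : c u = c v) : centre s c u = centre s c v := by
  rw [centre, centre, low_congr h, h]

namespace IsStrings

variable (hc : IsStrings col s c)
include hc

theorem even_of_eq {u v : V} (h : c u = c v) : 2 ∣ s u - s v := by
  have h1 := hc.even u
  have h2 := hc.even v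
  rw [h] at h1
  omega

theorem exists_pos {u : V} {p : ℤ} (h1 : low s c u ≤ p) (h2 : p ≤ s (c u)) (h3 : 2 ∣ p - s u) :
    ∃ w, c w = c u ∧ s w = p := by
  obtain ⟨v, hv, hv'⟩ := exists_low (s := s) (c := c) u
  have h4 := hc.even_of_eq hv
  obtain ⟨w, hw, hw'⟩ := hc.conv v (c u) p (by rw [hv, hc.idem]) (hv' ▸ h1) h2 (by omega)
  exact ⟨w, hw.trans hv, hw'⟩

/-- The reversal of every string. -/
theorem exists_rev : ∃ r : Equiv.Perm V, ∀ u, c (r u) = c u ∧ s (r u) = centre s c u - s u := by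
  have : ∀ u, ∃ w, c w = c u ∧ s w = centre s c u - s u := by
    intro u
    obtain ⟨v, hv, hv'⟩ := exists_low (s := s) (c := c) u
    have h4 := hc.even_of_eq hv
    have h5 := hc.even u
    have h6 := hc.top u
    have h7 : low s c u ≤ s u := low_le rfl
    apply hc.exists_pos <;> unfold centre <;> omega
  choose r hr hr' using this
  have hrr : Function.Involutive r := by
    intro u
    apply hc.inj
    · rw [hr, hr]
    · rw [hr', hr', centre_congr (hr u)]
      ring
  exact ⟨hrr.toPerm, fun u => ⟨hr u, hr' u⟩⟩

theorem sum_const_eq_zero (f : V → ℤ) (hf : ∀ u v, c u = c v → f u = f v) :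
    ∑ u, (2 * s u - centre s c u) * f u = 0 := by
  obtain ⟨r, hr⟩ := hc.exists_rev
  have h := Equiv.sum_comp r fun u => (2 * s u - centre s c u) * f u
  have h2 : ∀ u, (2 * s (r u) - centre s c (r u)) * f (r u) =
      -((2 * s u - centre s c u) * f u) := by
    intro u
    rw [(hr u).2, centre_congr (hr u).1, hf _ _ (hr u).1]
    ring
  simp_rw [h2, Finset.sum_neg_distrib] at h
  omega

/-- Reversal of the strings pairs off the terms of the sum. -/
theorem two_mul_sum (f : V → ℤ) (r : Equiv.Perm V)
    (hr : ∀ u, c (r u) = c u ∧ s (r u) = centre s c u - s u) :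
    2 * ∑ u, (2 * s u - centre s c u) * f u =
      ∑ u, (2 * s u - centre s c u) * (f u - f (r u)) := by
  have h := Equiv.sum_comp r fun u => (2 * s u - centre s c u) * f u
  have h2 : ∀ u, (2 * s (r u) - centre s c (r u)) * f (r u) =
      -((2 * s u - centre s c u) * f (r u)) := by
    intro u
    rw [(hr u).2, centre_congr (hr u).1]
    ring
  simp_rw [h2, Finset.sum_neg_distrib] at h
  simp_rw [mul_sub, Finset.sum_sub_distrib]
  omega

omit hc in
theorem term_nonpos {f : V → ℤ} (hf : ∀ u v, c u = c v → s v ≤ s u → f u ≤ f v)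
    {r : Equiv.Perm V} (hr : ∀ u, c (r u) = c u ∧ s (r u) = centre s c u - s u) (u : V) :
    (2 * s u - centre s c u) * (f u - f (r u)) ≤ 0 := by
  rcases le_total (centre s c u) (2 * s u) with h | h
  · apply mul_nonpos_of_nonneg_of_nonpos (by omega)
    have := hf u (r u) (hr u).1.symm (by rw [(hr u).2]; omega)
    omega
  · apply mul_nonpos_of_nonpos_of_nonneg (by omega)
    have := hf (r u) u (hr u).1 (by rw [(hr u).2]; omega)
    omega

theorem sum_nonpos {f : V → ℤ} (hf : ∀ u v, c u = c v → s v ≤ s u → f u ≤ f v) :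
    ∑ u, (2 * s u - centre s c u) * f u ≤ 0 := by
  obtain ⟨r, hr⟩ := hc.exists_rev
  have h := hc.two_mul_sum f r hr
  have h2 := Finset.sum_nonpos fun u (_ : u ∈ Finset.univ) => term_nonpos hf hr u
  omega

theorem eq_of_sum_eq_zero {f : V → ℤ} (hf : ∀ u v, c u = c v → s v ≤ s u → f u ≤ f v)
    (h0 : ∑ u, (2 * s u - centre s c u) * f u = 0) (u v : V) (huv : c u = c v) : f u = f v := by
  obtain ⟨r, hr⟩ := hc.exists_rev
  have h := hc.two_mul_sum f r hr
  rw [h0, mul_zero] at h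
  have h2 := (Finset.sum_eq_zero_iff_of_nonpos
    fun u (_ : u ∈ Finset.univ) => term_nonpos hf hr u).1 h.symm (c u) (Finset.mem_univ _)
  have key : ∀ w, c w = c u → f w = f (c u) := by
    intro w hw
    have h3 := hf (c u) w (by rw [hc.idem, hw]) (by rw [← hw]; exact hc.top w)
    have hcen := centre_congr (s := s) (hc.idem u)
    have hlow : s (r (c u)) = low s c u := by rw [(hr _).2, hcen]; unfold centre; omega
    have h4 := hf w (r (c u)) (by rw [(hr _).1, hc.idem, hw]) (by rw [hlow]; exact low_le hw)
    have hlw := low_le (s := s) hw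
    have htw := hc.top w
    rw [hw] at htw
    rcases mul_eq_zero.1 h2 with h5 | h5
    · rw [hcen, centre] at h5
      have : w = c u := hc.inj _ _ (by rw [hw, hc.idem]) (by omega)
      rw [this]
    · omega
  rw [key u rfl, key v huv.symm]

end IsStrings

/-- The partitions into strings can be told apart by the order in which the vertices appear when
strings are sorted by their centres: `c'` is another partition whose strings descend in the order
attached to `c`. -/
theorem strings_eq {c' : V → V} (hc : IsStrings col s c) (hc' : IsStrings col s c')
    (idx : V → ℤ) (hidx : ∀ u v, c u = c v ↔ idx u = idx v)
    (hmono : ∀ u v, c' u = c' v → s v ≤ s u → centre s c u ≤ centre s c v)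
    (hmono' : ∀ u v, c' u = c' v → s v ≤ s u → centre s c u = centre s c v → idx u ≤ idx v)
    (hle : spread s c ≤ spread s c') : c' = c := by
  have h1 := hc'.sum_const_eq_zero (centre s c') fun u v h => centre_congr h
  have h2 := hc'.sum_nonpos hmono
  have h3 : spread s c = spread s c' +
      2 * (∑ u, (2 * s u - centre s c' u) * centre s c' u) -
      2 * (∑ u, (2 * s u - centre s c' u) * centre s c u) +
      ∑ u, (centre s c' u - centre s c u) ^ 2 := by
    rw [spread, spread, Finset.mul_sum, Finset.mul_sum, ← Finset.sum_add_distrib,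
      ← Finset.sum_sub_distrib, ← Finset.sum_add_distrib]
    exact Finset.sum_congr rfl fun u _ => by ring
  have h4 : ∑ u, (centre s c' u - centre s c u) ^ 2 = 0 :=
    le_antisymm (by omega) (Finset.sum_nonneg fun u _ => sq_nonneg _)
  have hK : ∀ u, centre s c' u = centre s c u := by
    intro u
    have := (Finset.sum_eq_zero_iff_of_nonneg fun u (_ : u ∈ Finset.univ) =>
      sq_nonneg (centre s c' u - centre s c u)).1 h4 u (Finset.mem_univ _)
    have := pow_eq_zero_iff (two_ne_zero) |>.1 this
    omega
  have h5 := hc.sum_const_eq_zero idx fun u v h => (hidx u v).1 h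
  simp_rw [← hK] at h5
  have h6 : ∀ u v, c' u = c' v → c u = c v := by
    intro u v huv
    rw [hidx]
    exact hc'.eq_of_sum_eq_zero
      (fun u v h h' => hmono' u v h h' (by rw [← hK, ← hK, centre_congr h])) h5 u v huv
  -- The string of `c'` through the top vertex of a string of `c` has the same centre.
  funext u
  have hw : c' (c u) = c u := by
    have h7 := h6 _ _ (hc'.idem (c u))
    rw [hc.idem] at h7
    have h8 := hc.top (c' (c u))
    rw [h7] at h8
    exact hc'.inj _ _ (hc'.idem _) (le_antisymm h8 (hc'.top _))
  have hlow : low s c' (c u) = low s c u := by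
    have h9 := hK (c u)
    rw [centre_congr (hc.idem u), centre, centre, hw] at h9
    omega
  obtain ⟨v, hv, hv'⟩ := hc'.exists_pos (u := c u) (p := s u) (by rw [hlow]; exact low_le rfl)
    (by rw [hw]; exact hc.top u) (by have := hc.even u; omega)
  have h10 := h6 _ _ hv
  rw [hc.idem] at h10
  have : v = u := hc.inj _ _ h10 hv'
  rw [← this, hv, hw, this]

/-- The linear order on the vertices attached to a partition into strings: strings are sorted by
their centres, and the vertices of a string are in descending order. -/
theorem exists_stringOrder (hc : IsStrings col s c) {N : ℕ} (e₀ : V ≃ Fin N) :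
    ∃ e : V ≃ Fin N, (∀ u v, e u ≤ e v → centre s c u ≤ centre s c v) ∧
      (∀ u v, e u ≤ e v → centre s c u = centre s c v → e₀ (c u) ≤ e₀ (c v)) ∧
      (∀ u v, c u = c v → s v < s u → e u < e v) := by
  let key : V → ℤ ×ₗ (Fin N ×ₗ ℤ) := fun u =>
    toLex (centre s c u, toLex (e₀ (c u), -s u))
  have hkey : Function.Injective key := by
    intro u v h
    have h1 := toLex.injective h
    have h2 := toLex.injective (Prod.ext_iff.1 h1).2
    have h3 := Prod.ext_iff.1 h2
    exact hc.inj _ _ (e₀.injective h3.1) (neg_injective h3.2)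
  let _ : LinearOrder V := LinearOrder.lift' key hkey
  have hcard : Fintype.card V = N := by simpa using Fintype.card_congr e₀
  let e := (Fintype.orderIsoFinOfCardEq V hcard).symm
  have he : ∀ u v, e u ≤ e v ↔ key u ≤ key v := fun u v => by
    rw [e.le_iff_le]; rfl
  refine ⟨e.toEquiv, ?_, ?_, ?_⟩
  · intro u v h
    have := (he u v).1 h
    rw [Prod.Lex.toLex_le_toLex] at this
    rcases this with h | h
    · exact h.le
    · exact h.1.le
  · intro u v h h'
    have := (he u v).1 h
    rw [Prod.Lex.toLex_le_toLex] at this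
    rcases this with h | h
    · exact absurd h' h.ne
    · have := h.2
      rw [Prod.Lex.toLex_le_toLex] at this
      rcases this with h | h
      · exact h.le
      · exact h.1.le
  · intro u v h h'
    by_contra hn
    have := (he v u).1 (not_lt.1 hn)
    rw [Prod.Lex.toLex_le_toLex] at this
    rcases this with h1 | h1
    · exact h1.ne (centre_congr h).symm
    · have := h1.2
      rw [Prod.Lex.toLex_le_toLex] at this
      rcases this with h2 | h2
      · simp [h] at h2
      · have := h2.2
        simp only at this
        omega

theorem strings_eq_of_order {c' : V → V} (hc : IsStrings col s c) (hc' : IsStrings col s c')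
    {N : ℕ} {e₀ e : V ≃ Fin N} (he1 : ∀ u v, e u ≤ e v → centre s c u ≤ centre s c v)
    (he2 : ∀ u v, e u ≤ e v → centre s c u = centre s c v → e₀ (c u) ≤ e₀ (c v))
    (hdesc : ∀ u v, c' u = c' v → s v = s u - 2 → e u < e v)
    (hle : spread s c ≤ spread s c') : c' = c := by
  have key : ∀ (n : ℕ) (u v : V), c' u = c' v → s u = s v + 2 * n → e u ≤ e v := by
    intro n
    induction n with
    | zero =>
      intro u v h h'
      rw [hc'.inj u v h (by simpa using h')]
    | succ n ih =>
      intro u v h h'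
      push_cast at h'
      obtain ⟨w, hw, hw'⟩ := hc'.conv v u (s v + 2) h.symm (by omega) (by omega) (by simp)
      exact (ih u w (by rw [h, hw]) (by omega)).trans (hdesc w v hw (by omega)).le
  have key' : ∀ u v, c' u = c' v → s v ≤ s u → e u ≤ e v := by
    intro u v h h'
    obtain ⟨n, hn⟩ := hc'.even_of_eq h
    exact key n.toNat u v h (by omega)
  refine strings_eq hc hc' (fun u => ((e₀ (c u) : ℕ) : ℤ)) (fun u v => ?_)
    (fun u v h h' => he1 _ _ (key' u v h h')) (fun u v h h' h'' => ?_) hle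
  · constructor
    · intro h; simp [h]
    · intro h
      exact e₀.injective (Fin.ext (by exact_mod_cast h))
  · exact_mod_cast he2 _ _ (key' u v h h') h''

end Strings

/-! ### Pairs of strings -/

section PairsOfStrings

variable {V : Type*} [Fintype V] [DecidableEq V] {I : Type*} {col : V → I} {s : V → ℤ} {c : V → V}

variable (s c) in
/-- The pairs of a vertex of the string of `b` and a vertex of the string of `a`, at positions
differing by `D`. -/
def pairsAt (b a : V) (D : ℤ) : Finset (V × V) :=
  Finset.univ.filter fun p => c p.1 = c b ∧ c p.2 = c a ∧ s p.2 = s p.1 + D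

theorem mem_pairsAt {b a : V} {D : ℤ} {p : V × V} :
    p ∈ pairsAt s c b a D ↔ c p.1 = c b ∧ c p.2 = c a ∧ s p.2 = s p.1 + D := by
  simp [pairsAt]

theorem card_le_of_positions (hc : IsStrings col s c) {b a : V} {D x : ℤ} {m : ℕ}
    (h : ∀ p ∈ pairsAt s c b a D, x ≤ s p.1 ∧ s p.1 ≤ x + 2 * (m - 1) ∧ 2 ∣ s p.1 - x) :
    (pairsAt s c b a D).card ≤ m := by
  rw [← Finset.card_range m]
  apply Finset.card_le_card_of_injOn fun p => ((s p.1 - x) / 2).toNat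
  · intro p hp
    have := h p hp
    simp only [Finset.coe_range, Set.mem_Iio]
    omega
  · intro p hp p' hp' hpp
    have h1 := h p hp
    have h2 := h p' hp'
    simp only at hpp
    have h3 : s p.1 = s p'.1 := by omega
    have h4 := mem_pairsAt.1 hp
    have h5 := mem_pairsAt.1 hp'
    exact Prod.ext (hc.inj _ _ (h4.1.trans h5.1.symm) h3)
      (hc.inj _ _ (h4.2.1.trans h5.2.1.symm) (by omega))

/-- Two strings contain a distinguished zig-zag whose multiplicity is at least the number of pairs
of a vertex of the string of `b` and a vertex of the string of `a` which is higher by `D`, if the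
string of `b` has the higher centre. -/
theorem exists_zigzag (hc : IsStrings col s c) {a b : V} {D : ℕ}
    (hK : centre s c a ≤ centre s c b) :
    pairsAt s c b a D = ∅ ∨
    ∃ (k l m : ℕ) (x y : ℤ), 1 ≤ m ∧ x + 2 * k = y + D ∧ y + 2 * l = x + D ∧
      (∀ j < k + m, ∃ w, c w = c b ∧ s w = x + 2 * j) ∧
      (∀ j < l + m, ∃ w, c w = c a ∧ s w = y + 2 * j) ∧ (pairsAt s c b a D).card ≤ m := by
  rcases (pairsAt s c b a D).eq_empty_or_nonempty with h | h
  · exact Or.inl h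
  right
  obtain ⟨p₀, hp₀, hmin⟩ := Finset.exists_min_image _ (fun p => s p.1) h
  obtain ⟨p₁, hp₁, hmax⟩ := Finset.exists_max_image _ (fun p => s p.1) h
  have h0 := mem_pairsAt.1 hp₀
  have h1 := mem_pairsAt.1 hp₁
  have hle := hmin _ hp₁
  have ev := hc.even_of_eq (h1.1.trans h0.1.symm)
  have eva := hc.even_of_eq h0.2.1
  obtain ⟨a₀, ha₀, ha₀'⟩ := exists_low (s := s) (c := c) a
  obtain ⟨b₀, hb₀, hb₀'⟩ := exists_low (s := s) (c := c) b
  have ea := hc.even_of_eq (ha₀.trans h0.2.1.symm)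
  have eb := hc.even_of_eq (hb₀.trans h0.1.symm)
  have ea' := hc.even a
  have eb' := hc.even b
  have ea'' := hc.even_of_eq (h0.2.1)
  have eb'' := hc.even_of_eq (h0.1)
  have la : low s c a ≤ s p₀.2 := low_le h0.2.1
  have lb : low s c b ≤ s p₀.1 := low_le h0.1
  have ta := hc.top p₁.2
  rw [h1.2.1] at ta
  have tb := hc.top p₁.1
  rw [h1.1] at tb
  unfold centre at hK
  obtain ⟨y, hy⟩ : ∃ y, y = max (low s c a) (s p₀.1 - D) := ⟨_, rfl⟩
  have hy1 : low s c a ≤ y ∧ s p₀.1 - D ≤ y ∧ y ≤ s p₀.1 + D ∧ 2 ∣ y - (s p₀.1 + D) ∧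
      y ≤ s (c b) - s p₁.2 + s p₀.1 := by
    rcases max_choice (low s c a) (s p₀.1 - D) with h | h <;> omega
  refine ⟨((y + D - s p₀.1) / 2).toNat, ((s p₀.1 + D - y) / 2).toNat,
    ((s p₁.1 - s p₀.1) / 2).toNat + 1, s p₀.1, y, by omega, by omega, by omega, ?_, ?_, ?_⟩
  · intro j hj
    apply hc.exists_pos <;> omega
  · intro j hj
    apply hc.exists_pos <;> omega
  · apply card_le_of_positions hc (x := s p₀.1)
    intro p hp
    have h2 := mem_pairsAt.1 hp
    have h3 := hmin p hp
    have h4 := hmax p hp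
    have h5 := hc.even_of_eq (h2.1.trans h0.1.symm)
    omega

/-- Shifting one of two strings down by one step does not create overlaps, except by one vertex if
the strings are staggered. -/
theorem card_pairsAt_le (hc : IsStrings col s c) (a b : V) :
    (pairsAt s c b a (-2)).card ≤ (pairsAt s c b a 0).card ∨
    ((pairsAt s c b a (-2)).card ≤ (pairsAt s c b a 0).card + 1 ∧
      low s c a < low s c b ∧ s (c a) < s (c b) ∧ low s c b ≤ s (c a) + 2 ∧
      2 ∣ s (c b) - s (c a)) := by
  -- Pairs of the first kind, except those with the top vertex of `a`, are sent to the pair of the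
  -- second kind with the same first vertex.
  have hinj : Set.InjOn (fun p : V × V => p.1) (pairsAt s c b a 0) := by
    intro p hp p' hp' h
    have h4 := mem_pairsAt.1 hp
    have h5 := mem_pairsAt.1 hp'
    have h6 : p.1 = p'.1 := h
    exact Prod.ext h6 (hc.inj _ _ (h4.2.1.trans h5.2.1.symm) (by rw [h4.2.2, h5.2.2, h6]))
  have hinj' : Set.InjOn (fun p : V × V => p.1) (pairsAt s c b a (-2)) := by
    intro p hp p' hp' h
    have h4 := mem_pairsAt.1 hp
    have h5 := mem_pairsAt.1 hp'
    have h6 : p.1 = p'.1 := h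
    exact Prod.ext h6 (hc.inj _ _ (h4.2.1.trans h5.2.1.symm) (by rw [h4.2.2, h5.2.2, h6]))
  rw [← Finset.card_image_of_injOn hinj, ← Finset.card_image_of_injOn hinj']
  set A := (pairsAt s c b a (-2)).image fun p => p.1 with hA
  set B := (pairsAt s c b a 0).image fun p => p.1 with hB
  have memA : ∀ u, u ∈ A ↔ c u = c b ∧ ∃ v, c v = c a ∧ s v = s u - 2 := by
    intro u
    simp only [hA, Finset.mem_image, mem_pairsAt, Prod.exists]
    constructor
    · rintro ⟨u, v, h, rfl⟩; exact ⟨h.1, v, h.2.1, by omega⟩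
    · rintro ⟨h, v, h', h''⟩; exact ⟨u, v, ⟨h, h', by show s v = s u + -2; omega⟩, rfl⟩
  have memB : ∀ u, u ∈ B ↔ c u = c b ∧ ∃ v, c v = c a ∧ s v = s u := by
    intro u
    simp only [hB, Finset.mem_image, mem_pairsAt, Prod.exists]
    constructor
    · rintro ⟨u, v, h, rfl⟩; exact ⟨h.1, v, h.2.1, by omega⟩
    · rintro ⟨h, v, h', h''⟩; exact ⟨u, v, ⟨h, h', by show s v = s u + 0; omega⟩, rfl⟩
  have hAB : ∀ u ∈ A, s u ≠ s (c a) + 2 → u ∈ B := by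
    intro u hu hne
    obtain ⟨hu1, v, hv, hv'⟩ := (memA u).1 hu
    rw [memB]
    refine ⟨hu1, ?_⟩
    have h1 := hc.top v
    have h2 := hc.even v
    rw [hv] at h1 h2
    obtain ⟨w, hw, hw'⟩ := hc.exists_pos (u := a) (p := s u)
      ((low_le hv).trans (by omega)) (by omega) (by have := hc.even_of_eq hv; omega)
    exact ⟨w, hw, hw'⟩
  by_cases hex : ∃ u₀ ∈ A, s u₀ = s (c a) + 2
  · obtain ⟨u₀, hu₀, hs₀⟩ := hex
    obtain ⟨hu1, v, hv, hv'⟩ := (memA u₀).1 hu₀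
    have hsub : A.erase u₀ ⊆ B := by
      intro u hu
      rw [Finset.mem_erase] at hu
      apply hAB u hu.2
      intro h
      exact hu.1 (hc.inj _ _ (((memA u).1 hu.2).1.trans hu1.symm) (by omega))
    have hcard := Finset.card_erase_add_one hu₀
    have h1 := hc.top u₀
    have h2 := hc.even u₀
    rw [hu1] at h1 h2
    have h3 : low s c b ≤ s u₀ := low_le hu1
    by_cases hlow : low s c a < low s c b
    · right
      exact ⟨hcard ▸ Nat.succ_le_succ (Finset.card_le_card hsub), hlow, by omega, by omega,
        by omega⟩
    · left
      obtain ⟨a₀, ha₀, ha₀'⟩ := exists_low (s := s) (c := c) a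
      have h4 := hc.top a₀
      have h5 := hc.even a₀
      rw [ha₀] at h4 h5
      obtain ⟨w, hw, hw'⟩ := hc.exists_pos (u := u₀) (p := s a₀)
        (by rw [low_congr hu1]; omega) (by rw [hu1]; omega) (by omega)
      have hwB : w ∈ B := (memB w).2 ⟨hw.trans hu1, a₀, ha₀, hw'.symm⟩
      have hwA : w ∉ A := by
        intro h
        obtain ⟨_, x, hx, hx'⟩ := (memA w).1 h
        have : low s c a ≤ s x := low_le hx
        omega
      have h6 : A.erase u₀ ⊆ B.erase w := by
        intro u hu
        rw [Finset.mem_erase]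
        refine ⟨?_, hsub hu⟩
        rintro rfl
        exact hwA (Finset.mem_of_mem_erase hu)
      have h7 := Finset.card_le_card h6
      have h8 := Finset.card_erase_add_one hwB
      omega
  · left
    push Not at hex
    exact Finset.card_le_card fun u hu => hAB u hu (hex u hu)

theorem two_mul_card_segment (hc : IsStrings col s c) (a : V) {p q : ℤ} (h1 : low s c a ≤ p)
    (h2 : q ≤ s (c a)) (h3 : p ≤ q + 2) (h4 : 2 ∣ p - s a) (h5 : 2 ∣ q - s a) :
    2 * ((Finset.univ.filter fun u => c u = c a ∧ p ≤ s u ∧ s u ≤ q).card : ℤ) = q - p + 2 := by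
  have hinj : Set.InjOn s (Finset.univ.filter fun u => c u = c a ∧ p ≤ s u ∧ s u ≤ q) := by
    intro u hu v hv h
    simp only [Finset.coe_filter, Finset.mem_univ, true_and, Set.mem_ofPred_eq] at hu hv
    exact hc.inj _ _ (hu.1.trans hv.1.symm) h
  obtain ⟨n, hn⟩ : ∃ n : ℕ, q = p + 2 * n - 2 := ⟨((q - p + 2) / 2).toNat, by omega⟩
  have himg : (Finset.univ.filter fun u => c u = c a ∧ p ≤ s u ∧ s u ≤ q).image s =
      (Finset.range n).image fun j : ℕ => p + 2 * (j : ℤ) := by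
    ext x
    simp only [Finset.mem_image, Finset.mem_filter, Finset.mem_univ, true_and, Finset.mem_range]
    constructor
    · rintro ⟨u, hu, rfl⟩
      have := hc.even_of_eq hu.1
      exact ⟨((s u - p) / 2).toNat, by omega, by omega⟩
    · rintro ⟨j, hj, rfl⟩
      obtain ⟨w, hw, hw'⟩ := hc.exists_pos (u := a) (p := p + 2 * j) (by omega) (by omega)
        (by omega)
      exact ⟨w, ⟨hw, by omega, by omega⟩, hw'⟩
  rw [← Finset.card_image_of_injOn hinj, himg, Finset.card_image_of_injective _
    (fun i j h => by simpa using h), Finset.card_range]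
  omega

/-- Two staggered strings of the same colour can be rearranged into a longer and a shorter one
(possibly empty), which increases the spread. -/
theorem exists_rejoin (hc : IsStrings col s c) {a b : V} (hcol : col a = col b)
    (h1 : low s c a < low s c b) (h2 : s (c a) < s (c b)) (h3 : low s c b ≤ s (c a) + 2)
    (h4 : 2 ∣ s (c b) - s (c a)) :
    ∃ c', IsStrings col s c' ∧ spread s c < spread s c' ∧
      ∀ u, (if c (c' u) = c a then c b else c (c' u)) = if c u = c a then c b else c u := by
  have hab : c a ≠ c b := fun h => by rw [h] at h2; exact lt_irrefl _ h2
  obtain ⟨a₀, ha₀, ha₀'⟩ := exists_low (s := s) (c := c) a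
  obtain ⟨b₀, hb₀, hb₀'⟩ := exists_low (s := s) (c := c) b
  have ea := hc.even a
  have eb := hc.even b
  have ea₀ := hc.even_of_eq ha₀
  have eb₀ := hc.even_of_eq hb₀
  have eva : ∀ u, c u = c a → 2 ∣ s u - s a := fun u h => hc.even_of_eq h
  have evb : ∀ u, c u = c b → 2 ∣ s u - s b := fun u h => hc.even_of_eq h
  have lea : ∀ u, c u = c a → low s c a ≤ s u ∧ s u ≤ s (c a) := fun u h =>
    ⟨low_le h, h ▸ hc.top u⟩
  have leb : ∀ u, c u = c b → low s c b ≤ s u ∧ s u ≤ s (c b) := fun u h =>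
    ⟨low_le h, h ▸ hc.top u⟩
  have la : low s c a ≤ s (c a) := (lea a rfl).1.trans (lea a rfl).2
  -- `w` is the top vertex of the lower part of the string of `b`, if there is one.
  obtain ⟨w, hw⟩ : ∃ w, low s c b ≤ s (c a) → c w = c b ∧ s w = s (c a) := by
    by_cases h : low s c b ≤ s (c a)
    · obtain ⟨w, hw⟩ := hc.exists_pos (u := b) (p := s (c a)) h h2.le (by omega)
      exact ⟨w, fun _ => hw⟩
    · exact ⟨a, fun h' => absurd h' h⟩
  let c' : V → V := fun u =>
    if c u = c a then c b else if c u = c b then (if s (c a) < s u then c b else w) else c u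
  have ca : ∀ u, c u = c a → c' u = c b := fun u h => if_pos h
  have cb1 : ∀ u, c u = c b → s (c a) < s u → c' u = c b := fun u h h' => by
    simp only [c', h, hab.symm, if_false, if_true, h']
  have cb2 : ∀ u, c u = c b → s u ≤ s (c a) → c' u = w ∧ c w = c b ∧ s w = s (c a) :=
    fun u h h' => by
      simp only [c', h, hab.symm, if_false, if_true, not_lt.2 h', true_and]
      exact hw ((leb u h).1.trans h')
  have cn : ∀ u, c u ≠ c a → c u ≠ c b → c' u = c u := fun u h h' => by
    simp only [c', h, h', if_false]
  -- The possible positions of a vertex.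
  have cases4 : ∀ u, (c u = c a ∧ c' u = c b) ∨ (c u = c b ∧ s (c a) < s u ∧ c' u = c b) ∨
      (c u = c b ∧ s u ≤ s (c a) ∧ c' u = w ∧ c w = c b ∧ s w = s (c a)) ∨
      (c u ≠ c a ∧ c u ≠ c b ∧ c' u = c u) := by
    intro u
    by_cases h : c u = c a
    · exact Or.inl ⟨h, ca u h⟩
    · by_cases h' : c u = c b
      · rcases lt_or_ge (s (c a)) (s u) with h'' | h''
        · exact Or.inr (Or.inl ⟨h', h'', cb1 u h' h''⟩)
        · exact Or.inr (Or.inr (Or.inl ⟨h', h'', cb2 u h' h''⟩))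
      · exact Or.inr (Or.inr (Or.inr ⟨h, h', cn u h h'⟩))
  have hcb : c (c b) = c b := hc.idem b
  have hccb : c' (c b) = c b := cb1 _ hcb h2
  -- The vertices of the longer string.
  have out : ∀ u, c' u = c b → c u = c a ∨ (c u = c b ∧ s (c a) < s u) := by
    intro u hu
    rcases cases4 u with h | h | h | h
    · exact Or.inl h.1
    · exact Or.inr ⟨h.1, h.2.1⟩
    · have := h.2.2.1.symm.trans hu
      rw [this] at h
      omega
    · exact absurd (hu.symm.trans h.2.2) h.2.1.symm
  have inn : ∀ u, c' u = w → c w = c b → s w = s (c a) → c u = c b ∧ s u ≤ s (c a) := by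
    intro u hu hw1 hw2
    rcases cases4 u with h | h | h | h
    · have := h.2.symm.trans hu
      rw [← this] at hw2
      omega
    · have := h.2.2.symm.trans hu
      rw [← this] at hw2
      omega
    · exact ⟨h.1, h.2.1⟩
    · have := h.2.2.symm.trans hu
      rw [← this, hc.idem] at hw1
      exact absurd hw1 h.2.1
  have oth : ∀ u v, c u ≠ c a → c u ≠ c b → c' v = c u → c v = c u := by
    intro u v hu1 hu2 hv
    rcases cases4 v with h | h | h | h
    · exact absurd (hv.symm.trans h.2) hu2
    · exact absurd (hv.symm.trans h.2.2) hu2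
    · have := hv.symm.trans h.2.2.1
      rw [← this, hc.idem] at h
      exact absurd h.2.2.2.1 hu2
    · exact h.2.2.symm.trans hv
  have hstr : IsStrings col s c' := by
    refine ⟨?_, ?_, ?_, ?_, ?_, ?_⟩
    · intro u
      rcases cases4 u with h | h | h | h
      · rw [h.2, hccb]
      · rw [h.2.2, hccb]
      · rw [h.2.2.1]; exact (cb2 w h.2.2.2.1 h.2.2.2.2.le).1
      · rw [h.2.2, cn _ (by rw [hc.idem]; exact h.1) (by rw [hc.idem]; exact h.2.1), hc.idem]
    · intro u
      have hu := hc.col u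
      rcases cases4 u with h | h | h | h
      · rw [h.2, hc.col, ← hu, h.1, hc.col, hcol]
      · rw [h.2.2, hc.col, ← hu, h.1, hc.col]
      · rw [h.2.2.1, ← hc.col w, h.2.2.2.1, ← hu, h.1]
      · rw [h.2.2, hu]
    · intro u v huv hs
      rcases cases4 u with h | h | h | h
      · rcases out v (huv.symm.trans h.2) with h' | h'
        · exact hc.inj _ _ (h.1.trans h'.symm) hs
        · have := lea u h.1; omega
      · rcases out v (huv.symm.trans h.2.2) with h' | h'
        · have := lea v h'; omega
        · exact hc.inj _ _ (h.1.trans h'.1.symm) hs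
      · have h' := inn v (huv.symm.trans h.2.2.1) h.2.2.2.1 h.2.2.2.2
        exact hc.inj _ _ (h.1.trans h'.1.symm) hs
      · exact hc.inj _ _ (oth u v h.1 h.2.1 (huv.symm.trans h.2.2)).symm hs
    · intro u
      have hu := hc.top u
      rcases cases4 u with h | h | h | h
      · rw [h.2]; rw [h.1] at hu; omega
      · rw [h.2.2]; rw [h.1] at hu; omega
      · rw [h.2.2.1, h.2.2.2.2]; exact h.2.1
      · rw [h.2.2]; exact hu
    · intro u
      have hu := hc.even u
      rcases cases4 u with h | h | h | h
      · rw [h.2]; rw [h.1] at hu; omega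
      · rw [h.2.2]; rw [h.1] at hu; omega
      · rw [h.2.2.1, h.2.2.2.2]; have := evb u h.1; omega
      · rw [h.2.2]; exact hu
    · intro u v p huv hup hpv hp
      have aux : c' u = c b → ∃ w, c' w = c' u ∧ s w = p := by
        intro hu
        have hu' := out u hu
        have hv' := out v (huv.symm.trans hu)
        have hup2 : 2 ∣ p - s a ∧ 2 ∣ p - s b := by
          rcases hu' with h | h
          · have := eva u h; omega
          · have := evb u h.1; omega
        rcases le_or_gt p (s (c a)) with hpa | hpa
        · obtain ⟨x, hx, hx'⟩ := hc.exists_pos (u := a) (p := p)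
            (by
              rcases hu' with h | h
              · have := lea u h; omega
              · omega) hpa hup2.1
          exact ⟨x, by rw [ca x hx, hu], hx'⟩
        · obtain ⟨x, hx, hx'⟩ := hc.exists_pos (u := b) (p := p) (by omega)
            (by
              rcases hv' with h | h
              · have := lea v h; omega
              · have := leb v h.1; omega) hup2.2
          exact ⟨x, by rw [cb1 x hx (by omega), hu], hx'⟩
      rcases cases4 u with h | h | h | h
      · exact aux h.2
      · exact aux h.2.2
      · have h' := inn v (huv.symm.trans h.2.2.1) h.2.2.2.1 h.2.2.2.2
        obtain ⟨x, hx, hx'⟩ := hc.conv u v p (h.1.trans h'.1.symm) hup hpv hp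
        exact ⟨x, by rw [(cb2 x (hx.trans h.1) (by omega)).1, h.2.2.1], hx'⟩
      · have h' := oth u v h.1 h.2.1 (huv.symm.trans h.2.2)
        obtain ⟨x, hx, hx'⟩ := hc.conv u v p h'.symm hup hpv hp
        exact ⟨x, by rw [cn x (hx ▸ h.1) (hx ▸ h.2.1), h.2.2, hx], hx'⟩
  refine ⟨c', hstr, ?_, ?_⟩
  · -- The centres of the new strings.
    have Kout : ∀ u, c' u = c b → centre s c' u = low s c a + s (c b) := by
      intro u hu
      rw [centre, hu, low_eq (w := a₀) (by rw [ca a₀ ha₀, hu]), ha₀']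
      intro v hv
      rcases out v (hv.trans hu) with h | h
      · rw [ha₀']; exact low_le h
      · omega
    have Kinn : ∀ u, c u = c b → s u ≤ s (c a) → centre s c' u = low s c b + s (c a) := by
      intro u hu hu'
      obtain ⟨h5, h6, h7⟩ := cb2 u hu hu'
      have := leb u hu
      rw [centre, h5, low_eq (w := b₀) (by rw [(cb2 b₀ hb₀ (by omega)).1, h5]), hb₀', h7]
      intro v hv
      rw [hb₀']
      exact low_le (inn v (hv.trans h5) h6 h7).1
    have Koth : ∀ u, c u ≠ c a → c u ≠ c b → centre s c' u = centre s c u := by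
      intro u hu hu'
      obtain ⟨u₀, hu₀, hu₀'⟩ := exists_low (s := s) (c := c) u
      rw [centre, centre, cn u hu hu', low_eq (w := u₀)
        (by rw [cn u₀ (hu₀ ▸ hu) (hu₀ ▸ hu'), cn u hu hu', hu₀]), hu₀']
      intro v hv
      rw [hu₀']
      exact low_le (oth u v hu hu' (hv.trans (cn u hu hu')))
    -- The spread is a constant minus the sum of the squares of the centres.
    have hspread : ∀ {c : V → V}, IsStrings col s c →
        spread s c = ∑ u, 4 * s u ^ 2 - ∑ u, centre s c u ^ 2 := by
      intro c hc
      have := hc.sum_const_eq_zero (centre s c) fun u v h => centre_congr h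
      have h5 : spread s c = ∑ u, 4 * s u ^ 2 - ∑ u, centre s c u ^ 2 -
          2 * ∑ u, (2 * s u - centre s c u) * centre s c u := by
        rw [spread, Finset.mul_sum, ← Finset.sum_sub_distrib, ← Finset.sum_sub_distrib]
        exact Finset.sum_congr rfl fun u _ => by ring
      omega
    rw [hspread hc, hspread hstr]
    apply sub_lt_sub_left
    have c1 := two_mul_card_segment hc a (p := low s c a) (q := s (c a)) le_rfl le_rfl
      (by omega) (by omega) (by omega)
    have c2 := two_mul_card_segment hc b (p := s (c a) + 2) (q := s (c b)) (by omega) le_rfl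
      (by omega) (by omega) (by omega)
    have c3 := two_mul_card_segment hc b (p := low s c b) (q := s (c a)) le_rfl h2.le
      (by omega) (by omega) (by omega)
    set A := Finset.univ.filter fun u => c u = c a ∧ low s c a ≤ s u ∧ s u ≤ s (c a)
    set B := Finset.univ.filter fun u => c u = c b ∧ s (c a) + 2 ≤ s u ∧ s u ≤ s (c b)
    set C := Finset.univ.filter fun u => c u = c b ∧ low s c b ≤ s u ∧ s u ≤ s (c a)
    have hterm : ∀ u, centre s c' u ^ 2 = centre s c u ^ 2 +
        ((if u ∈ A then (low s c a + s (c b)) ^ 2 - (low s c a + s (c a)) ^ 2 else 0) +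
        (if u ∈ B then (low s c a + s (c b)) ^ 2 - (low s c b + s (c b)) ^ 2 else 0) +
        (if u ∈ C then (low s c b + s (c a)) ^ 2 - (low s c b + s (c b)) ^ 2 else 0)) := by
      intro u
      have hA : u ∈ A ↔ c u = c a := by
        simp only [A, Finset.mem_filter, Finset.mem_univ, true_and]
        exact ⟨fun h => h.1, fun h => ⟨h, lea u h⟩⟩
      have hB : u ∈ B ↔ c u = c b ∧ s (c a) < s u := by
        simp only [B, Finset.mem_filter, Finset.mem_univ, true_and]
        exact ⟨fun h => ⟨h.1, by omega⟩, fun h =>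
          ⟨h.1, by have := evb u h.1; omega, (leb u h.1).2⟩⟩
      have hC : u ∈ C ↔ c u = c b ∧ s u ≤ s (c a) := by
        simp only [C, Finset.mem_filter, Finset.mem_univ, true_and]
        exact ⟨fun h => ⟨h.1, h.2.2⟩, fun h => ⟨h.1, (leb u h.1).1, h.2⟩⟩
      rcases cases4 u with h | h | h | h
      · rw [if_pos (hA.2 h.1), if_neg (fun h' => hab (h.1.symm.trans (hB.1 h').1)),
          if_neg (fun h' => hab (h.1.symm.trans (hC.1 h').1)), Kout u h.2,
          centre_congr (show c u = c a from h.1), centre]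
        ring
      · rw [if_neg (fun h' => hab ((hA.1 h').symm.trans h.1)), if_pos (hB.2 ⟨h.1, h.2.1⟩),
          if_neg (fun h' => absurd (hC.1 h').2 (by omega)), Kout u h.2.2,
          centre_congr (show c u = c b from h.1), centre]
        ring
      · rw [if_neg (fun h' => hab ((hA.1 h').symm.trans h.1)),
          if_neg (fun h' => absurd (hB.1 h').2 (by omega)), if_pos (hC.2 ⟨h.1, h.2.1⟩),
          Kinn u h.1 h.2.1, centre_congr (show c u = c b from h.1), centre]
        ring
      · rw [if_neg (fun h' => h.1 (hA.1 h')), if_neg (fun h' => h.2.1 (hB.1 h').1),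
          if_neg (fun h' => h.2.1 (hC.1 h').1), Koth u h.1 h.2.1]
        ring
    simp_rw [hterm, Finset.sum_add_distrib, Finset.sum_ite_mem, Finset.univ_inter,
      Finset.sum_const, nsmul_eq_mul]
    have hneg : 0 < (s (c b) - s (c a)) * (low s c b - low s c a) *
        (s (c a) + s (c b) - low s c a - low s c b + 4) := by
      apply mul_pos (mul_pos _ _) <;> omega
    have : 2 * ((A.card : ℤ) * ((low s c a + s (c b)) ^ 2 - (low s c a + s (c a)) ^ 2) +
        B.card * ((low s c a + s (c b)) ^ 2 - (low s c b + s (c b)) ^ 2) +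
        C.card * ((low s c b + s (c a)) ^ 2 - (low s c b + s (c b)) ^ 2)) =
        -((s (c b) - s (c a)) * (low s c b - low s c a) *
        (s (c a) + s (c b) - low s c a - low s c b + 4)) := by
      linear_combination ((low s c a + s (c b)) ^ 2 - (low s c a + s (c a)) ^ 2) * c1 +
        ((low s c a + s (c b)) ^ 2 - (low s c b + s (c b)) ^ 2) * c2 +
        ((low s c b + s (c a)) ^ 2 - (low s c b + s (c b)) ^ 2) * c3
    omega
  · intro u
    rcases cases4 u with h | h | h | h
    · rw [h.2, hcb, if_neg hab.symm, if_pos h.1]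
    · rw [h.2.2, hcb, h.1]
    · rw [h.2.2.1, h.2.2.2.1, h.1]
    · rw [h.2.2, hc.idem]

end PairsOfStrings

/-! ### The ideals of a wheel condition and of the shuffle products -/

section Ideals

variable {K : Type*} [Field K] (q : Kˣ) {I : Type*} (d : I → I → ℤ)
  {V : Type*} [Fintype V] [DecidableEq V] (col : V → I)

/-- A unit rescaled by a nonzero constant. -/
def scaleUnit {A : Type*} [CommRing A] [Algebra K A] (a : Kˣ) (x : Aˣ) : Aˣ :=
  Units.map (algebraMap K A).toMonoidHom a * x

theorem val_scaleUnit {A : Type*} [CommRing A] [Algebra K A] (a : Kˣ) (x : Aˣ) :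
    ((scaleUnit a x : Aˣ) : A) = (a : K) • (x : A) := by
  rw [Algebra.smul_def]; rfl

theorem qpow_smul_smul {A : Type*} [AddCommGroup A] [Module K A] (m n : ℤ) (x : A) :
    ((q ^ m : Kˣ) : K) • ((q ^ n : Kˣ) : K) • x = ((q ^ (m + n) : Kˣ) : K) • x := by
  rw [smul_smul, zpow_add, Units.val_mul]

/-- The Laurent polynomial `z_v - q^{-d} z_u`, where `d` is the entry of the Cartan matrix at the
colours of `u` and `v`. -/
def edgeFactor (u v : V) : Laurent K V :=
  lvar K v - ((q ^ (-d (col u) (col v)) : Kˣ) : K) • lvar K u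

/-- The product of the `z_v - q^{-d} z_u` over the pairs in which `v` comes before `u`. -/
def orderProd {N : ℕ} (e : V ≃ Fin N) : Laurent K V :=
  ∏ p ∈ Finset.univ.filter (fun p : V × V => e p.2 < e p.1), edgeFactor q d col p.1 p.2

variable (V) in
/-- The ideal generated by the numerators of the kernels of the shuffle products of `N` elements of
degree one, over all orders of the factors. -/
def orderIdeal (N : ℕ) : Ideal (Laurent K V) :=
  Ideal.span (Set.range fun e : V ≃ Fin N => orderProd q d col e)

/-- The Laurent polynomials satisfying the wheel conditions for all ways to choose the vertices of
a distinguished zig-zag among the variables, the remaining variables being specialized in an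
arbitrary way. -/
def wheelIdeal : Ideal (Laurent K V) where
  carrier := {h | ∀ (i j : I) (k l m : ℕ) (x y : ℤ) (α β : ℕ → V) (X Y : (Laurent K V)ˣ)
    (φ : Laurent K V →ₐ[K] Laurent K V), i ≠ j → 1 ≤ m → x + 2 * k = y - d i j →
    y + 2 * l = x - d i j → (∀ a < k + m, col (α a) = i) → (∀ a < l + m, col (β a) = j) →
    Set.InjOn α (Set.Iio (k + m)) → Set.InjOn β (Set.Iio (l + m)) →
    (∀ a < k + m, φ (lvar K (α a)) = ((q ^ (x + 2 * a) : Kˣ) : K) • (X : Laurent K V)) →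
    (∀ a < l + m, φ (lvar K (β a)) = ((q ^ (y + 2 * a) : Kˣ) : K) • (Y : Laurent K V)) →
    ((X : Laurent K V) - Y) ^ m ∣ φ h}
  zero_mem' := by simp
  add_mem' := by
    intro a b ha hb i j k l m x y α β X Y φ h1 h2 h3 h4 h5 h6 h7 h8 h9 h10
    rw [map_add]
    exact dvd_add (ha i j k l m x y α β X Y φ h1 h2 h3 h4 h5 h6 h7 h8 h9 h10)
      (hb i j k l m x y α β X Y φ h1 h2 h3 h4 h5 h6 h7 h8 h9 h10)
  smul_mem' := by
    intro a b hb i j k l m x y α β X Y φ h1 h2 h3 h4 h5 h6 h7 h8 h9 h10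
    rw [smul_eq_mul, map_mul]
    exact (hb i j k l m x y α β X Y φ h1 h2 h3 h4 h5 h6 h7 h8 h9 h10).mul_left _

variable {q d col}

theorem map_edgeFactor {A : Type*} [CommRing A] [Algebra K A] (φ : Laurent K V →ₐ[K] A)
    {u v : V} {x y : ℤ} {X Y : A} (hu : φ (lvar K u) = ((q ^ x : Kˣ) : K) • X)
    (hv : φ (lvar K v) = ((q ^ y : Kˣ) : K) • Y) (h : y = x - d (col u) (col v)) :
    φ (edgeFactor q d col u v) = ((q ^ y : Kˣ) : K) • (Y - X) := by
  rw [edgeFactor, map_sub, map_smul, hu, hv, qpow_smul_smul, smul_sub, h]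
  ring_nf

theorem map_orderProd_eq_zero {A : Type*} [CommRing A] [Algebra K A] (φ : Laurent K V →ₐ[K] A)
    {N : ℕ} (e : V ≃ Fin N) {u v : V} (he : e v < e u) (h : φ (edgeFactor q d col u v) = 0) :
    φ (orderProd q d col e) = 0 := by
  rw [orderProd, map_prod]
  exact Finset.prod_eq_zero (i := (u, v)) (by simpa using he) h

theorem descending_of_map_ne_zero (hd : IsSymmetricCartan d) {A : Type*} [CommRing A] [Algebra K A]
    (φ : Laurent K V →ₐ[K] A) {N : ℕ} (e : V ≃ Fin N) (hne : φ (orderProd q d col e) ≠ 0)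
    {i : I} {n : ℕ} {α : ℕ → V} {X : A} {x : ℤ} (hcol : ∀ a < n, col (α a) = i)
    (hα : ∀ a < n, φ (lvar K (α a)) = ((q ^ (x + 2 * a) : Kˣ) : K) • X)
    (a b : ℕ) (hab : a ≤ b) (hb : b < n) : e (α b) ≤ e (α a) := by
  induction b, hab using Nat.le_induction with
  | base => exact le_rfl
  | succ b hab ih =>
    refine le_trans ?_ (ih (by omega))
    by_contra hlt
    rw [not_le] at hlt
    apply hne
    apply map_orderProd_eq_zero φ e hlt
    rw [map_edgeFactor φ (hα (b + 1) hb) (hα b (by omega)), sub_self, smul_zero]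
    rw [hcol _ hb, hcol b (by omega), hd.diag]
    push_cast
    ring

/-- The kernel of a shuffle product of elements of degree one satisfies the wheel conditions: if
the variables of either colour of a zig-zag are in descending order, then for each `b < m` one of
the two factors attached to the `b`-th steps from one colour to the other vanishes. -/
theorem pow_dvd_map_orderProd (hd : IsSymmetricCartan d) {A : Type*} [CommRing A] [Algebra K A]
    (φ : Laurent K V →ₐ[K] A) {N : ℕ} (e : V ≃ Fin N) {i j : I} {k l m : ℕ} {x y : ℤ}
    {α β : ℕ → V} {X Y : A} (hij : i ≠ j) (h1 : x + 2 * k = y - d i j)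
    (h2 : y + 2 * l = x - d i j) (hα : ∀ a < k + m, col (α a) = i)
    (hβ : ∀ a < l + m, col (β a) = j)
    (iα : Set.InjOn α (Set.Iio (k + m))) (iβ : Set.InjOn β (Set.Iio (l + m)))
    (sα : ∀ a < k + m, φ (lvar K (α a)) = ((q ^ (x + 2 * a) : Kˣ) : K) • X)
    (sβ : ∀ a < l + m, φ (lvar K (β a)) = ((q ^ (y + 2 * a) : Kˣ) : K) • Y) :
    (X - Y) ^ m ∣ φ (orderProd q d col e) := by
  by_cases hne : φ (orderProd q d col e) = 0
  · rw [hne]; exact dvd_zero _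
  have dα := descending_of_map_ne_zero hd φ e hne hα sα
  have dβ := descending_of_map_ne_zero hd φ e hne hβ sβ
  let P : ℕ → V × V := fun b =>
    if e (α (k + b)) < e (β b) then (β b, α (k + b)) else (α b, β (l + b))
  have hP : ∀ b < m, (e (α (k + b)) < e (β b) ∧ P b = (β b, α (k + b))) ∨
      (e (β (l + b)) < e (α b) ∧ P b = (α b, β (l + b))) := by
    intro b hb
    by_cases h : e (α (k + b)) < e (β b)
    · exact Or.inl ⟨h, if_pos h⟩
    · refine Or.inr ⟨?_, if_neg h⟩
      have h3 := dα b (k + b) (by omega) (by omega)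
      have h4 := dβ b (l + b) (by omega) (by omega)
      refine lt_of_le_of_ne (h4.trans ((not_lt.1 h).trans h3)) ?_
      intro h5
      apply hij
      rw [← hα b (by omega), ← hβ (l + b) (by omega), e.injective h5]
  have hinj : Set.InjOn P (Finset.range m) := by
    intro b hb b' hb' hbb
    simp only [Finset.coe_range, Set.mem_Iio] at hb hb'
    rcases hP b hb with h | h <;> rcases hP b' hb' with h' | h' <;>
      rw [h.2, h'.2, Prod.mk.injEq] at hbb
    · exact iβ (by simp; omega) (by simp; omega) hbb.1
    · exact absurd (by rw [← hα b' (by omega), ← hβ b (by omega), hbb.1]) hij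
    · exact absurd (by rw [← hα b (by omega), ← hβ b' (by omega), hbb.1]) hij
    · exact iα (by simp; omega) (by simp; omega) hbb.1
  have hsub : (Finset.range m).image P ⊆
      Finset.univ.filter (fun p : V × V => e p.2 < e p.1) := by
    intro p hp
    obtain ⟨b, hb, rfl⟩ := Finset.mem_image.1 hp
    rw [Finset.mem_range] at hb
    rw [Finset.mem_filter]
    refine ⟨Finset.mem_univ _, ?_⟩
    rcases hP b hb with h | h <;> rw [h.2] <;> exact h.1
  have h3 := map_dvd φ (Finset.prod_dvd_prod_of_subset _ _
    (fun p : V × V => edgeFactor q d col p.1 p.2) hsub)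
  refine dvd_trans ?_ h3
  rw [Finset.prod_image hinj, map_prod, ← Finset.card_range m, ← Finset.prod_const]
  rw [Finset.card_range]
  apply Finset.prod_dvd_prod_of_dvd
  intro b hb
  rw [Finset.mem_range] at hb
  rcases hP b hb with h | h <;> rw [h.2]
  · rw [map_edgeFactor φ (sβ b (by omega)) (sα (k + b) (by omega))]
    · exact dvd_smul_of_dvd _ dvd_rfl
    · rw [hα _ (by omega), hβ _ (by omega), hd.symm]
      push_cast
      omega
  · rw [map_edgeFactor φ (sα b (by omega)) (sβ (l + b) (by omega))]
    · rw [← neg_sub X Y, smul_neg, dvd_neg]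
      exact dvd_smul_of_dvd _ dvd_rfl
    · rw [hα _ (by omega), hβ _ (by omega)]
      push_cast
      omega

theorem orderIdeal_le_wheelIdeal (hd : IsSymmetricCartan d) (N : ℕ) :
    orderIdeal q d V col N ≤ wheelIdeal q d col := by
  rw [orderIdeal, Ideal.span_le]
  rintro _ ⟨e, rfl⟩ i j k l m x y α β X Y φ h1 h2 h3 h4 h5 h6 h7 h8 h9 h10
  exact pow_dvd_map_orderProd hd φ e h1 h3 h4 h5 h6 h7 h8 h9 h10

theorem permute_edgeFactor (g : Equiv.Perm V) (hg : ∀ v, col (g v) = col v) (u v : V) :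
    permute g (edgeFactor q d col u v) = edgeFactor q d col (g u) (g v) := by
  rw [edgeFactor, edgeFactor, map_sub, map_smul, permute_lvar, permute_lvar, hg, hg]

theorem permute_orderProd (g : Equiv.Perm V) (hg : ∀ v, col (g v) = col v) {N : ℕ}
    (e : V ≃ Fin N) :
    permute g (orderProd q d col e) = orderProd q d col (g.symm.trans e) := by
  rw [orderProd, orderProd, map_prod]
  apply Finset.prod_equiv (Equiv.prodCongr g g)
  · intro p
    rw [Finset.mem_filter, Finset.mem_filter]
    simp
  · intro p _
    exact permute_edgeFactor g hg p.1 p.2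

theorem permute_mem_orderIdeal (g : Equiv.Perm V) (hg : ∀ v, col (g v) = col v) {N : ℕ}
    {h : Laurent K V} (hh : h ∈ orderIdeal q d V col N) :
    permute g h ∈ orderIdeal q d V col N := by
  have : orderIdeal q d V col N ≤ (orderIdeal q d V col N).comap (permute g) := by
    conv_lhs => rw [orderIdeal]
    rw [Ideal.span_le]
    rintro _ ⟨e, rfl⟩
    rw [SetLike.mem_coe, Ideal.mem_comap]
    change permute g (orderProd q d col e) ∈ _
    rw [permute_orderProd g hg]
    exact Ideal.subset_span ⟨_, rfl⟩
  exact this hh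

theorem antisym_mem_orderIdeal {W : Subgroup (Equiv.Perm V)} [Fintype W]
    (hW : ∀ g ∈ W, ∀ v, col (g v) = col v) {N : ℕ} {h : Laurent K V}
    (hh : h ∈ orderIdeal q d V col N) : antisym W h ∈ orderIdeal q d V col N := by
  rw [antisym_apply]
  refine Submodule.sum_mem _ fun g _ => ?_
  rw [← intCast_mul_eq_smul]
  exact Ideal.mul_mem_left _ _ (permute_mem_orderIdeal _ (hW g g.2) hh)

end Ideals

/-! ### Restriction to strings -/

section Restriction

variable {K : Type*} [Field K] {q : Kˣ} {I : Type*} {d : I → I → ℤ}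
  {V : Type*} [Fintype V] [DecidableEq V] {col : V → I} {s : V → ℤ} {c : V → V}

variable (q s) in
/-- The restriction of a Laurent polynomial to the subtorus on which the variables of each string
form a geometric progression, with one variable `x_a` for each string. -/
def stringRes (c : V → V) : Laurent K V →ₐ[K] Laurent K V :=
  laurentSubst fun u => scaleUnit (q ^ s u) (laurentVar K (c u))

@[simp]
theorem stringRes_lvar (c : V → V) (u : V) :
    stringRes q s c (lvar K u) = ((q ^ s u : Kˣ) : K) • lvar K (c u) := by
  rw [stringRes, laurentSubst_laurentVar, val_scaleUnit]

theorem stringRes_edgeFactor {u v : V} (h : s v = s u - d (col u) (col v)) :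
    stringRes q s c (edgeFactor q d col u v) =
      ((q ^ s v : Kˣ) : K) • (lvar K (c v) - lvar K (c u)) :=
  map_edgeFactor _ (stringRes_lvar c u) (stringRes_lvar c v) h

theorem qpow_smul_ne_zero {A : Type*} [AddCommGroup A] [Module K A] (n : ℤ)
    {x : A} (h : x ≠ 0) : ((q ^ n : Kˣ) : K) • x ≠ 0 :=
  smul_ne_zero (Units.ne_zero _) h

theorem stringRes_vander_ne_zero (hc : IsStrings col s c) [DecidableEq I] {N : ℕ} (e : V ≃ Fin N) :
    stringRes q s c (vander K e fun u => (col u, s u)) ≠ 0 := by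
  rw [vander, map_prod]
  apply Finset.prod_ne_zero_iff.2
  intro p hp
  simp only [Finset.mem_filter, Finset.mem_univ, true_and, Prod.mk.injEq] at hp
  rw [map_sub, stringRes_lvar, stringRes_lvar, hp.2.2, ← smul_sub]
  apply qpow_smul_ne_zero
  apply lvar_sub_ne_zero
  intro h
  exact hp.1.ne (congrArg e (hc.inj _ _ h hp.2.2))

/-- The restriction to strings of the kernel attached to the order of another partition vanishes,
unless that partition has the larger spread. -/
theorem stringRes_orderProd_eq_zero (hd : IsSymmetricCartan d) {c' : V → V}
    (hc : IsStrings col s c) (hc' : IsStrings col s c') {N : ℕ} {e₀ e : V ≃ Fin N}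
    (he1 : ∀ u v, e u ≤ e v → centre s c u ≤ centre s c v)
    (he2 : ∀ u v, e u ≤ e v → centre s c u = centre s c v → e₀ (c u) ≤ e₀ (c v))
    (hle : spread s c ≤ spread s c') (hne : c' ≠ c) :
    stringRes q s c' (orderProd q d col e) = 0 := by
  by_contra h0
  apply hne
  refine strings_eq_of_order hc hc' he1 he2 (fun u v huv hs => ?_) hle
  by_contra hlt
  have huv' : u ≠ v := by rintro rfl; omega
  have hlt' : e v < e u := lt_of_le_of_ne (not_lt.1 hlt) fun h => huv' (e.injective h).symm
  apply h0
  apply map_orderProd_eq_zero _ e hlt'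
  rw [stringRes_edgeFactor, huv, sub_self, smul_zero]
  rw [hs, ← hc'.col u, ← hc'.col v, huv, hd.diag]

theorem pow_dvd_stringRes_of_ne (hd : IsSymmetricCartan d) (hc : IsStrings col s c)
    {h : Laurent K V} (hw : h ∈ wheelIdeal q d col) {a b : V} (ha : c a = a) (hb : c b = b)
    (hcol : col a ≠ col b) (hK : centre s c a ≤ centre s c b) :
    (lvar K a - lvar K b) ^ (pairsAt s c b a (-d (col b) (col a))).card ∣ stringRes q s c h := by
  obtain ⟨D, hD⟩ : ∃ D : ℕ, (D : ℤ) = -d (col b) (col a) :=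
    ⟨(-d (col b) (col a)).toNat, by have := hd.off_diag _ _ hcol.symm; omega⟩
  rw [← hD]
  rcases exists_zigzag hc (D := D) hK with h0 | ⟨k, l, m, x, y, hm, h1, h2, hα, hβ, hcard⟩
  · rw [h0]; simp
  · refine (pow_dvd_pow _ hcard).trans ?_
    have : Nonempty V := ⟨a⟩
    choose! α hα hα' using hα
    choose! β hβ hβ' using hβ
    have := hw (col b) (col a) k l m x y α β (laurentVar K b) (laurentVar K a)
      (stringRes q s c) hcol.symm hm (by omega) (by omega)
      (fun n hn => by rw [← hc.col, hα n hn, hc.col])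
      (fun n hn => by rw [← hc.col, hβ n hn, hc.col])
      (fun n hn n' hn' h => ?_) (fun n hn n' hn' h => ?_)
      (fun n hn => by rw [stringRes_lvar, hα n hn, hα' n hn, hb])
      (fun n hn => by rw [stringRes_lvar, hβ n hn, hβ' n hn, ha])
    · rw [← neg_sub, neg_pow]
      exact (isUnit_one.neg.pow m).mul_left_dvd.2 this
    · have h3 := hα' n hn
      rw [h, hα' n' hn'] at h3
      omega
    · have h3 := hβ' n hn
      rw [h, hβ' n' hn'] at h3
      omega

theorem pow_dvd_stringRes_vander (hc : IsStrings col s c) [DecidableEq I] {N : ℕ} (e : V ≃ Fin N)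
    {a b : V} (ha : c a = a) (hb : c b = b) (hab : a ≠ b) (hcol : col a = col b) :
    (lvar K a - lvar K b) ^ (pairsAt s c b a 0).card ∣
      stringRes q s c (vander K e fun u => (col u, s u)) := by
  let o : V × V → V × V := fun p => if e p.1 < e p.2 then p else p.swap
  have ho : ∀ p ∈ pairsAt s c b a 0, (e p.1 < e p.2 ∧ o p = p) ∨
      (e p.2 < e p.1 ∧ o p = p.swap) := by
    intro p hp
    by_cases h : e p.1 < e p.2
    · exact Or.inl ⟨h, if_pos h⟩
    · refine Or.inr ⟨lt_of_le_of_ne (not_lt.1 h) fun h' => hab ?_, if_neg h⟩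
      have hp' := mem_pairsAt.1 hp
      rw [← ha, ← hb, ← hp'.1, ← hp'.2.1, e.injective h']
  have hinj : Set.InjOn o (pairsAt s c b a 0) := by
    intro p hp p' hp' h
    have h1 := mem_pairsAt.1 hp
    have h2 := mem_pairsAt.1 hp'
    rw [ha, hb] at h1 h2
    rcases ho p hp with h3 | h3 <;> rcases ho p' hp' with h4 | h4 <;> rw [h3.2, h4.2] at h
    · exact h
    · rw [h] at h1
      exact absurd (h2.2.1.symm.trans h1.1) hab
    · rw [← h] at h2
      exact absurd (h1.2.1.symm.trans h2.1) hab
    · exact Prod.swap_injective h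
  have hsub : (pairsAt s c b a 0).image o ⊆
      Finset.univ.filter
        (fun p : V × V => e p.1 < e p.2 ∧ (col p.1, s p.1) = (col p.2, s p.2)) := by
    intro p' hp'
    obtain ⟨p, hp, rfl⟩ := Finset.mem_image.1 hp'
    have h1 := mem_pairsAt.1 hp
    have h2 : col p.1 = col p.2 := by
      rw [← hc.col, ← hc.col p.2, h1.1, h1.2.1, hc.col, hc.col, hcol]
    rw [Finset.mem_filter]
    refine ⟨Finset.mem_univ _, ?_⟩
    rcases ho p hp with h3 | h3 <;> rw [h3.2]
    · exact ⟨h3.1, by rw [h2, h1.2.2, add_zero]⟩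
    · exact ⟨h3.1, by rw [Prod.fst_swap, Prod.snd_swap, h2, h1.2.2, add_zero]⟩
  refine dvd_trans ?_ (map_dvd _ (Finset.prod_dvd_prod_of_subset _ _
    (fun p : V × V => lvar K p.1 - lvar K p.2) hsub))
  rw [Finset.prod_image hinj, map_prod, ← Finset.prod_const]
  apply Finset.prod_dvd_prod_of_dvd
  intro p hp
  have h1 := mem_pairsAt.1 hp
  rcases ho p hp with h3 | h3 <;> rw [h3.2, map_sub, stringRes_lvar, stringRes_lvar]
  · rw [h1.1, h1.2.1, h1.2.2, ha, hb, add_zero, ← smul_sub, ← neg_sub (lvar K a), smul_neg, dvd_neg]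
    exact dvd_smul_of_dvd _ dvd_rfl
  · rw [Prod.fst_swap, Prod.snd_swap, h1.1, h1.2.1, h1.2.2, ha, hb, add_zero, ← smul_sub]
    exact dvd_smul_of_dvd _ dvd_rfl

/-- If two staggered strings of the same colour are rearranged, then the locus where the variables
of the two strings agree is contained in the subtorus of the new strings. -/
theorem sub_dvd_stringRes_of_rejoin {c' : V → V} {a b : V}
    (h : ∀ u, (if c (c' u) = a then b else c (c' u)) = if c u = a then b else c u)
    {f : Laurent K V} (hf : stringRes q s c' f = 0) :
    lvar K a - lvar K b ∣ stringRes q s c f := by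
  rw [sub_dvd_iff_collapse]
  have key : (collapse a b).comp (stringRes q s c) =
      (laurentSubst fun w => laurentVar K (if c w = a then b else c w)).comp
        (stringRes q s c') := by
    apply laurent_algHom_ext
    intro u
    rw [AlgHom.comp_apply, AlgHom.comp_apply, stringRes_lvar, stringRes_lvar, map_smul, map_smul,
      collapse_lvar, laurentSubst_laurentVar, h]
  have := DFunLike.congr_fun key f
  rw [AlgHom.comp_apply, AlgHom.comp_apply, hf, map_zero] at this
  exact this

/-- The divisibility for two strings of the same colour. Antisymmetry provides a factor for each
pair of vertices at equal positions; there can be one more pair of vertices at positions differing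
by two, whose factor comes from the vanishing on the subtorus of a recombined partition. -/
theorem pow_dvd_stringRes_of_eq [CharZero K] (hc : IsStrings col s c) {W : Subgroup (Equiv.Perm V)}
    (hW : ∀ u v, col u = col v → s u = s v → Equiv.swap u v ∈ W) {h : Laurent K V}
    (hanti : IsAnti W h)
    (hvan : ∀ c', IsStrings col s c' → spread s c < spread s c' → stringRes q s c' h = 0)
    {N : ℕ} (e : V ≃ Fin N)
    {a b : V} (ha : c a = a) (hb : c b = b) (hab : a ≠ b) (hcol : col a = col b) :
    (lvar K a - lvar K b) ^ (pairsAt s c b a (-2)).card ∣ stringRes q s c h := by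
  classical
  obtain ⟨r, rfl⟩ := vander_dvd_of_anti e (fun u => (col u, s u)) hanti fun u v huv => by
    rw [Prod.mk.injEq] at huv
    exact hW u v huv.1 huv.2
  have h1 := pow_dvd_stringRes_vander (K := K) (q := q) hc e ha hb hab hcol
  rw [map_mul]
  rcases card_pairsAt_le hc a b with h2 | ⟨h2, h3, h4, h5, h6⟩
  · exact ((pow_dvd_pow _ h2).trans h1).mul_right _
  · refine (pow_dvd_pow _ h2).trans ?_
    rw [pow_succ]
    refine mul_dvd_mul h1 ?_
    obtain ⟨c', hc', hs, h7⟩ := exists_rejoin hc hcol h3 h4 h5 h6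
    rw [ha, hb] at h7
    apply sub_dvd_stringRes_of_rejoin h7
    have h8 := hvan c' hc' hs
    rw [map_mul, mul_eq_zero] at h8
    exact h8.resolve_left (stringRes_vander_ne_zero hc' e)

/-- The product of the `z_v - q^{-d} z_u` over the pairs which are not at matching positions. -/
def nonEdgeProd (q : Kˣ) (d : I → I → ℤ) (col : V → I) (s : V → ℤ) : Laurent K V :=
  ∏ p ∈ Finset.univ.filter (fun p : V × V => p.1 ≠ p.2 ∧ s p.2 ≠ s p.1 - d (col p.1) (col p.2)),
    edgeFactor q d col p.1 p.2

/-- The variables of the strings lift to Laurent polynomials on the whole torus. -/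
theorem exists_lift (c : V → V) (t : Laurent K V) :
    ∃ t', stringRes q s c t' = laurentSubst (fun w => laurentVar K (c w)) t := by
  refine ⟨laurentSubst (fun w => scaleUnit (q ^ (-s w)) (laurentVar K w)) t, ?_⟩
  apply algHom_laurentSubst
  intro v
  rw [val_scaleUnit, map_smul, stringRes_lvar, qpow_smul_smul]
  simp

/-- If `h` vanishes on the subtori of all partitions of larger spread, its restriction to the
strings is, up to factors which do not vanish locally, a multiple of the kernel of the order `e`,
in which the strings follow each other by increasing centre and each string is read from top to
bottom. -/
theorem stringRes_dvd_of_vanishing [CharZero K] (hd : IsSymmetricCartan d)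
    (hc : IsStrings col s c) {W : Subgroup (Equiv.Perm V)}
    (hW : ∀ u v, col u = col v → s u = s v → Equiv.swap u v ∈ W) {h : Laurent K V}
    (hw : h ∈ wheelIdeal q d col) (hanti : IsAnti W h)
    (hvan : ∀ c', IsStrings col s c' → spread s c < spread s c' → stringRes q s c' h = 0)
    {N : ℕ} {e₀ e : V ≃ Fin N} (he1 : ∀ u v, e u ≤ e v → centre s c u ≤ centre s c v)
    (he2 : ∀ u v, e u ≤ e v → centre s c u = centre s c v → e₀ (c u) ≤ e₀ (c v))
    (he3 : ∀ u v, c u = c v → s v < s u → e u < e v) :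
    ∃ t, stringRes q s c (nonEdgeProd q d col s * h) =
      stringRes q s c (t * orderProd q d col e) := by
  classical
  set inv := Finset.univ.filter (fun p : V × V => e p.2 < e p.1) with hinv
  set E := inv.filter (fun p : V × V => s p.2 = s p.1 - d (col p.1) (col p.2)) with hE
  set NE := inv.filter (fun p : V × V => ¬ s p.2 = s p.1 - d (col p.1) (col p.2)) with hNE
  have hsplit : orderProd q d col e =
      (∏ p ∈ E, edgeFactor q d col p.1 p.2) * ∏ p ∈ NE, edgeFactor q d col p.1 p.2 :=
    (Finset.prod_filter_mul_prod_filter_not _ _ _).symm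
  obtain ⟨ν, hν⟩ : ∏ p ∈ NE, edgeFactor q d col p.1 p.2 ∣ nonEdgeProd q d col s := by
    apply Finset.prod_dvd_prod_of_subset
    intro p hp
    simp only [hNE, hinv, Finset.mem_filter, Finset.mem_univ, true_and] at hp
    rw [Finset.mem_filter]
    exact ⟨Finset.mem_univ _, fun h => hp.1.ne (congrArg e h.symm), hp.2⟩
  have memE : ∀ p ∈ E, e p.2 < e p.1 ∧ s p.2 = s p.1 - d (col p.1) (col p.2) := by
    intro p hp
    simpa only [hE, hinv, Finset.mem_filter, Finset.mem_univ, true_and] using hp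
  have hneE : ∀ p ∈ E, c p.2 ≠ c p.1 := by
    intro p hp h
    obtain ⟨h1, h2⟩ := memE p hp
    have h3 := he3 p.1 p.2 h.symm
    rw [← hc.col p.1, ← hc.col p.2, h, hd.diag] at h2
    exact lt_asymm h1 (h3 (by omega))
  -- The restriction of `h` is divisible by the restrictions of the vanishing factors.
  obtain ⟨t₀, ht₀⟩ : ∏ p ∈ E, (lvar K (c p.2) - lvar K (c p.1)) ∣ stringRes q s c h := by
    have hcomp : ∏ p ∈ E, (lvar K (c p.2) - lvar K (c p.1)) = _ :=
      Finset.prod_comp (s := E) (fun b : V × V => lvar K b.1 - lvar K b.2)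
        (fun p => (c p.2, c p.1))
    rw [hcomp]
    apply prod_prime_pow_dvd
    · intro b hb
      obtain ⟨p, hp, rfl⟩ := Finset.mem_image.1 hb
      exact prime_lvar_sub (hneE p hp)
    · intro b hb b' hb' hne
      obtain ⟨p, hp, rfl⟩ := Finset.mem_image.1 hb
      obtain ⟨p', hp', rfl⟩ := Finset.mem_image.1 hb'
      apply not_sub_dvd_sub (hneE p' hp')
      · rintro ⟨h1, h2⟩
        exact hne (Prod.ext h1 h2)
      · rintro ⟨h1, h2⟩
        have h3 := he1 _ _ (memE p hp).1.le
        have h4 := he1 _ _ (memE p' hp').1.le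
        rw [← centre_congr h1, ← centre_congr h2] at h4
        have h5 := he2 _ _ (memE p hp).1.le (le_antisymm h3 h4)
        have h6 := he2 _ _ (memE p' hp').1.le
          (by rw [← centre_congr h1, ← centre_congr h2]; exact le_antisymm h4 h3)
        simp only at h1 h2
        rw [← h1, ← h2] at h6
        exact hneE p hp (e₀.injective (le_antisymm h5 h6))
    · intro b hb
      obtain ⟨p, hp, rfl⟩ := Finset.mem_image.1 hb
      obtain ⟨h1, h2⟩ := memE p hp
      have hca := hc.idem p.2
      have hcb := hc.idem p.1
      have hK : centre s c (c p.2) ≤ centre s c (c p.1) := by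
        rw [centre_congr hca, centre_congr hcb]
        exact he1 _ _ h1.le
      have hcard : (E.filter fun x : V × V => (c x.2, c x.1) = (c p.2, c p.1)).card ≤
          (pairsAt s c (c p.1) (c p.2) (-d (col (c p.1)) (col (c p.2)))).card := by
        apply Finset.card_le_card
        intro x hx
        rw [Finset.mem_filter, Prod.mk.injEq] at hx
        rw [mem_pairsAt, hca, hcb]
        refine ⟨hx.2.2, hx.2.1, ?_⟩
        rw [(memE x hx.1).2, ← hc.col x.1, ← hc.col x.2, hx.2.1, hx.2.2]
        ring
      refine (pow_dvd_pow _ hcard).trans ?_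
      by_cases hcol : col (c p.2) = col (c p.1)
      · rw [hcol, hd.diag]
        exact pow_dvd_stringRes_of_eq hc hW hanti hvan e hca hcb (hneE p hp) hcol
      · exact pow_dvd_stringRes_of_ne hd hc hw hca hcb hcol hK
  obtain ⟨t₁, ht₁⟩ := exists_lift (q := q) (s := s) c t₀
  have h1 : stringRes q s c h =
      (∏ p ∈ E, (lvar K (c p.2) - lvar K (c p.1))) * stringRes q s c t₁ := by
    have h2 := congrArg (laurentSubst fun w => laurentVar K (c w)) ht₀
    have h3 : laurentSubst (fun w => laurentVar K (c w)) (stringRes q s c h) =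
        stringRes q s c h := by
      apply algHom_laurentSubst
      intro v
      rw [val_scaleUnit, map_smul, laurentSubst_laurentVar, hc.idem]
    rw [h3, map_mul, map_prod] at h2
    rw [h2, ht₁]
    congr 1
    apply Finset.prod_congr rfl
    intro p _
    rw [map_sub, laurentSubst_laurentVar, laurentSubst_laurentVar, hc.idem, hc.idem]
  have h2 : stringRes q s c (∏ p ∈ E, edgeFactor q d col p.1 p.2) =
      ((∏ p ∈ E, q ^ s p.2 : Kˣ) : K) • ∏ p ∈ E, (lvar K (c p.2) - lvar K (c p.1)) := by
    rw [map_prod, Units.coe_prod, ← Finset.prod_smul]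
    exact Finset.prod_congr rfl fun p hp => stringRes_edgeFactor (memE p hp).2
  refine ⟨(((∏ p ∈ E, q ^ s p.2 : Kˣ)⁻¹ : Kˣ) : K) • (ν * t₁), ?_⟩
  rw [hsplit, hν]
  simp only [map_mul, map_smul]
  rw [h1, h2, smul_mul_assoc, smul_mul_assoc, mul_smul_comm, smul_smul, Units.inv_mul, one_smul]
  ring

end Restriction

/-! ### Wheel conditions imply membership in the ideal of shuffle products -/

section Generation

variable {K : Type*} [Field K] {q : Kˣ} {I : Type*} {d : I → I → ℤ}
  {V : Type*} [Fintype V] [DecidableEq V] {col : V → I} {s : V → ℤ}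

/-- The permutations preserving a labelling. -/
def labelPerms {T : Type*} (f : V → T) : Subgroup (Equiv.Perm V) where
  carrier := {g | ∀ v, f (g v) = f v}
  one_mem' _ := rfl
  mul_mem' := fun {a b} ha hb v => (ha (b v)).trans (hb v)
  inv_mem' := fun {a} ha v => by rw [← ha (a⁻¹ v)]; simp

theorem mem_labelPerms {T : Type*} {f : V → T} {g : Equiv.Perm V} :
    g ∈ labelPerms f ↔ ∀ v, f (g v) = f v := Iff.rfl

theorem swap_mem_labelPerms {T : Type*} {f : V → T} {u v : V} (h : f u = f v) :
    Equiv.swap u v ∈ labelPerms f := by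
  intro w
  rcases eq_or_ne w u with rfl | h1
  · rw [Equiv.swap_apply_left, h]
  · rcases eq_or_ne w v with rfl | h2
    · rw [Equiv.swap_apply_right, h]
    · rw [Equiv.swap_apply_of_ne_of_ne h1 h2]

theorem isStrings_conj {c : V → V} (hc : IsStrings col s c) {g : Equiv.Perm V}
    (hg : ∀ v, col (g v) = col v) (hg' : ∀ v, s (g v) = s v) :
    IsStrings col s (fun v => g.symm (c (g v))) := by
  have hs : ∀ v, s (g.symm v) = s v := fun v => by rw [← hg', g.apply_symm_apply]
  refine ⟨fun u => ?_, fun u => ?_, fun u v h h' => ?_, fun u => ?_, fun u => ?_,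
    fun u v p h h1 h2 h3 => ?_⟩
  · rw [g.apply_symm_apply, hc.idem]
  · rw [← hg, g.apply_symm_apply, hc.col, hg]
  · exact g.injective (hc.inj _ _ (g.symm.injective h) (by rw [hg', hg', h']))
  · rw [hs, ← hg' u]; exact hc.top _
  · rw [hs, ← hg' u]; exact hc.even _
  · obtain ⟨w, hw, hw'⟩ := hc.conv (g u) (g v) p (g.symm.injective h) (by rwa [hg'])
      (by rwa [hg']) (by rwa [hg'])
    exact ⟨g.symm w, by rw [g.apply_symm_apply, hw], by rw [hs, hw']⟩

theorem spread_conj (c : V → V) {g : Equiv.Perm V} (hg' : ∀ v, s (g v) = s v) :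
    spread s (fun v => g.symm (c (g v))) = spread s c := by
  have hs : ∀ v, s (g.symm v) = s v := fun v => by rw [← hg', g.apply_symm_apply]
  rw [spread, spread, ← Equiv.sum_comp g fun u => (2 * s u - centre s c u) ^ 2]
  apply Finset.sum_congr rfl
  intro u _
  have hlow : low s (fun v => g.symm (c (g v))) u = low s c (g u) := by
    obtain ⟨w, hw, hw'⟩ := exists_low (s := s) (c := c) (g u)
    rw [← hw', ← hs w]
    apply low_eq
    · rw [g.apply_symm_apply, hw]
    · intro v hv
      rw [hs, hw', ← hg' v]
      exact low_le (g.symm.injective hv)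
  rw [centre, centre, hlow, hs, hg']

theorem stringRes_permute (c : V → V) {g : Equiv.Perm V} (hg' : ∀ v, s (g v) = s v)
    (h : Laurent K V) : stringRes q s c (permute g h) =
      permute g (stringRes q s (fun v => g.symm (c (g v))) h) := by
  have : (stringRes q s c).comp (permute g) =
      (permute (K := K) g).comp (stringRes q s (fun v => g.symm (c (g v)))) := by
    apply laurent_algHom_ext
    intro v
    rw [AlgHom.comp_apply, AlgHom.comp_apply, permute_lvar, stringRes_lvar, stringRes_lvar,
      map_smul, permute_lvar, g.apply_symm_apply, hg']
  exact DFunLike.congr_fun this h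

theorem isStrings_id : IsStrings col s (id : V → V) :=
  ⟨fun _ => rfl, fun _ => rfl, fun _ _ h _ => h, fun _ => le_rfl, fun _ => by simp,
    fun u v p h h1 h2 _ => ⟨u, rfl, by cases h; exact le_antisymm h1 h2⟩⟩

theorem permute_nonEdgeProd {g : Equiv.Perm V} (hg : ∀ v, col (g v) = col v)
    (hg' : ∀ v, s (g v) = s v) :
    permute g (nonEdgeProd q d col s) = nonEdgeProd q d col s := by
  rw [nonEdgeProd, map_prod]
  apply Finset.prod_equiv (Equiv.prodCongr g g)
  · intro p
    rw [Finset.mem_filter, Finset.mem_filter]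
    simp [hg, hg']
  · intro p _
    exact permute_edgeFactor g hg p.1 p.2

theorem nonEdgeProd_not_mem {P : Ideal (Laurent K V)} (hP : P.IsPrime)
    (hs : ∀ u v, u ≠ v → edgeFactor q d col u v ∈ P → s v = s u - d (col u) (col v)) :
    nonEdgeProd q d col s ∉ P := by
  intro h
  obtain ⟨p, hp, hp'⟩ := hP.prod_mem_iff.1 h
  rw [Finset.mem_filter] at hp
  exact hp.2.2 (hs _ _ hp.2.1 hp')

/-- Local form of the generation statement, at a prime ideal where a factor `z_v - q^{-d} z_u` can
only vanish if the positions of `u` and `v` match: an antisymmetric Laurent polynomial satisfying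
the wheel conditions, and vanishing on the subtori of the partitions of spread at least `n`,
lies locally in the ideal of the shuffle products. In the induction on `n`, multiples of kernels
are subtracted to make the restrictions to the subtori of the partitions of spread `n` vanish. -/
theorem exists_mul_mem_orderIdeal [CharZero K] (hd : IsSymmetricCartan d)
    {P : Ideal (Laurent K V)} (hP : P.IsPrime)
    (hs : ∀ u v, u ≠ v → edgeFactor q d col u v ∈ P → s v = s u - d (col u) (col v))
    {N : ℕ} (e₀ : V ≃ Fin N) (n : ℕ) :
    ∀ h ∈ wheelIdeal q d col, IsAnti (labelPerms fun v => (col v, s v)) h →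
      (∀ c, IsStrings col s c → (n : ℤ) ≤ spread s c → stringRes q s c h = 0) →
      ∃ l, l ∉ P ∧ l * h ∈ orderIdeal q d V col N := by
  classical
  induction n with
  | zero =>
    intro h _ _ hvan
    have h0 := hvan id isStrings_id (Finset.sum_nonneg fun u _ => sq_nonneg _)
    have h1 : laurentSubst (fun w => scaleUnit (q ^ (-s w)) (laurentVar K w))
        (stringRes q s id h) = h := by
      have : (laurentSubst (fun w => scaleUnit (q ^ (-s w)) (laurentVar K w))).comp
          (stringRes q s id) = AlgHom.id K (Laurent K V) := by
        apply laurent_algHom_ext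
        intro v
        rw [AlgHom.comp_apply, stringRes_lvar, map_smul, laurentSubst_laurentVar, val_scaleUnit,
          qpow_smul_smul]
        simp
      exact DFunLike.congr_fun this h
    rw [h0, map_zero] at h1
    exact ⟨1, fun h => hP.ne_top ((Ideal.eq_top_iff_one _).2 h), by simp [← h1]⟩
  | succ n ih =>
    intro h hw hanti hvan
    set W := labelPerms fun v => (col v, s v) with hWdef
    have hWcol : ∀ g ∈ W, ∀ v, col (g v) = col v := fun g hg v =>
      (Prod.ext_iff.1 (mem_labelPerms.1 hg v)).1
    have hWs : ∀ g ∈ W, ∀ v, s (g v) = s v := fun g hg v =>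
      (Prod.ext_iff.1 (mem_labelPerms.1 hg v)).2
    set ll := nonEdgeProd q d col s with hll
    -- A correction term for each partition of spread `n`.
    have hterm : ∀ c, ∃ m ∈ orderIdeal q d V col N, IsStrings col s c → spread s c = n →
        stringRes q s c m = stringRes q s c (ll * h) ∧
        ∀ c', IsStrings col s c' → spread s c ≤ spread s c' → c' ≠ c →
          stringRes q s c' m = 0 := by
      intro c
      by_cases hc : IsStrings col s c ∧ spread s c = n
      · obtain ⟨e, he1, he2, he3⟩ := exists_stringOrder hc.1 e₀
        obtain ⟨t, ht⟩ := stringRes_dvd_of_vanishing (q := q) (W := W) hd hc.1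
          (fun u v h1 h2 => swap_mem_labelPerms (by simp [h1, h2])) hw hanti
          (fun c' hc' hlt => hvan c' hc' (by rw [hc.2] at hlt; push_cast; omega))
          he1 he2 he3
        refine ⟨t * orderProd q d col e, Ideal.mul_mem_left _ _ (Ideal.subset_span ⟨e, rfl⟩),
          fun _ _ => ⟨ht.symm, fun c' hc' hle hne => ?_⟩⟩
        rw [map_mul, stringRes_orderProd_eq_zero hd hc.1 hc' he1 he2 hle hne, mul_zero]
      · exact ⟨0, zero_mem _, fun h1 h2 => absurd ⟨h1, h2⟩ hc⟩
    choose m hm hm' using hterm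
    set y := ∑ c ∈ Finset.univ.filter (fun c : V → V => IsStrings col s c ∧ spread s c = n), m c
      with hy
    have hyM : y ∈ orderIdeal q d V col N := Submodule.sum_mem _ fun c _ => hm c
    have hvan' : ∀ c, IsStrings col s c → (n : ℤ) ≤ spread s c →
        stringRes q s c (ll * h - y) = 0 := by
      intro c hc hle
      rw [map_sub, hy, map_sum]
      rcases hle.eq_or_lt with heq | hlt
      · rw [Finset.sum_eq_single c]
        · rw [(hm' c hc heq.symm).1, sub_self]
        · intro b hb hbc
          rw [Finset.mem_filter] at hb
          exact (hm' b hb.2.1 hb.2.2).2 c hc (by omega) hbc.symm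
        · intro hn
          exact absurd (Finset.mem_filter.2 ⟨Finset.mem_univ _, hc, heq.symm⟩) hn
      · rw [map_mul, hvan c hc (by push_cast; omega), mul_zero, Finset.sum_eq_zero, sub_zero]
        intro b hb
        rw [Finset.mem_filter] at hb
        refine (hm' b hb.2.1 hb.2.2).2 c hc (by omega) ?_
        rintro rfl
        omega
    have hanti' : IsAnti W (ll * h) :=
      isAnti_mul (fun g hg => permute_nonEdgeProd (hWcol g hg) (hWs g hg)) hanti
    have hcard : (Fintype.card W : K) ≠ 0 := Nat.cast_ne_zero.2 Fintype.card_ne_zero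
    have hdiff : (Fintype.card W : K)⁻¹ • antisym W (ll * h - y) =
        ll * h - (Fintype.card W : K)⁻¹ • antisym W y := by
      rw [map_sub, smul_sub, antisym_of_isAnti hanti', smul_smul, inv_mul_cancel₀ hcard, one_smul]
    have hAM : (Fintype.card W : K)⁻¹ • antisym W y ∈ orderIdeal q d V col N :=
      Submodule.smul_of_tower_mem _ _ (antisym_mem_orderIdeal hWcol hyM)
    obtain ⟨l, hl, hl'⟩ := ih ((Fintype.card W : K)⁻¹ • antisym W (ll * h - y))
      (by
        rw [hdiff]
        exact sub_mem (Ideal.mul_mem_left _ _ hw) (orderIdeal_le_wheelIdeal hd N hAM))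
      (isAnti_smul _ (isAnti_antisym W _))
      (by
        intro c hc hle
        rw [map_smul, antisym_apply, map_sum, Finset.sum_eq_zero, smul_zero]
        intro g _
        rw [map_smul, stringRes_permute c (hWs g g.2),
          hvan' _ (isStrings_conj hc (hWcol g g.2) (hWs g g.2))
            (by rw [spread_conj c (hWs g g.2)]; exact hle), map_zero, smul_zero])
    refine ⟨l * ll, hP.mul_notMem hl (nonEdgeProd_not_mem hP hs), ?_⟩
    rw [hdiff] at hl'
    have := add_mem hl' (Ideal.mul_mem_left _ l hAM)
    convert this using 1
    ring

/-- Integer positions for elements of a field, recording the powers of `q` by which they differ. -/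
theorem exists_positions {F : Type*} [Field F] (q : Fˣ) (hq : ∀ n : ℕ, n ≠ 0 → q ^ n ≠ 1)
    (ζ : V → Fˣ) :
    ∃ s : V → ℤ, ∀ u v, ∀ n : ℤ, ζ v = q ^ n * ζ u → s v = s u + n := by
  classical
  have hinj : ∀ n : ℤ, q ^ n = 1 → n = 0 := by
    intro n hn
    by_contra h0
    apply hq n.natAbs (Int.natAbs_ne_zero.2 h0)
    rcases Int.natAbs_eq n with h | h
    · rw [← zpow_natCast, ← h, hn]
    · rw [← zpow_natCast, ← inv_inj, ← zpow_neg, ← h, hn, inv_one]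
  let S : Setoid V := ⟨fun u v => ∃ n : ℤ, ζ v = q ^ n * ζ u, fun u => ⟨0, by simp⟩,
    fun {u v} ⟨n, hn⟩ => ⟨-n, by rw [hn, zpow_neg, inv_mul_cancel_left]⟩,
    fun {u v w} ⟨n, hn⟩ ⟨m, hm⟩ => ⟨m + n, by rw [hm, hn, zpow_add, mul_assoc]⟩⟩
  have hrep : ∀ u, ∃ n : ℤ, ζ u = q ^ n * ζ (Quotient.mk S u).out := fun u =>
    Quotient.exact (s := S) (Quotient.out_eq (Quotient.mk S u))
  choose t ht using hrep
  refine ⟨t, fun u v n hn => ?_⟩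
  have hout : Quotient.mk S u = Quotient.mk S v := Quotient.sound ⟨n, hn⟩
  have h1 := ht v
  rw [hn, ht u, hout, ← mul_assoc, mul_left_inj, ← zpow_add] at h1
  have h2 : q ^ (n + t u - t v) = 1 := by rw [zpow_sub, h1, mul_inv_cancel]
  have := hinj _ h2
  omega

/-- An antisymmetric Laurent polynomial satisfying the wheel conditions lies in the ideal generated
by the kernels of the shuffle products of elements of degree one. -/
theorem mem_orderIdeal_of_mem_wheelIdeal [CharZero K] (hq : ∀ n : ℕ, n ≠ 0 → q ^ n ≠ 1)
    (hd : IsSymmetricCartan d) {N : ℕ} (e₀ : V ≃ Fin N) {h : Laurent K V}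
    (hw : h ∈ wheelIdeal q d col) (hanti : IsAnti (labelPerms col) h) :
    h ∈ orderIdeal q d V col N := by
  classical
  by_contra hnot
  have hne : (orderIdeal q d V col N).colon {h} ≠ ⊤ := by
    intro htop
    have : (1 : Laurent K V) ∈ (orderIdeal q d V col N).colon {h} := htop ▸ Submodule.mem_top
    rw [Submodule.mem_colon_singleton, one_smul] at this
    exact hnot this
  obtain ⟨P, hPmax, hPle⟩ := Ideal.exists_le_maximal _ hne
  let _ : Field (Laurent K V ⧸ P) := Ideal.Quotient.field P
  let φ : Laurent K V →ₐ[K] Laurent K V ⧸ P := Ideal.Quotient.mkₐ K P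
  let qF : (Laurent K V ⧸ P)ˣ := Units.map (algebraMap K (Laurent K V ⧸ P)).toMonoidHom q
  have hqF : ∀ n : ℕ, n ≠ 0 → qF ^ n ≠ 1 := by
    intro n hn h1
    apply hq n hn
    rw [← map_pow] at h1
    have h2 := congrArg (fun x : (Laurent K V ⧸ P)ˣ => (x : Laurent K V ⧸ P)) h1
    apply Units.ext
    apply (algebraMap K (Laurent K V ⧸ P)).injective
    rw [Units.val_one, map_one]
    exact h2
  obtain ⟨s, hs⟩ := exists_positions qF hqF
    (fun v => Units.map φ.toRingHom.toMonoidHom (laurentVar K v))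
  have hs' : ∀ u v, u ≠ v → edgeFactor q d col u v ∈ P → s v = s u - d (col u) (col v) := by
    intro u v _ huv
    rw [sub_eq_add_neg]
    apply hs
    have h1 : φ (edgeFactor q d col u v) = 0 := Ideal.Quotient.eq_zero_iff_mem.2 huv
    rw [edgeFactor, map_sub, sub_eq_zero, map_smul, Algebra.smul_def] at h1
    apply Units.ext
    rw [Units.val_mul, ← map_zpow]
    exact h1
  obtain ⟨l, hl, hl'⟩ := exists_mul_mem_orderIdeal hd hPmax.isPrime hs' e₀
    (∑ c : V → V, (spread s c).natAbs + 1) h hw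
    (fun g hg => hanti g fun v => (Prod.ext_iff.1 (mem_labelPerms.1 hg v)).1)
    (by
      intro c hc hle
      exfalso
      have := Finset.single_le_sum (f := fun c : V → V => (spread s c).natAbs)
        (fun _ _ => Nat.zero_le _) (Finset.mem_univ c)
      rw [Nat.cast_add, Nat.cast_one] at hle
      omega)
  apply hl
  apply hPle
  rw [Submodule.mem_colon_singleton, smul_eq_mul]
  exact hl'

end Generation

/-! ### Expansions in different regions -/

section ConstantTerms

variable {K : Type*} [Field K]

theorem ratSubst_ratVar {σ L : Type*} [Field L] [Algebra K L] (u : σ → L)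
    (hu : AlgebraicIndependent K u) (v : σ) : ratSubst u hu (ratVar K v) = u v := by
  rw [ratSubst, ratVar, IsFractionRing.liftAlgHom_apply, IsFractionRing.lift_algebraMap]
  simp

@[simp]
theorem ratRename_ratVar {σ τ : Type*} (f : σ ↪ τ) (v : σ) :
    ratRename K f (ratVar K v) = ratVar K (f v) :=
  ratSubst_ratVar _ _ v

theorem ratFun_algHom_ext {σ L : Type*} [Field L] [Algebra K L] {f g : RatFun K σ →ₐ[K] L}
    (h : ∀ v, f (ratVar K v) = g (ratVar K v)) : f = g := by
  have h1 : (f : RatFun K σ →+* L) = g := by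
    apply IsFractionRing.ringHom_ext (A := MvPolynomial σ K)
    have h2 : f.comp (Algebra.algHom K (MvPolynomial σ K) (RatFun K σ)) =
        g.comp (Algebra.algHom K (MvPolynomial σ K) (RatFun K σ)) :=
      MvPolynomial.algHom_ext h
    exact fun x => DFunLike.congr_fun h2 x
  exact AlgHom.ext fun x => DFunLike.congr_fun h1 x

theorem ratRename_ratRename {σ τ ρ : Type*} (f : σ ↪ τ) (g : τ ↪ ρ) (R : RatFun K σ) :
    ratRename K g (ratRename K f R) = ratRename K (f.trans g) R := by
  have : (ratRename K g).comp (ratRename K f) = ratRename K (f.trans g) :=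
    ratFun_algHom_ext fun v => by simp
  exact DFunLike.congr_fun this R

theorem ratVar_injective {σ : Type*} : Function.Injective (ratVar K : σ → RatFun K σ) :=
  (algebraicIndependent_ratVar K σ).injective

theorem ratVar_sub_ne_zero {σ : Type*} {a b : σ} (h : a ≠ b) : ratVar K a - ratVar K b ≠ 0 :=
  sub_ne_zero.2 fun h' => h (ratVar_injective h')

/-- The variables are linearly independent over the constants. -/
theorem ratVar_sub_smul_ne_zero {σ : Type*} {a b : σ} (h : a ≠ b) (c : K) :
    ratVar K a - c • ratVar K b ≠ 0 := by
  classical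
  have h1 := (algebraicIndependent_ratVar K σ).linearIndependent
  intro h2
  have h3 := (linearIndependent_iff'.1 h1) ({a, b} : Finset σ)
    (fun x => if x = a then 1 else -c) ?_ a (by simp)
  · simp at h3
  · rw [Finset.sum_pair h]
    simp only [if_true, if_neg h.symm, one_smul, neg_smul]
    rw [← h2]
    ring

theorem expand_ratVar (ε : ℤˣ) (N : ℕ) (a : Fin N) :
    expand K ε N (ratVar K a) = HahnSeries.single (toLex (Pi.single a (ε : ℤ))) 1 :=
  ratSubst_ratVar _ _ a

@[simp]
theorem laurentToRat_lvar {σ : Type*} [Fintype σ] [DecidableEq σ] (v : σ) :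
    laurentToRat K σ (lvar K v) = ratVar K v := by
  rw [laurentToRat, laurentSubst_laurentVar, Units.val_mk0]

theorem coeff_eventually_zero {Γ : Type*} [AddCommGroup Γ] [LinearOrder Γ] [IsOrderedAddMonoid Γ]
    (F : HahnSeries Γ K) {δ : Γ} (hδ : 0 < δ) :
    ∃ n₀ : ℕ, ∀ n ≥ n₀, F.coeff (-(n • δ)) = 0 := by
  by_contra hcon
  push Not at hcon
  have hfreq : ∃ᶠ n : ℕ in Filter.atTop, F.coeff (-(n • δ)) ≠ 0 :=
    Filter.frequently_atTop.2 hcon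
  obtain ⟨φ, hφ, hφ'⟩ := Filter.extraction_of_frequently_atTop hfreq
  have hwf := F.isWF_support
  rw [Set.isWF_iff_no_descending_seq] at hwf
  refine hwf (fun n => -(φ n • δ)) ?_ (fun n => hφ' n)
  intro a b hab
  exact neg_lt_neg (nsmul_lt_nsmul_left hδ (hφ hab))

variable {V : Type*} [Fintype V] [DecidableEq V]

theorem map_laurentToRat_single {N : ℕ} (Ψ : RatFun K V →ₐ[K] Series K N)
    {γ : V → Lex (Fin N → ℤ)} (hΨ : ∀ v, Ψ (ratVar K v) = HahnSeries.single (γ v) 1)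
    (m : V → ℤ) :
    Ψ (laurentToRat K V (AddMonoidAlgebra.single m 1)) = HahnSeries.single (∑ v, m v • γ v) 1 := by
  have hz : ∀ (v : V) (k : ℤ), Ψ (ratVar K v ^ k) = HahnSeries.single (k • γ v) 1 := by
    intro v k
    rw [map_zpow₀, hΨ]
    cases k with
    | ofNat n =>
      rw [Int.ofNat_eq_natCast, zpow_natCast, HahnSeries.single_pow, one_pow, natCast_zsmul]
    | negSucc n =>
      rw [zpow_negSucc, HahnSeries.single_pow, one_pow, negSucc_zsmul]
      symm
      apply eq_inv_of_mul_eq_one_left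
      rw [HahnSeries.single_mul_single]
      simp
  have hs : ∀ s : Finset V, ∏ v ∈ s, (HahnSeries.single (m v • γ v) (1 : K) : Series K N) =
      HahnSeries.single (∑ v ∈ s, m v • γ v) 1 := by
    intro s
    induction s using Finset.induction_on with
    | empty => simp
    | insert a s ha ih =>
      rw [Finset.prod_insert ha, Finset.sum_insert ha, ih, HahnSeries.single_mul_single, mul_one]
  rw [laurentToRat, laurentSubst_single, Units.coe_prod, map_prod, ← hs]
  apply Finset.prod_congr rfl
  intro v _
  rw [Units.val_zpow_eq_zpow_val, Units.val_mk0, hz]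

theorem coeff_zero_laurentToRat {N : ℕ} (Ψ : RatFun K V →ₐ[K] Series K N)
    {γ : V → Lex (Fin N → ℤ)} (hΨ : ∀ v, Ψ (ratVar K v) = HahnSeries.single (γ v) 1)
    (hγ : ∀ m : V → ℤ, ∑ v, m v • γ v = 0 → m = 0) (p : Laurent K V) :
    (Ψ (laurentToRat K V p)).coeff 0 = p.coeff 0 := by
  induction p using AddMonoidAlgebra.induction_linear with
  | zero => simp
  | add f g hf hg => simp [hf, hg]
  | single m a =>
    have h1 : (AddMonoidAlgebra.single m a : Laurent K V) = a • AddMonoidAlgebra.single m 1 := by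
      simp
    rw [h1, map_smul, map_smul, map_laurentToRat_single Ψ hΨ, HahnSeries.coeff_smul,
      HahnSeries.coeff_single]
    by_cases hm : m = 0
    · subst hm; simp
    · rw [if_neg (fun h => hm (hγ m h.symm))]
      simp [hm]

/-- Two expansions of a rational function in which every pole is expanded in the same direction
have the same constant term. A pole is removed by splitting off the first term of its geometric
series; iterating, the remainder eventually has no constant term. -/
theorem coeff_zero_eq {N₁ N₂ : ℕ} (Ψ₁ : RatFun K V →ₐ[K] Series K N₁)
    (Ψ₂ : RatFun K V →ₐ[K] Series K N₂) {γ₁ : V → Lex (Fin N₁ → ℤ)} {γ₂ : V → Lex (Fin N₂ → ℤ)}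
    (hΨ₁ : ∀ v, Ψ₁ (ratVar K v) = HahnSeries.single (γ₁ v) 1)
    (hΨ₂ : ∀ v, Ψ₂ (ratVar K v) = HahnSeries.single (γ₂ v) 1)
    (hγ₁ : ∀ m : V → ℤ, ∑ v, m v • γ₁ v = 0 → m = 0)
    (hγ₂ : ∀ m : V → ℤ, ∑ v, m v • γ₂ v = 0 → m = 0)
    (E : Finset (V × V)) (c : V × V → Kˣ) (h₁ : ∀ p ∈ E, γ₁ p.1 < γ₁ p.2)
    (h₂ : ∀ p ∈ E, γ₂ p.1 < γ₂ p.2) (r : Laurent K V) :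
    (Ψ₁ (laurentToRat K V r / ∏ p ∈ E, (ratVar K p.2 - (c p : K) • ratVar K p.1))).coeff 0 =
    (Ψ₂ (laurentToRat K V r / ∏ p ∈ E, (ratVar K p.2 - (c p : K) • ratVar K p.1))).coeff 0 := by
  induction E using Finset.induction_on generalizing r with
  | empty =>
    simp only [Finset.prod_empty, div_one]
    rw [coeff_zero_laurentToRat Ψ₁ hΨ₁ hγ₁, coeff_zero_laurentToRat Ψ₂ hΨ₂ hγ₂]
  | insert p E hp ih =>
    replace ih := ih (fun p' hp' => h₁ p' (Finset.mem_insert_of_mem hp'))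
      (fun p' hp' => h₂ p' (Finset.mem_insert_of_mem hp'))
    have hp₁ := h₁ p (Finset.mem_insert_self p E)
    have hp₂ := h₂ p (Finset.mem_insert_self p E)
    have hne : p.2 ≠ p.1 := fun h => by rw [h] at hp₁; exact lt_irrefl _ hp₁
    have hP := ratVar_sub_smul_ne_zero hne (c p : K)
    set D := ∏ p ∈ insert p E, (ratVar K p.2 - (c p : K) • ratVar K p.1) with hD
    set D' := ∏ p ∈ E, (ratVar K p.2 - (c p : K) • ratVar K p.1) with hD'
    have hDD : D = (ratVar K p.2 - (c p : K) • ratVar K p.1) * D' := Finset.prod_insert hp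
    let w : V → ℤ := Pi.single p.2 1 - Pi.single p.1 1
    let x : Laurent K V := ((c p)⁻¹ : Kˣ).val • AddMonoidAlgebra.single w 1
    let y : Laurent K V := -(((c p)⁻¹ : Kˣ).val • AddMonoidAlgebra.single (-Pi.single p.1 1) 1)
    have hl : ∀ a : V, lvar K a = AddMonoidAlgebra.single (Pi.single a 1) 1 :=
      fun a => val_laurentVar a
    have hsingle : ∀ a : V, laurentToRat K V (AddMonoidAlgebra.single (-Pi.single a 1) 1) =
        (ratVar K a)⁻¹ := by
      intro a
      apply eq_inv_of_mul_eq_one_left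
      rw [← laurentToRat_lvar, ← map_mul, hl, AddMonoidAlgebra.single_mul_single,
        neg_add_cancel, mul_one, ← AddMonoidAlgebra.one_def, map_one]
    have hx : laurentToRat K V x = ((c p)⁻¹ : Kˣ).val • (ratVar K p.2 * (ratVar K p.1)⁻¹) := by
      rw [map_smul, ← hsingle, ← laurentToRat_lvar, ← map_mul, hl,
        AddMonoidAlgebra.single_mul_single, mul_one, ← sub_eq_add_neg]
    have hy : laurentToRat K V y = -(((c p)⁻¹ : Kˣ).val • (ratVar K p.1)⁻¹) := by
      rw [map_neg, map_smul, hsingle]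
    have hstep : ∀ r : Laurent K V, laurentToRat K V r / D =
        laurentToRat K V (y * r) / D' + laurentToRat K V (x * r) / D := by
      intro r
      have h3 : 1 = laurentToRat K V y * (ratVar K p.2 - (c p : K) • ratVar K p.1) +
          laurentToRat K V x := by
        rw [hx, hy]
        have h4 := ratVar_ne_zero K p.1
        have h5 : algebraMap K (RatFun K V) (c p) ≠ 0 := by simp
        rw [Units.val_inv_eq_inv_val, Algebra.smul_def, Algebra.smul_def, Algebra.smul_def,
          map_inv₀]
        field_simp
        ring
      by_cases hD0 : D' = 0
      · rw [hDD, hD0]; simp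
      · rw [hDD, map_mul, map_mul]
        field_simp
        linear_combination laurentToRat K V r * h3
    have hΔ : ∀ (n : ℕ) (r : Laurent K V),
        (Ψ₁ (laurentToRat K V r / D)).coeff 0 - (Ψ₂ (laurentToRat K V r / D)).coeff 0 =
        (Ψ₁ (laurentToRat K V (x ^ n * r) / D)).coeff 0 -
          (Ψ₂ (laurentToRat K V (x ^ n * r) / D)).coeff 0 := by
      intro n
      induction n with
      | zero => intro r; simp
      | succ n ihn =>
        intro r
        have hpow : x ^ (n + 1) * r = x * (x ^ n * r) := by ring
        rw [ihn, hstep, map_add, map_add, HahnSeries.coeff_add, HahnSeries.coeff_add, ih, hpow]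
        ring
    have hrem : ∀ {N : ℕ} (Ψ : RatFun K V →ₐ[K] Series K N) {γ : V → Lex (Fin N → ℤ)},
        (∀ v, Ψ (ratVar K v) = HahnSeries.single (γ v) 1) → γ p.1 < γ p.2 →
        ∃ n₀ : ℕ, ∀ n ≥ n₀, (Ψ (laurentToRat K V (x ^ n * r) / D)).coeff 0 = 0 := by
      intro N Ψ γ hΨ hγ
      have hδ : 0 < γ p.2 - γ p.1 := sub_pos.2 hγ
      obtain ⟨n₀, hn₀⟩ := coeff_eventually_zero (Ψ (laurentToRat K V r / D)) hδ
      refine ⟨n₀, fun n hn => ?_⟩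
      have hxs : Ψ (laurentToRat K V x) =
          ((c p)⁻¹ : Kˣ).val • HahnSeries.single (γ p.2 - γ p.1) 1 := by
        rw [map_smul, map_smul, map_laurentToRat_single Ψ hΨ]
        congr 2
        have h6 : ∀ a : V, ∑ v, (Pi.single a 1 : V → ℤ) v • γ v = γ a := by
          intro a
          rw [Finset.sum_eq_single a]
          · simp
          · intro b _ hb; simp [Pi.single_eq_of_ne hb]
          · simp
        simp only [w, Pi.sub_apply, sub_smul, Finset.sum_sub_distrib, h6]
      rw [map_mul, map_pow, mul_div_assoc, map_mul, map_pow, hxs, smul_pow, HahnSeries.single_pow,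
        smul_mul_assoc, HahnSeries.coeff_smul, one_pow]
      have h7 : (0 : Lex (Fin N → ℤ)) = -(n • (γ p.2 - γ p.1)) + n • (γ p.2 - γ p.1) := by simp
      rw [h7, HahnSeries.coeff_single_mul_add, hn₀ n hn, mul_zero, smul_zero]
    obtain ⟨n₁, hn₁⟩ := hrem Ψ₁ hΨ₁ hp₁
    obtain ⟨n₂, hn₂⟩ := hrem Ψ₂ hΨ₂ hp₂
    have h8 := hΔ (max n₁ n₂) r
    rw [hn₁ _ (le_max_left _ _), hn₂ _ (le_max_right _ _), sub_zero] at h8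
    exact sub_eq_zero.1 h8

/-- The relation `|z_u| ≫ |z_v|` in the region given by a sign and an enumeration of the
variables. -/
def Dominates {N : ℕ} (ε : ℤˣ) (e : V ≃ Fin N) (u v : V) : Prop :=
  (ε = -1 ∧ e u < e v) ∨ (ε = 1 ∧ e v < e u)

theorem Dominates.lex_lt {N : ℕ} {ε : ℤˣ} {e : V ≃ Fin N} {u v : V} (h : Dominates ε e u v) :
    toLex (Pi.single (e u) (ε : ℤ) : Fin N → ℤ) < toLex (Pi.single (e v) (ε : ℤ)) := by
  rcases h with ⟨rfl, h⟩ | ⟨rfl, h⟩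
  · refine ⟨e u, fun j hj => ?_, ?_⟩
    · simp [Pi.single_eq_of_ne hj.ne, Pi.single_eq_of_ne (hj.trans h).ne]
    · simp [Pi.single_eq_of_ne h.ne]
  · refine ⟨e v, fun j hj => ?_, ?_⟩
    · simp [Pi.single_eq_of_ne hj.ne, Pi.single_eq_of_ne (hj.trans h).ne]
    · simp [Pi.single_eq_of_ne h.ne]

/-- The constant term of a rational function only depends on the directions in which its poles
are expanded. -/
theorem constTerm_eq {N₁ N₂ : ℕ} {ε₁ ε₂ : ℤˣ} {e₁ : V ≃ Fin N₁} {e₂ : V ≃ Fin N₂}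
    (E : Finset (V × V)) (c : V × V → Kˣ) (h₁ : ∀ p ∈ E, Dominates ε₁ e₁ p.1 p.2)
    (h₂ : ∀ p ∈ E, Dominates ε₂ e₂ p.1 p.2) (r : Laurent K V) {f : RatFun K V}
    (hf : f = laurentToRat K V r / ∏ p ∈ E, (ratVar K p.2 - (c p : K) • ratVar K p.1)) :
    constTerm K ε₁ (ratRename K e₁.toEmbedding f) =
      constTerm K ε₂ (ratRename K e₂.toEmbedding f) := by
  have key : ∀ {N : ℕ} (ε : ℤˣ) (e : V ≃ Fin N) (m : V → ℤ),
      ∑ v, m v • toLex (Pi.single (e v) (ε : ℤ) : Fin N → ℤ) = 0 → m = 0 := by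
    intro N ε e m h
    funext v
    have h0 : (∑ v, m v • (Pi.single (e v) (ε : ℤ) : Fin N → ℤ)) = 0 := h
    have h1 := congrFun h0 (e v)
    simp only [Finset.sum_apply, Pi.zero_apply, Pi.smul_apply] at h1
    rw [Finset.sum_eq_single v] at h1
    · simpa using h1
    · intro w _ hw
      simp [Pi.single_eq_of_ne (fun h' => hw (e.injective h').symm)]
    · simp
  subst hf
  exact coeff_zero_eq ((expand K ε₁ N₁).comp (ratRename K e₁.toEmbedding))
    ((expand K ε₂ N₂).comp (ratRename K e₂.toEmbedding))
    (fun v => by rw [AlgHom.comp_apply, ratRename_ratVar, expand_ratVar]; rfl)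
    (fun v => by rw [AlgHom.comp_apply, ratRename_ratVar, expand_ratVar]; rfl)
    (key ε₁ e₁) (key ε₂ e₂) E c (fun p hp => (h₁ p hp).lex_lt) (fun p hp => (h₂ p hp).lex_lt) r

end ConstantTerms

/-! ### Words in the generators and linear maps out of the quadratic algebras -/

section Words

variable (K : Type*) [Field K] {X : Type*}

/-- The monomial of the free algebra with letters `w 0, w 1, …`. -/
def word {N : ℕ} (w : Fin N → X) : FreeAlgebra K X :=
  (List.ofFn fun a => FreeAlgebra.ι K (w a)).prod

theorem word_append {N M : ℕ} (w : Fin N → X) (w' : Fin M → X) :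
    word K (Fin.append w w') = word K w * word K w' := by
  rw [word, word, word, ← List.prod_append, ← List.ofFn_fin_append]
  congr 2
  funext a
  refine Fin.addCases (fun a => ?_) (fun a => ?_) a <;> simp

theorem basisFreeMonoid_ofList (l : List X) :
    FreeAlgebra.basisFreeMonoid K X (FreeMonoid.ofList l) = word K l.get := by
  have h : ∀ l : List X, FreeAlgebra.basisFreeMonoid K X (FreeMonoid.ofList l) =
      (l.map (FreeAlgebra.ι K)).prod := by
    intro l
    simp only [FreeAlgebra.basisFreeMonoid, Module.Basis.map_apply, Finsupp.coe_basisSingleOne]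
    change FreeAlgebra.equivMonoidAlgebraFreeMonoid.symm
      (MonoidAlgebra.single (FreeMonoid.ofList l) 1) = _
    rw [AlgEquiv.symm_apply_eq, map_list_prod, List.map_map]
    induction l with
    | nil => rfl
    | cons x l ih =>
      rw [List.map_cons, List.prod_cons, ← ih, FreeMonoid.ofList_cons]
      simp [FreeAlgebra.equivMonoidAlgebraFreeMonoid, MonoidAlgebra.single_mul_single]
  rw [h, word]
  congr 1
  rw [← List.ofFn_get (l.map (FreeAlgebra.ι K))]
  apply List.ext_get <;> simp

variable {K} {M : Type*} [AddCommMonoid M] [Module K M]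

theorem mem_of_word_mem {p : Submodule K (FreeAlgebra K X)}
    (hp : ∀ (N : ℕ) (w : Fin N → X), word K w ∈ p) (x : FreeAlgebra K X) : x ∈ p := by
  have h1 : Submodule.span K (Set.range (FreeAlgebra.basisFreeMonoid K X)) ≤ p := by
    rw [Submodule.span_le]
    rintro _ ⟨l, rfl⟩
    have := basisFreeMonoid_ofList K (FreeMonoid.toList l)
    rw [FreeMonoid.ofList_toList] at this
    rw [this]
    exact hp _ _
  exact h1 ((FreeAlgebra.basisFreeMonoid K X).mem_span x)

theorem freeAlgebra_linearMap_ext {f g : FreeAlgebra K X →ₗ[K] M}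
    (h : ∀ (N : ℕ) (w : Fin N → X), f (word K w) = g (word K w)) : f = g := by
  apply (FreeAlgebra.basisFreeMonoid K X).ext
  intro l
  have := basisFreeMonoid_ofList K (FreeMonoid.toList l)
  rw [FreeMonoid.ofList_toList] at this
  rw [this, h]

/-- The linear map on the free algebra with prescribed values on the monomials. -/
def wordLinear (F : ∀ N : ℕ, (Fin N → X) → M) : FreeAlgebra K X →ₗ[K] M :=
  (FreeAlgebra.basisFreeMonoid K X).constr K
    fun l => F (FreeMonoid.toList l).length (FreeMonoid.toList l).get

theorem wordLinear_word (F : ∀ N : ℕ, (Fin N → X) → M) {N : ℕ} (w : Fin N → X) :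
    wordLinear F (word K w) = F N w := by
  have h1 : word K w = FreeAlgebra.basisFreeMonoid K X (FreeMonoid.ofList (List.ofFn w)) := by
    rw [basisFreeMonoid_ofList]
    have h3 : ∀ p p' : Σ N, Fin N → X, p = p' → word K p.2 = word K p'.2 := by
      rintro p _ rfl; rfl
    exact (h3 _ _ (List.equivSigmaTuple.right_inv ⟨N, w⟩)).symm
  rw [h1, wordLinear, Module.Basis.constr_basis]
  have h3 : ∀ p p' : Σ N, Fin N → X, p = p' → F p.1 p.2 = F p'.1 p'.2 := by
    rintro p _ rfl; rfl
  exact h3 _ _ (List.equivSigmaTuple.right_inv ⟨N, w⟩)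

/-- A linear map on an algebra descends to a quotient by relations as soon as it respects all
two-sided multiples of the relations. -/
theorem exists_ringQuot_linearMap {A : Type*} [Semiring A] [Algebra K A] (s : A → A → Prop)
    (T : A →ₗ[K] M) (h : ∀ x y, s x y → ∀ a b, T (a * x * b) = T (a * y * b)) :
    ∃ T' : RingQuot s →ₗ[K] M, ∀ x, T' (RingQuot.mkAlgHom K s x) = T x := by
  let c : RingCon A :=
    { r := fun x y => ∀ a b, T (a * x * b) = T (a * y * b)
      iseqv := ⟨fun _ _ _ => rfl, fun h a b => (h a b).symm,
        fun h h' a b => (h a b).trans (h' a b)⟩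
      mul' := by
        intro w x y z h1 h2 a b
        have e1 := h1 a (y * b)
        have e2 := h2 (a * x) b
        simp only [mul_assoc] at e1 e2 ⊢
        rw [e1, e2]
      add' := by
        intro w x y z h1 h2 a b
        simp only [mul_add, add_mul, map_add, h1 a b, h2 a b] }
  have hc : ∀ x y, RingQuot.mkAlgHom K s x = RingQuot.mkAlgHom K s y → T x = T y := by
    intro x y hxy
    rw [← AlgHom.coe_toRingHom, RingQuot.mkAlgHom_coe] at hxy
    have hw : ∀ ⦃x y⦄, s x y → c.mk' x = c.mk' y := fun x y hs => (RingCon.eq c).2 (h x y hs)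
    have h1 := congrArg (RingQuot.lift ⟨c.mk', hw⟩) hxy
    have h3 : ∀ x, RingQuot.lift ⟨c.mk', hw⟩ (RingQuot.mkRingHom s x) = c.mk' x :=
      fun x => RingQuot.lift_mkRingHom_apply c.mk' hw x
    have h2 := (RingCon.eq c).1 (((h3 x).symm.trans h1).trans (h3 y)) 1 1
    simpa using h2
  have hπ := RingQuot.mkAlgHom_surjective K s
  have hi := Function.surjInv_eq hπ
  refine ⟨{ toFun := fun y => T (Function.surjInv hπ y), map_add' := fun y z => ?_,
            map_smul' := fun c y => ?_ }, fun x => hc _ _ (hi _)⟩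
  · rw [← map_add]
    exact hc _ _ (by rw [map_add, hi, hi, hi])
  · rw [RingHom.id_apply, ← map_smul]
    exact hc _ _ (by rw [map_smul, hi, hi])

variable (q : Kˣ) {I : Type*} (d : I → I → ℤ) (h : Half)

theorem mkAlgHom_word {N : ℕ} (w : Fin N → I × ℤ) :
    RingQuot.mkAlgHom K (QuadRel q d h) (word K w) =
      (List.ofFn fun a => gen q d h (w a).1 (w a).2).prod := by
  rw [word, map_list_prod, List.map_ofFn]
  rfl

variable {q d h}

theorem mem_of_gen_prod_mem {p : Submodule K (QuadAlg q d h)}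
    (hp : ∀ (N : ℕ) (w : Fin N → I × ℤ),
      (List.ofFn fun a => gen q d h (w a).1 (w a).2).prod ∈ p) (x : QuadAlg q d h) : x ∈ p := by
  obtain ⟨y, rfl⟩ := RingQuot.mkAlgHom_surjective K (QuadRel q d h) x
  have h1 := mem_of_word_mem (p := p.comap (RingQuot.mkAlgHom K (QuadRel q d h)).toLinearMap)
    (fun N w => by
      rw [Submodule.mem_comap, AlgHom.toLinearMap_apply, mkAlgHom_word]
      exact hp N w) y
  exact h1

theorem quadAlg_linearMap_ext {f g : QuadAlg q d h →ₗ[K] M}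
    (hfg : ∀ (N : ℕ) (w : Fin N → I × ℤ),
      f (List.ofFn fun a => gen q d h (w a).1 (w a).2).prod =
        g (List.ofFn fun a => gen q d h (w a).1 (w a).2).prod) : f = g :=
  LinearMap.ext fun x => mem_of_gen_prod_mem (p := LinearMap.eqLocus f g) hfg x

end Words

/-! ### Shuffle products of elements of degree one -/

section ShuffleWords

variable {K : Type*} [Field K] (q : Kˣ) {I : Type*} [Fintype I] [LinearOrder I] (d : I → I → ℤ)
  (h : Half)

/-- The ways to plug variables `z_a`, where `z_a` has colour `i a`, into the variables of a function
of degree `n`. -/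
abbrev Enumeration {N : ℕ} (n : I → ℕ) (i : Fin N → I) : Type _ :=
  {e : Var n ≃ Fin N // ∀ v, i (e v) = v.1}

theorem exists_colourPerm {n : I → ℕ} (π : Equiv.Perm (Var n)) (hπ : ∀ v, (π v).1 = v.1) :
    ∃ g : ∀ i, Equiv.Perm (Fin (n i)), colourPerm g = π := by
  have h1 : ∀ v : Var n, ∃ b : Fin (n v.1), π v = ⟨v.1, b⟩ := by
    intro v
    have h2 := hπ v
    rcases hv : π v with ⟨j, b⟩
    rw [hv] at h2
    change j = v.1 at h2
    subst h2
    exact ⟨b, rfl⟩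
  choose b hb using h1
  have hinj : ∀ i, Function.Injective (show Fin (n i) → Fin (n i) from fun a => b ⟨i, a⟩) := by
    intro i a a' haa
    have h3 : π ⟨i, a⟩ = π ⟨i, a'⟩ := by
      rw [hb, hb]
      exact congrArg (fun c : Fin (n i) => (⟨i, c⟩ : Var n)) haa
    exact eq_of_heq (Sigma.mk.inj_iff.1 (π.injective h3)).2
  refine ⟨fun i => Equiv.ofBijective (fun a : Fin (n i) => (b ⟨i, a⟩ : Fin (n i)))
    (Finite.injective_iff_bijective.1 (hinj i)), ?_⟩
  ext1 ⟨i, a⟩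
  exact (hb ⟨i, a⟩).symm

theorem colourPerm_injective {n : I → ℕ} :
    Function.Injective (colourPerm : (∀ i, Equiv.Perm (Fin (n i))) → Equiv.Perm (Var n)) := by
  intro g g' hg
  funext i
  ext1 a
  have h1 := DFunLike.congr_fun hg (⟨i, a⟩ : Var n)
  exact eq_of_heq (Sigma.mk.inj_iff.1 h1).2

/-- The permutations of the variables preserving the colours act simply transitively on the
enumerations. -/
def enumerationEquiv {N : ℕ} {n : I → ℕ} {i : Fin N → I} (e₀ : Enumeration n i) :
    (∀ i, Equiv.Perm (Fin (n i))) ≃ Enumeration n i :=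
  Equiv.ofBijective
    (fun g => ⟨(colourPerm g).symm.trans e₀.1, fun v => (e₀.2 _).trans (by
      conv_rhs => rw [← (colourPerm g).apply_symm_apply v]
      rfl)⟩) <| by
    constructor
    · intro g g' hg
      have h1 := congrArg Subtype.val hg
      apply colourPerm_injective
      ext1 v
      have h2 := DFunLike.congr_fun h1 (colourPerm g v)
      simp only [Equiv.trans_apply, Equiv.symm_apply_apply, EmbeddingLike.apply_eq_iff_eq] at h2
      rw [Equiv.eq_symm_apply] at h2
      exact h2.symm
    · rintro ⟨e, he⟩
      obtain ⟨g, hg⟩ := exists_colourPerm (e₀.1.trans e.symm) (fun v => by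
        rw [← he, Equiv.trans_apply, Equiv.apply_symm_apply, e₀.2])
      refine ⟨g, Subtype.ext ?_⟩
      ext1 v
      simp [hg]

theorem coe_enumerationEquiv {N : ℕ} {n : I → ℕ} {i : Fin N → I} (e₀ : Enumeration n i)
    (g : ∀ i, Equiv.Perm (Fin (n i))) :
    (enumerationEquiv e₀ g : Var n ≃ Fin N) = (colourPerm g).symm.trans e₀.1 := rfl

theorem card_colourPerm (n : I → ℕ) :
    Fintype.card (∀ i, Equiv.Perm (Fin (n i))) = ∏ i, (n i).factorial := by
  rw [Fintype.card_pi]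
  simp [Fintype.card_perm]

theorem card_enumeration {N : ℕ} {n : I → ℕ} {i : Fin N → I} (e₀ : Enumeration n i) :
    Fintype.card (Enumeration n i) = ∏ i, (n i).factorial := by
  rw [← Fintype.card_congr (enumerationEquiv e₀), card_colourPerm]

/-- The number of letters of each colour. -/
def wordDegree {N : ℕ} (i : Fin N → I) : I → ℕ := fun j => Fintype.card {a // i a = j}

theorem nonempty_enumeration {N : ℕ} (i : Fin N → I) :
    Nonempty (Enumeration (wordDegree i) i) := by
  let e : Var (wordDegree i) ≃ Fin N :=
    (Equiv.sigmaCongrRight fun j => (Fintype.equivFin {a // i a = j}).symm).trans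
      (Equiv.sigmaFiberEquiv i)
  refine ⟨e, ?_⟩
  rintro ⟨j, b⟩
  exact ((Fintype.equivFin {a // i a = j}).symm b).2

theorem Enumeration.degree_eq {N : ℕ} {n : I → ℕ} {i : Fin N → I} (e : Enumeration n i) :
    n = wordDegree i := by
  funext j
  have e1 : Fin (n j) ≃ {v : Var n // v.1 = j} :=
    { toFun := fun a => ⟨⟨j, a⟩, rfl⟩
      invFun := fun v => v.2 ▸ v.1.2
      left_inv := fun a => rfl
      right_inv := by rintro ⟨⟨_, a⟩, rfl⟩; rfl }
  have e2 : {v : Var n // v.1 = j} ≃ {a // i a = j} :=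
    e.1.subtypeEquiv fun v => by rw [e.2]
  rw [wordDegree, ← Fintype.card_congr (e1.trans e2), Fintype.card_fin]

/-- The sum of the functions obtained from `F` by plugging its variables, whose colours are given
by `i`, into the variables of degree `n` in all possible ways. -/
def symSum {N : ℕ} (n : I → ℕ) (i : Fin N → I) : RatFun K (Fin N) →ₗ[K] RatFun K (Var n) :=
  ∑ e : Enumeration n i, (ratRename K e.1.symm.toEmbedding).toLinearMap

theorem symSum_apply {N : ℕ} (n : I → ℕ) (i : Fin N → I) (F : RatFun K (Fin N)) :
    symSum n i F = ∑ e : Enumeration n i, ratRename K e.1.symm.toEmbedding F := by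
  simp [symSum]

theorem symmetrize_ratRename {N : ℕ} {n : I → ℕ} {i : Fin N → I} (e₀ : Enumeration n i)
    (F : RatFun K (Fin N)) :
    symmetrize K (ratRename K e₀.1.symm.toEmbedding F) = symSum n i F := by
  rw [symmetrize, symSum_apply, ← (enumerationEquiv e₀).sum_comp]
  apply Finset.sum_congr rfl
  intro g _
  rw [ratRename_ratRename]
  rfl

theorem symSum_comp {N : ℕ} (n : I → ℕ) (i : Fin N → I) (σ : Equiv.Perm (Fin N))
    (F : RatFun K (Fin N)) :
    symSum n (i ∘ σ) F = symSum n i (ratRename K σ.toEmbedding F) := by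
  rw [symSum_apply, symSum_apply]
  let E : Enumeration n (i ∘ σ) ≃ Enumeration n i :=
    { toFun := fun e => ⟨e.1.trans σ, e.2⟩
      invFun := fun e => ⟨e.1.trans σ.symm, fun v => by simpa using e.2 v⟩
      left_inv := fun e => Subtype.ext (Equiv.ext fun v => σ.symm_apply_apply _)
      right_inv := fun e => Subtype.ext (Equiv.ext fun v => σ.apply_symm_apply _) }
  refine Fintype.sum_equiv E _ _ fun e => ?_
  rw [ratRename_ratRename]
  congr 2
  ext v : 1
  exact congrArg e.1.symm (σ.symm_apply_apply v).symm

/-- The kernel of the shuffle product of the elements of degree one `z^k` of colour `i`, over the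
letters `(i, k)` of the word `w`. -/
def wordKernel {N : ℕ} (w : Fin N → I × ℤ) : RatFun K (Fin N) :=
  (∏ a, ratVar K a ^ (w a).2) * ∏ a, ∏ b ∈ Finset.univ.filter (fun b => a < b),
    zetaFactor q d h (w a).1 (w b).1 (ratVar K a) (ratVar K b)

/-- The shuffle product of the elements of degree one given by the letters of a word. -/
def wordElement {N : ℕ} (w : Fin N → I × ℤ) : RatSum K I :=
  DirectSum.lof K (I → ℕ) (fun n => RatFun K (Var n)) (wordDegree fun a => (w a).1)
    (symSum _ (fun a => (w a).1) (wordKernel q d h w))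

variable {q d h}

theorem wordElement_eq {N : ℕ} (w : Fin N → I × ℤ) {n : I → ℕ}
    (e : Enumeration n fun a => (w a).1) :
    wordElement q d h w = DirectSum.lof K (I → ℕ) (fun n => RatFun K (Var n)) n
      (symSum n (fun a => (w a).1) (wordKernel q d h w)) := by
  have := e.degree_eq
  subst this
  rfl

theorem map_zetaFactor {L L' : Type*} [Field L] [Algebra K L] [Field L'] [Algebra K L']
    (φ : L →ₐ[K] L') (i j : I) (x y : L) :
    φ (zetaFactor q d h i j x y) = zetaFactor q d h i j (φ x) (φ y) := by
  cases h <;> simp [zetaFactor, zeta, map_div₀]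

theorem wordKernel_append {N M : ℕ} (w : Fin N → I × ℤ) (w' : Fin M → I × ℤ) :
    wordKernel q d h (Fin.append w w') =
      ratRename K (Fin.castAddEmb M) (wordKernel q d h w) *
        ratRename K (Fin.natAddEmb N) (wordKernel q d h w') *
        ∏ a : Fin N, ∏ b : Fin M, zetaFactor q d h (w a).1 (w' b).1
          (ratVar K (Fin.castAdd M a)) (ratVar K (Fin.natAdd N b)) := by
  have h1 : ∀ (a : Fin N) (b : Fin M), Fin.castAdd M a < Fin.natAdd N b := by
    intro a b
    rw [Fin.lt_def]
    simp only [Fin.val_castAdd, Fin.val_natAdd]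
    omega
  have h2 : ∀ (a : Fin N) (b : Fin M), ¬ Fin.natAdd N b < Fin.castAdd M a :=
    fun a b => (h1 a b).le.not_gt
  have h3 : ∀ a b : Fin N, Fin.castAdd M a < Fin.castAdd M b ↔ a < b := fun _ _ => Iff.rfl
  simp only [wordKernel, map_mul, map_prod, map_zpow₀, ratRename_ratVar, map_zetaFactor,
    Finset.prod_filter, Fin.prod_univ_add, Fin.append_left, Fin.append_right,
    Fin.natAdd_lt_natAdd_iff, h1, h2, if_true, if_false, apply_ite, map_one,
    Finset.prod_mul_distrib, Finset.prod_const_one, Fin.castAddEmb_apply,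
    Fin.natAddEmb_apply, h3]
  ring

/-- The variables of a function of degree `n + m` are those of a function of degree `n` and those
of a function of degree `m`. -/
def varSum (n m : I → ℕ) : Var n ⊕ Var m ≃ Var (n + m) :=
  (Equiv.sigmaSumDistrib (fun i => Fin (n i)) (fun i => Fin (m i))).symm.trans
    (Equiv.sigmaCongrRight fun i => (finSumFinEquiv : Fin (n i) ⊕ Fin (m i) ≃ Fin (n i + m i)))

theorem varSum_inl (n m : I → ℕ) (v : Var n) : varSum n m (Sum.inl v) = leftVar n m v := rfl

theorem varSum_inr (n m : I → ℕ) (v : Var m) : varSum n m (Sum.inr v) = rightVar n m v := rfl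

/-- The enumeration of the variables of a word from those of two subwords. -/
def Enumeration.append {N M : ℕ} {n m : I → ℕ} {i : Fin N → I} {j : Fin M → I}
    (e : Enumeration n i) (e' : Enumeration m j) : Enumeration (n + m) (Fin.append i j) :=
  ⟨(varSum n m).symm.trans ((Equiv.sumCongr e.1 e'.1).trans finSumFinEquiv), fun v => by
    obtain ⟨v, rfl⟩ := (varSum n m).surjective v
    rcases v with v | v
    · simp only [Equiv.trans_apply, Equiv.symm_apply_apply, Equiv.sumCongr_apply, Sum.map_inl,
        finSumFinEquiv_apply_left, Fin.append_left, e.2]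
      rfl
    · simp only [Equiv.trans_apply, Equiv.symm_apply_apply, Equiv.sumCongr_apply, Sum.map_inr,
        finSumFinEquiv_apply_right, Fin.append_right, e'.2]
      rfl⟩

theorem Enumeration.append_symm_castAdd {N M : ℕ} {n m : I → ℕ} {i : Fin N → I} {j : Fin M → I}
    (e : Enumeration n i) (e' : Enumeration m j) (a : Fin N) :
    (e.append e').1.symm (Fin.castAdd M a) = leftVar n m (e.1.symm a) := by
  rw [Equiv.symm_apply_eq, ← varSum_inl]
  simp [Enumeration.append]

theorem Enumeration.append_symm_natAdd {N M : ℕ} {n m : I → ℕ} {i : Fin N → I} {j : Fin M → I}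
    (e : Enumeration n i) (e' : Enumeration m j) (b : Fin M) :
    (e.append e').1.symm (Fin.natAdd N b) = rightVar n m (e'.1.symm b) := by
  rw [Equiv.symm_apply_eq, ← varSum_inr]
  simp [Enumeration.append]

theorem shuffleFun_symSum [CharZero K] {N M : ℕ} {n m : I → ℕ} (w : Fin N → I × ℤ)
    (w' : Fin M → I × ℤ) (e₀ : Enumeration n fun a => (w a).1)
    (e₁ : Enumeration m fun a => (w' a).1) :
    shuffleFun q d h (symSum n (fun a => (w a).1) (wordKernel q d h w))
        (symSum m (fun a => (w' a).1) (wordKernel q d h w')) =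
      symSum (n + m) (Fin.append (fun a => (w a).1) fun a => (w' a).1)
        (wordKernel q d h (Fin.append w w')) := by
  have key : ∀ (e : Enumeration n fun a => (w a).1) (e' : Enumeration m fun a => (w' a).1),
      ratRename K (leftVar n m) (ratRename K e.1.symm.toEmbedding (wordKernel q d h w)) *
        ratRename K (rightVar n m) (ratRename K e'.1.symm.toEmbedding (wordKernel q d h w')) *
        ∏ v : Var n, ∏ u : Var m,
          zetaFactor q d h v.1 u.1 (ratVar K (leftVar n m v)) (ratVar K (rightVar n m u)) =
      ratRename K (e.append e').1.symm.toEmbedding (wordKernel q d h (Fin.append w w')) := by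
    intro e e'
    rw [wordKernel_append, map_mul, map_mul, ratRename_ratRename, ratRename_ratRename,
      ratRename_ratRename, ratRename_ratRename]
    congr 1
    · congr 3
      · ext a : 1; exact (e.append_symm_castAdd e' a).symm
      · ext a : 1; exact (e.append_symm_natAdd e' a).symm
    · rw [map_prod, ← e.1.prod_comp]
      apply Finset.prod_congr rfl
      intro v _
      rw [map_prod, ← e'.1.prod_comp]
      apply Finset.prod_congr rfl
      intro u _
      have h4 : (w (e.1 v)).1 = v.1 := e.2 v
      have h5 : (w' (e'.1 u)).1 = u.1 := e'.2 u
      rw [map_zetaFactor, ratRename_ratVar, ratRename_ratVar, h4, h5]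
      simp only [Equiv.coe_toEmbedding]
      rw [e.append_symm_castAdd e', e.append_symm_natAdd e', Equiv.symm_apply_apply,
        Equiv.symm_apply_apply]
  have hsum : symmetrize K (∑ e : Enumeration n (fun a => (w a).1),
      ∑ e' : Enumeration m (fun a => (w' a).1),
        ratRename K (e.append e').1.symm.toEmbedding (wordKernel q d h (Fin.append w w'))) =
      ∑ e : Enumeration n (fun a => (w a).1), ∑ e' : Enumeration m (fun a => (w' a).1),
        symSum (n + m) (Fin.append (fun a => (w a).1) fun a => (w' a).1)
        (wordKernel q d h (Fin.append w w')) := by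
    rw [symmetrize]
    simp only [map_sum]
    rw [Finset.sum_comm]
    refine Finset.sum_congr rfl fun e _ => ?_
    rw [Finset.sum_comm]
    exact Finset.sum_congr rfl fun e' _ => symmetrize_ratRename (e.append e') _
  rw [shuffleFun]
  simp only [symSum_apply (i := fun a => (w a).1), symSum_apply (i := fun a => (w' a).1), map_sum]
  rw [Finset.sum_mul_sum, Finset.sum_mul]
  simp_rw [Finset.sum_mul, key]
  rw [hsum]
  simp only [Finset.sum_const, Finset.card_univ, card_enumeration e₀, card_enumeration e₁]
  rw [← Nat.cast_smul_eq_nsmul K, ← Nat.cast_smul_eq_nsmul K, smul_smul, smul_smul, mul_assoc]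
  have h3 : ∀ n : I → ℕ, ((∏ i, (n i).factorial : ℕ) : K) ≠ 0 := fun n =>
    Nat.cast_ne_zero.2 (Finset.prod_ne_zero_iff.2 fun i _ => Nat.factorial_ne_zero _)
  rw [inv_mul_cancel₀ (mul_ne_zero (h3 n) (h3 m)), one_smul]

theorem wordElement_append [CharZero K] {N M : ℕ} (w : Fin N → I × ℤ) (w' : Fin M → I × ℤ) :
    wordElement q d h (Fin.append w w') =
      shuffleMul q d h (wordElement q d h w) (wordElement q d h w') := by
  obtain ⟨e₀⟩ := nonempty_enumeration fun a => (w a).1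
  obtain ⟨e₁⟩ := nonempty_enumeration fun a => (w' a).1
  have h1 : (Fin.append (fun a => (w a).1) fun a => (w' a).1) =
      fun a => (Fin.append w w' a).1 := by
    funext a
    refine Fin.addCases (fun a => ?_) (fun a => ?_) a <;> simp
  have h2 := shuffleFun_symSum (q := q) (d := d) (h := h) w w' e₀ e₁
  have e := e₀.append e₁
  rw [h1] at h2 e
  rw [wordElement_eq _ e, ← h2, wordElement, wordElement, shuffleMul, DirectSum.toModule_lof,
    LinearMap.flip_apply, DirectSum.toModule_lof, LinearMap.flip_apply]
  rfl

theorem wordElement_nil (w : Fin 0 → I × ℤ) : wordElement q d h w = shuffleOne K := by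
  have : IsEmpty (Var (0 : I → ℕ)) := ⟨fun v => v.2.elim0⟩
  let e : Enumeration (0 : I → ℕ) (fun a => (w a).1) :=
    ⟨Equiv.equivOfIsEmpty _ _, fun v => isEmptyElim v⟩
  rw [wordElement_eq w e, shuffleOne, symSum_apply]
  congr 1
  have h1 : wordKernel q d h w = 1 := by simp [wordKernel]
  simp [h1, card_enumeration e]

theorem wordElement_single [CharZero K] (w : Fin 1 → I × ℤ) :
    wordElement q d h w = shuffleGen K (w 0).1 (w 0).2 := by
  obtain ⟨⟨i, k⟩, hw⟩ : ∃ p, w 0 = p := ⟨_, rfl⟩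
  have h0 : ∀ v : Var (Pi.single i 1 : I → ℕ), v = ⟨i, ⟨0, by simp⟩⟩ := by
    rintro ⟨j, b⟩
    by_cases hj : j = i
    · subst hj
      congr 1
      ext
      have h1 := b.2.trans_eq (Pi.single_eq_same (M := fun _ => ℕ) j 1)
      exact Nat.lt_one_iff.1 h1
    · exact absurd (b.2.trans_eq (Pi.single_eq_of_ne (M := fun _ => ℕ) hj 1)) (Nat.not_lt_zero _)
  let e : Enumeration (Pi.single i 1 : I → ℕ) (fun a => (w a).1) :=
    ⟨{ toFun := fun _ => 0
       invFun := fun _ => ⟨i, ⟨0, by simp⟩⟩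
       left_inv := fun v => (h0 v).symm
       right_inv := fun a => Subsingleton.elim _ _ }, fun v => by
        rw [h0 v]
        change (w 0).1 = i
        rw [hw]⟩
  rw [wordElement_eq w e, hw, shuffleGen, symSum_apply]
  congr 1
  have h1 : wordKernel q d h w = ratVar K 0 ^ k := by
    simp [wordKernel, hw, Finset.filter_singleton]
  have h2 : ∀ e : Enumeration (Pi.single i 1 : I → ℕ) (fun a => (w a).1),
      ratRename K e.1.symm.toEmbedding (wordKernel q d h w) =
        ratVar K (⟨i, ⟨0, by simp⟩⟩ : Var (Pi.single i 1 : I → ℕ)) ^ k := by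
    intro e
    rw [h1, map_zpow₀, ratRename_ratVar, ← h0]
  rw [Finset.sum_congr rfl fun e _ => h2 e, Finset.sum_const, Finset.card_univ,
    card_enumeration e, Finset.prod_eq_one, one_smul]
  intro j _
  by_cases hj : j = i
  · subst hj; simp
  · simp [Pi.single_eq_of_ne hj]

end ShuffleWords

/-! ### Numerators of shuffle products -/

section PairProducts

variable {K : Type*} [Field K] {V : Type*} [Fintype V] [DecidableEq V]

theorem prod_pairs {R : Type*} [CommMonoid R] {N : ℕ} (e : V ≃ Fin N) (G : V → V → R) :
    ∏ p ∈ Finset.univ.filter (fun p : V × V => e p.1 < e p.2), G p.1 p.2 =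
      ∏ a, ∏ b ∈ Finset.univ.filter (fun b => a < b), G (e.symm a) (e.symm b) := by
  simp only [Finset.prod_filter]
  rw [Fintype.prod_prod_type, ← e.symm.prod_comp]
  refine Finset.prod_congr rfl fun a _ => ?_
  rw [← e.symm.prod_comp]
  simp

theorem prod_pairs_swap {R : Type*} [CommMonoid R] {N : ℕ} (e : V ≃ Fin N) (G : V → V → R) :
    ∏ p ∈ Finset.univ.filter (fun p : V × V => e p.2 < e p.1), G p.1 p.2 =
      ∏ p ∈ Finset.univ.filter (fun p : V × V => e p.1 < e p.2), G p.2 p.1 := by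
  simp only [Finset.prod_filter]
  rw [← (Equiv.prodComm V V).prod_comp]
  rfl

/-- The product of all differences `z_u - z_v`, each pair being taken in the order given by `e`. -/
def fullVander (K : Type*) [Field K] {N : ℕ} (e : V ≃ Fin N) : Laurent K V :=
  vander K e fun _ => ()

theorem fullVander_eq {N : ℕ} (e : V ≃ Fin N) : fullVander K e =
    ∏ p ∈ Finset.univ.filter (fun p : V × V => e p.1 < e p.2), (lvar K p.1 - lvar K p.2) := by
  simp [fullVander, vander]

theorem laurentToRat_fullVander {N : ℕ} (e : V ≃ Fin N) :
    laurentToRat K V (fullVander K e) =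
      ∏ p ∈ Finset.univ.filter (fun p : V × V => e p.1 < e p.2),
        (ratVar K p.1 - ratVar K p.2) := by
  rw [fullVander_eq, map_prod]
  simp only [map_sub, laurentToRat_lvar]

theorem laurentToRat_fullVander_ne_zero {N : ℕ} (e : V ≃ Fin N) :
    laurentToRat K V (fullVander K e) ≠ 0 := by
  rw [laurentToRat_fullVander]
  refine Finset.prod_ne_zero_iff.2 fun p hp => ratVar_sub_ne_zero fun h => ?_
  simp [h] at hp

theorem permute_fullVander {N : ℕ} (e : V ≃ Fin N) (g : Equiv.Perm V) :
    permute g (fullVander K e) = ((Equiv.Perm.sign g : ℤ) : Laurent K V) * fullVander K e := by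
  rw [fullVander_eq, map_prod]
  simp only [map_sub, permute_lvar]
  rw [prod_pairs e fun u v => lvar K (g u) - lvar K (g v),
    prod_pairs e fun u v => lvar K u - lvar K v]
  have h1 : ∀ a : Fin N, Finset.univ.filter (fun b => a < b) = Finset.Ioi a := by
    intro a; ext b; simp
  have h2 := Equiv.Perm.prod_Ioi_comp_eq_sign_mul_prod (e.symm.trans (g.trans e))
    (f := fun a b => lvar K (e.symm a) - lvar K (e.symm b)) (fun _ _ => (neg_sub _ _).symm)
  simp only [h1]
  simpa [Equiv.Perm.sign_symm_trans_trans] using h2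

theorem permute_fullVander_eq_fullVander {N : ℕ} (e : V ≃ Fin N) (g : Equiv.Perm V) :
    permute g (fullVander K e) = fullVander K (g.symm.trans e) := by
  rw [fullVander_eq, fullVander_eq, map_prod]
  simp only [map_sub, permute_lvar, Finset.prod_filter]
  rw [← (Equiv.prodCongr g g).prod_comp (fun p : V × V =>
    if (g.symm.trans e) p.1 < (g.symm.trans e) p.2 then lvar K p.1 - lvar K p.2 else 1)]
  simp

theorem exists_fullVander_eq {N : ℕ} (e e' : V ≃ Fin N) :
    ∃ ε : Kˣ, fullVander K e' = (ε : K) • fullVander K e := by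
  have h1 := permute_fullVander (K := K) e (e.trans e'.symm)
  rw [permute_fullVander_eq_fullVander, intCast_mul_eq_smul] at h1
  have h2 : (e.trans e'.symm).symm.trans e = e' := by ext1; simp
  rw [h2] at h1
  refine ⟨Units.map (Int.castRingHom K).toMonoidHom (Equiv.Perm.sign (e.trans e'.symm)), h1⟩

theorem ratRename_laurentToRat (g : Equiv.Perm V) (p : Laurent K V) :
    ratRename K g.toEmbedding (laurentToRat K V p) = laurentToRat K V (permute g p) := by
  have : (ratRename K g.toEmbedding).comp (laurentToRat K V) =
      (laurentToRat K V).comp (permute g) := by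
    apply laurent_algHom_ext
    intro v
    change ratRename K g.toEmbedding (laurentToRat K V (lvar K v)) =
      laurentToRat K V (permute g (lvar K v))
    rw [permute_lvar, laurentToRat_lvar, laurentToRat_lvar, ratRename_ratVar]
    rfl
  exact DFunLike.congr_fun this p

theorem laurentToRat_single (κ : V → ℤ) :
    laurentToRat K V (AddMonoidAlgebra.single κ 1) = ∏ v, ratVar K v ^ κ v := by
  rw [laurentToRat, laurentSubst_single, Units.coe_prod]
  simp

end PairProducts

section Numerators

variable {K : Type*} [Field K] {q : Kˣ} {I : Type*} [Fintype I] [LinearOrder I] {d : I → I → ℤ}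
  {h : Half}

theorem prod_wordKernel {N : ℕ} {n : I → ℕ} {w : Fin N → I × ℤ}
    (e : Enumeration n fun a => (w a).1) :
    ratRename K e.1.symm.toEmbedding (wordKernel q d h w) =
      (∏ v, ratVar K v ^ (w (e.1 v)).2) *
        ∏ p ∈ Finset.univ.filter (fun p : Var n × Var n => e.1 p.1 < e.1 p.2),
          zetaFactor q d h p.1.1 p.2.1 (ratVar K p.1) (ratVar K p.2) := by
  have h1 : ∀ a, (e.1.symm a).1 = (w a).1 := fun a => by
    rw [← e.2, Equiv.apply_symm_apply]
  rw [prod_pairs e.1 fun u v => zetaFactor q d h u.1 v.1 (ratVar K u) (ratVar K v), wordKernel]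
  simp only [map_mul, map_prod, map_zpow₀, ratRename_ratVar, map_zetaFactor, h1]
  rw [← e.1.symm.prod_comp]
  simp

/-- The order of the variables for which the kernel of a shuffle product of elements of degree one
is the quotient of `orderProd` and `fullVander`: that of the factors for `V^+`, and the opposite
one for `V^-`. -/
def halfOrder (h : Half) {V : Type*} {N : ℕ} (e : V ≃ Fin N) : V ≃ Fin N :=
  match h with
  | .plus => e
  | .minus => e.trans Fin.revPerm

theorem halfOrder_halfOrder {V : Type*} {N : ℕ} (e : V ≃ Fin N) :
    halfOrder h (halfOrder h e) = e := by
  cases h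
  · rfl
  · ext1 v
    simp [halfOrder]

theorem zeta_div {L : Type*} [Field L] [Algebra K L] (i j : I) {x y : L}
    (hy : y ≠ 0) :
    zeta q d i j (x / y) = (x - ((q ^ (-d i j) : Kˣ) : K) • y) / (x - y) := by
  by_cases hxy : x = y
  · simp [zeta, hxy, hy]
  · rw [zeta, Algebra.smul_def]
    have h1 : x / y - 1 ≠ 0 := by
      rw [div_sub_one hy]
      exact div_ne_zero (sub_ne_zero.2 hxy) hy
    have h2 : x - y ≠ 0 := sub_ne_zero.2 hxy
    field_simp

theorem prod_zetaFactor (hd : IsSymmetricCartan d) {V : Type*} [Fintype V] [DecidableEq V]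
    (col : V → I) {N : ℕ} (e : V ≃ Fin N) :
    ∏ p ∈ Finset.univ.filter (fun p : V × V => e p.1 < e p.2),
      zetaFactor q d h (col p.1) (col p.2) (ratVar K p.1) (ratVar K p.2) =
    laurentToRat K V (orderProd q d col (halfOrder h e)) /
      laurentToRat K V (fullVander K (halfOrder h e)) := by
  rw [laurentToRat_fullVander, orderProd, map_prod]
  cases h
  · change _ = (∏ p ∈ Finset.univ.filter (fun p : V × V => e p.2 < e p.1),
      laurentToRat K V (edgeFactor q d col p.1 p.2)) /
        ∏ p ∈ Finset.univ.filter (fun p : V × V => e p.1 < e p.2), (ratVar K p.1 - ratVar K p.2)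
    rw [prod_pairs_swap e fun u v => laurentToRat K V (edgeFactor q d col u v),
      ← Finset.prod_div_distrib]
    refine Finset.prod_congr rfl fun p _ => ?_
    rw [edgeFactor, map_sub, map_smul, laurentToRat_lvar, laurentToRat_lvar, hd.symm]
    exact zeta_div _ _ (ratVar_ne_zero K _)
  · simp only [halfOrder, Equiv.trans_apply, Fin.revPerm_apply, Fin.rev_lt_rev]
    rw [prod_pairs_swap e fun u v => ratVar K u - ratVar K v, ← Finset.prod_div_distrib]
    refine Finset.prod_congr rfl fun p _ => ?_
    rw [edgeFactor, map_sub, map_smul, laurentToRat_lvar, laurentToRat_lvar, hd.symm]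
    exact zeta_div _ _ (ratVar_ne_zero K _)

/-- The colours of the variables. -/
abbrev colour {n : I → ℕ} (v : Var n) : I := v.1

/-- The permutations of each colour, as permutations of the variables preserving the colours. -/
def colourPermEquiv (n : I → ℕ) :
    (∀ i, Equiv.Perm (Fin (n i))) ≃ labelPerms (colour : Var n → I) :=
  Equiv.ofBijective (fun g => ⟨colourPerm g, mem_labelPerms.2 fun _ => rfl⟩)
    ⟨fun g g' hg => colourPerm_injective (congrArg Subtype.val hg), fun π => by
      obtain ⟨g, hg⟩ := exists_colourPerm π.1 π.2
      exact ⟨g, Subtype.ext hg⟩⟩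

theorem coe_colourPermEquiv {n : I → ℕ} (g : ∀ i, Equiv.Perm (Fin (n i))) :
    (colourPermEquiv n g : Equiv.Perm (Var n)) = colourPerm g := rfl

theorem symmetrize_laurentToRat_div {n : I → ℕ} {N : ℕ} (e : Var n ≃ Fin N)
    [Fintype (labelPerms (colour : Var n → I))] (p : Laurent K (Var n)) :
    symmetrize K (laurentToRat K _ p / laurentToRat K _ (fullVander K e)) =
      laurentToRat K _ (antisym (labelPerms colour) p) / laurentToRat K _ (fullVander K e) := by
  rw [symmetrize, antisym_apply, map_sum, Finset.sum_div]
  refine Fintype.sum_equiv (colourPermEquiv n) _ _ fun g => ?_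
  rw [map_div₀, ratRename_laurentToRat, ratRename_laurentToRat, permute_fullVander,
    intCast_mul_eq_smul, map_smul, map_smul, coe_colourPermEquiv]
  rcases Int.units_eq_one_or (Equiv.Perm.sign (colourPerm g)) with h | h <;>
    simp [h, div_neg, neg_div]

theorem symSum_wordKernel (hd : IsSymmetricCartan d) {N : ℕ} {n : I → ℕ} {w : Fin N → I × ℤ}
    (e : Enumeration n fun a => (w a).1) [Fintype (labelPerms (colour : Var n → I))] :
    symSum n (fun a => (w a).1) (wordKernel q d h w) =
      laurentToRat K _ (antisym (labelPerms colour)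
        (AddMonoidAlgebra.single (fun v => (w (e.1 v)).2) 1 *
          orderProd q d colour (halfOrder h e.1))) /
        laurentToRat K _ (fullVander K (halfOrder h e.1)) := by
  rw [← symmetrize_ratRename e, prod_wordKernel, prod_zetaFactor hd colour,
    ← laurentToRat_single, ← mul_div_assoc, ← map_mul, symmetrize_laurentToRat_div]

theorem exists_lexOrder (n : I → ℕ) :
    ∃ e : Var n ≃ Fin (Fintype.card (Var n)), ∀ u v : Var n, u.1 < v.1 → e u < e v := by
  have hc : Fintype.card (Σₗ i, Fin (n i)) = Fintype.card (Var n) := rfl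
  let f := Fintype.orderIsoFinOfCardEq (Σₗ i, Fin (n i)) hc
  refine ⟨toLex.trans f.symm.toEquiv, fun u v huv => ?_⟩
  change f.symm (toLex u) < f.symm (toLex v)
  rw [OrderIso.lt_iff_lt]
  obtain ⟨i, a⟩ := u
  obtain ⟨j, b⟩ := v
  exact Sigma.Lex.left _ _ huv

/-- The denominator of the elements of the big shuffle algebra of degree `n`. -/
def colourVander (K : Type*) [Field K] (n : I → ℕ) : Laurent K (Var n) :=
  ∏ p ∈ Finset.univ.filter (fun p : Var n × Var n => colour p.1 < colour p.2),
    (lvar K p.1 - lvar K p.2)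

theorem laurentToRat_colourVander (n : I → ℕ) :
    laurentToRat K _ (colourVander K n) = shuffleDen K n := by
  simp only [colourVander, map_prod, map_sub, laurentToRat_lvar, shuffleDen]
  simp only [Finset.prod_filter]
  rw [Fintype.prod_prod_type, Fintype.prod_sigma]
  refine Finset.prod_congr rfl fun i _ => ?_
  simp_rw [Fintype.prod_sigma]
  rw [Finset.prod_comm]
  refine Finset.prod_congr rfl fun j _ => ?_
  split_ifs <;> simp

theorem colourVander_ne_zero (n : I → ℕ) : colourVander K n ≠ 0 := by
  refine Finset.prod_ne_zero_iff.2 fun p hp => lvar_sub_ne_zero fun h => ?_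
  simp [h] at hp

theorem shuffleDen_ne_zero (n : I → ℕ) : shuffleDen K n ≠ 0 := by
  rw [← laurentToRat_colourVander]
  simp only [colourVander, map_prod, map_sub, laurentToRat_lvar]
  refine Finset.prod_ne_zero_iff.2 fun p hp => ratVar_sub_ne_zero fun h => ?_
  simp [h] at hp

theorem permute_colourVander {n : I → ℕ} {g : Equiv.Perm (Var n)}
    (hg : g ∈ labelPerms (colour : Var n → I)) :
    permute g (colourVander K n) = colourVander K n := by
  rw [mem_labelPerms] at hg
  simp only [colourVander, map_prod, map_sub, permute_lvar]
  simp only [Finset.prod_filter]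
  rw [← (Equiv.prodCongr g g).prod_comp (fun p : Var n × Var n =>
    if colour p.1 < colour p.2 then lvar K p.1 - lvar K p.2 else 1)]
  simp [hg]

theorem fullVander_eq_mul_colourVander {n : I → ℕ} {N : ℕ} (e : Var n ≃ Fin N)
    (he : ∀ u v : Var n, u.1 < v.1 → e u < e v) :
    fullVander K e = vander K e colour * colourVander K n := by
  rw [fullVander_eq, vander, colourVander, ← Finset.prod_union]
  · refine Finset.prod_congr ?_ fun _ _ => rfl
    ext p
    simp only [Finset.mem_filter, Finset.mem_univ, true_and, Finset.mem_union]
    constructor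
    · intro hp
      rcases lt_trichotomy (colour p.1) (colour p.2) with h | h | h
      · exact Or.inr h
      · exact Or.inl ⟨hp, h⟩
      · exact absurd (he _ _ h) hp.le.not_gt
    · rintro (hp | hp)
      · exact hp.1
      · exact he _ _ hp
  · rw [Finset.disjoint_filter]
    intro p _ hp hp'
    exact hp'.ne hp.2

theorem isAnti_vander_colour {n : I → ℕ} {N : ℕ} (e : Var n ≃ Fin N)
    (he : ∀ u v : Var n, u.1 < v.1 → e u < e v) :
    IsAnti (labelPerms (colour : Var n → I)) (vander K e colour) := by
  intro g hg
  apply mul_right_cancel₀ (colourVander_ne_zero (K := K) n)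
  rw [mul_assoc, ← fullVander_eq_mul_colourVander e he, ← permute_fullVander,
    fullVander_eq_mul_colourVander e he, map_mul, permute_colourVander hg]

end Numerators

/-! ### The wheel conditions characterize the shuffle products of elements of degree one -/

section Characterization

variable {K : Type*} [Field K] {q : Kˣ} {I : Type*} [Fintype I] [LinearOrder I] {d : I → I → ℤ}
  {h : Half}

theorem zpow_injective (hq : ∀ n : ℕ, n ≠ 0 → q ^ n ≠ 1) : Function.Injective fun m : ℤ => q ^ m :=
  injective_zpow_iff_not_isOfFinOrder.2 fun hf => by
    obtain ⟨m, hm, h1⟩ := isOfFinOrder_iff_pow_eq_one.1 hf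
    exact hq m hm.ne' h1

theorem smul_lvar_inj {σ : Type*} [DecidableEq σ] {a b : σ} {x y : Kˣ}
    (hxy : (x : K) • lvar K a = (y : K) • lvar K b) : a = b ∧ x = y := by
  have h1 := congrArg (fun f : Laurent K σ => f.coeff (Pi.single a 1)) hxy
  simp only [val_laurentVar] at h1
  by_cases hab : a = b
  · subst hab
    refine ⟨rfl, Units.ext ?_⟩
    simpa using h1
  · exfalso
    have h2 : (Pi.single b 1 : σ → ℤ) ≠ Pi.single a 1 := fun h2 => by
      have := congrFun h2 a
      simp [Pi.single_eq_of_ne hab] at this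
    simp [h2] at h1

section Zigzag

variable {n : I → ℕ} {i j : I} {s t s' t' : ℤ}

theorem val_zigzagValue_left {v : Var n} (hv : v.1 = i ∧ s + 2 * (v.2 : ℕ) ≤ t) :
    laurentSubst (zigzagValue q n i j s t s' t') (lvar K v) =
      ((q ^ (s + 2 * (v.2 : ℕ)) : Kˣ) : K) • lvar K (Sum.inl false) := by
  rw [laurentSubst_laurentVar, zigzagValue, if_pos hv, Algebra.smul_def]
  rfl

theorem val_zigzagValue_right (hij : i ≠ j) {v : Var n}
    (hv : v.1 = j ∧ s' + 2 * (v.2 : ℕ) ≤ t') :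
    laurentSubst (zigzagValue q n i j s t s' t') (lvar K v) =
      ((q ^ (s' + 2 * (v.2 : ℕ)) : Kˣ) : K) • lvar K (Sum.inl true) := by
  rw [laurentSubst_laurentVar, zigzagValue, if_neg, if_pos hv, Algebra.smul_def]
  · rfl
  · exact fun h1 => hij (h1.1.symm.trans hv.1)

theorem val_zigzagValue_other {v : Var n} (hv : ¬(v.1 = i ∧ s + 2 * (v.2 : ℕ) ≤ t))
    (hv' : ¬(v.1 = j ∧ s' + 2 * (v.2 : ℕ) ≤ t')) :
    laurentSubst (zigzagValue q n i j s t s' t') (lvar K v) = lvar K (Sum.inr v) := by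
  rw [laurentSubst_laurentVar, zigzagValue, if_neg hv, if_neg hv']

/-- The specialization attached to a zig-zag separates variables of the same colour, even after
setting `x = y`. -/
theorem not_dvd_zigzag_vander (hq : ∀ n : ℕ, n ≠ 0 → q ^ n ≠ 1) (hij : i ≠ j) {N : ℕ}
    (e : Var n ≃ Fin N) :
    ¬ lvar K (Sum.inl false) - lvar K (Sum.inl true) ∣
      laurentSubst (zigzagValue q n i j s t s' t') (vander K e colour) := by
  rw [sub_dvd_iff_collapse, vander, map_prod, map_prod]
  refine Finset.prod_ne_zero_iff.2 fun p hp => ?_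
  simp only [Finset.mem_filter, Finset.mem_univ, true_and] at hp
  obtain ⟨h1, h2⟩ := hp
  have hne : p.1 ≠ p.2 := fun h3 => by simp [h3] at h1
  rw [map_sub, map_sub, sub_ne_zero]
  -- The value of each variable after setting `x = y`.
  have hval : ∀ v : Var n, ∃ (c : Kˣ) (ρ : Bool ⊕ Var n),
      collapse (Sum.inl false) (Sum.inl true)
        (laurentSubst (zigzagValue q n i j s t s' t') (lvar K v)) = (c : K) • lvar K ρ ∧
      ((v.1 = i ∧ s + 2 * (v.2 : ℕ) ≤ t ∧ c = q ^ (s + 2 * (v.2 : ℕ)) ∧ ρ = Sum.inl true) ∨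
        (v.1 = j ∧ s' + 2 * (v.2 : ℕ) ≤ t' ∧ c = q ^ (s' + 2 * (v.2 : ℕ)) ∧ ρ = Sum.inl true) ∨
        ρ = Sum.inr v) := by
    intro v
    by_cases hv : v.1 = i ∧ s + 2 * (v.2 : ℕ) ≤ t
    · refine ⟨_, Sum.inl true, ?_, Or.inl ⟨hv.1, hv.2, rfl, rfl⟩⟩
      rw [val_zigzagValue_left hv, map_smul, collapse_lvar, if_pos rfl]
    · by_cases hv' : v.1 = j ∧ s' + 2 * (v.2 : ℕ) ≤ t'
      · refine ⟨_, Sum.inl true, ?_, Or.inr (Or.inl ⟨hv'.1, hv'.2, rfl, rfl⟩)⟩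
        rw [val_zigzagValue_right hij hv', map_smul, collapse_lvar, if_neg (by simp)]
      · refine ⟨1, Sum.inr v, ?_, Or.inr (Or.inr rfl)⟩
        rw [val_zigzagValue_other hv hv', collapse_lvar, if_neg (by simp), Units.val_one, one_smul]
  have hsnd : ∀ u v : Var n, u.1 = v.1 → ((u.2 : ℕ) : ℤ) = (v.2 : ℕ) → u = v := by
    rintro ⟨c, a⟩ ⟨c', b⟩ h3 h4
    change c = c' at h3
    subst h3
    congr 1
    ext
    exact_mod_cast h4
  obtain ⟨c, ρ, e1, e2⟩ := hval p.1
  obtain ⟨c', ρ', e3, e4⟩ := hval p.2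
  rw [e1, e3]
  intro h3
  obtain ⟨h4, h5⟩ := smul_lvar_inj h3
  have h2' : p.1.1 = p.2.1 := h2
  rcases e2 with ⟨a1, -, a3, a4⟩ | ⟨a1, -, a3, a4⟩ | a4 <;>
  rcases e4 with ⟨b1, -, b3, b4⟩ | ⟨b1, -, b3, b4⟩ | b4
  · rw [a3, b3] at h5
    have := zpow_injective hq h5
    exact hne (hsnd _ _ h2' (by linarith))
  · exact hij (a1.symm.trans (h2'.trans b1))
  · rw [a4, b4] at h4; cases h4
  · exact hij (b1.symm.trans (h2'.symm.trans a1))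
  · rw [a3, b3] at h5
    have := zpow_injective hq h5
    exact hne (hsnd _ _ h2' (by linarith))
  · rw [a4, b4] at h4; cases h4
  · rw [a4, b4] at h4; cases h4
  · rw [a4, b4] at h4; cases h4
  · rw [a4, b4] at h4; exact hne (Sum.inr_injective h4)

end Zigzag

theorem wheelCondition_of_mem_orderIdeal (hq : ∀ n : ℕ, n ≠ 0 → q ^ n ≠ 1)
    (hd : IsSymmetricCartan d) {n : I → ℕ} {N : ℕ} (e : Var n ≃ Fin N) {r : Laurent K (Var n)}
    (hr : vander K e colour * r ∈ orderIdeal q d (Var n) colour N) : WheelCondition q d r := by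
  rintro i j s t s' t' m hij ⟨hm, k, l, hkl, rfl, rfl, h1, h2⟩ hi hj
  have hi' : k + m ≤ n i := by omega
  have hj' : l + m ≤ n j := by omega
  have hp : Prime (lvar K (Sum.inl false : Bool ⊕ Var n) - lvar K (Sum.inl true)) :=
    prime_lvar_sub (by simp)
  refine hp.pow_dvd_of_dvd_mul_left m (not_dvd_zigzag_vander (s := s)
    (t := s + 2 * (k + m - 1)) (s' := s') (t' := s' + 2 * (l + m - 1)) hq hij e) ?_
  rw [← map_mul]
  set φ := laurentSubst (K := K)
    (zigzagValue q n i j s (s + 2 * (k + m - 1)) s' (s' + 2 * (l + m - 1))) with hφ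
  have hI : orderIdeal q d (Var n) colour N ≤
      (Ideal.span {(lvar K (Sum.inl false : Bool ⊕ Var n) - lvar K (Sum.inl true)) ^ m}).comap
        φ := by
    rw [orderIdeal, Ideal.span_le]
    rintro _ ⟨e', rfl⟩
    simp only [SetLike.mem_coe, Ideal.mem_comap, Ideal.mem_span_singleton]
    let α : ℕ → Var n := fun a => ⟨i, ⟨min a (n i - 1), by omega⟩⟩
    let β : ℕ → Var n := fun a => ⟨j, ⟨min a (n j - 1), by omega⟩⟩
    refine pow_dvd_map_orderProd (k := k) (l := l) (x := s) (y := s') (α := α) (β := β) hd φ e'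
      hij (by linarith) (by linarith) (fun _ _ => rfl) (fun _ _ => rfl) ?_ ?_ ?_ ?_
    · intro a ha b hb hab
      have h3 : min a (n i - 1) = min b (n i - 1) :=
        congrArg Fin.val (eq_of_heq (Sigma.mk.inj_iff.1 hab).2)
      simp only [Set.mem_Iio] at ha hb
      omega
    · intro a ha b hb hab
      have h3 : min a (n j - 1) = min b (n j - 1) :=
        congrArg Fin.val (eq_of_heq (Sigma.mk.inj_iff.1 hab).2)
      simp only [Set.mem_Iio] at ha hb
      omega
    · intro a ha
      have h3 : ((α a).2 : ℕ) = a := by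
        change min a (n i - 1) = a
        omega
      have h4 : (α a).1 = i ∧ s + 2 * ((α a).2 : ℕ) ≤ s + 2 * (k + m - 1) :=
        ⟨rfl, by rw [h3]; omega⟩
      rw [hφ, val_zigzagValue_left h4, h3]
    · intro a ha
      have h3 : ((β a).2 : ℕ) = a := by
        change min a (n j - 1) = a
        omega
      have h4 : (β a).1 = j ∧ s' + 2 * ((β a).2 : ℕ) ≤ s' + 2 * (l + m - 1) :=
        ⟨rfl, by rw [h3]; omega⟩
      rw [hφ, val_zigzagValue_right hij h4, h3]
  exact Ideal.mem_span_singleton.1 (hI hr)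

theorem exists_perm_extending {N M : ℕ} (f : ℕ → Fin N) (hf : Set.InjOn f (Set.Iio M)) :
    ∃ g : Equiv.Perm (Fin N), ∀ a : Fin N, (a : ℕ) < M → g a = f a := by
  have hinj : Set.InjOn (fun a : Fin N => f a)
      ((Finset.univ.filter fun a : Fin N => (a : ℕ) < M : Finset (Fin N)) : Set (Fin N)) := by
    intro a ha b hb hab
    simp only [Finset.coe_filter, Finset.mem_univ, true_and, Set.mem_ofPred_eq] at ha hb
    exact Fin.ext (hf ha hb hab)
  obtain ⟨g, hg⟩ := Finset.exists_equiv_extend_of_card_eq (t := (Finset.univ : Finset (Fin N)))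
    (by simp) (Finset.subset_univ _) hinj
  exact ⟨g.trans (Equiv.subtypeUnivEquiv fun _ => Finset.mem_univ _), fun a ha => hg a (by simpa)⟩

theorem mem_wheelIdeal_of_wheelCondition {n : I → ℕ} {r : Laurent K (Var n)}
    (hr : IsColourSymmetric K r) (hw : WheelCondition q d r) : r ∈ wheelIdeal q d colour := by
  intro i j k l m x y α β X Y φ hij hm h1 h2 hα hβ iα iβ sα sβ
  have hcol : ∀ (c : I) (M : ℕ) (γ : ℕ → Var n), 1 ≤ M → (∀ a < M, colour (γ a) = c) →
      Set.InjOn γ (Set.Iio M) → M ≤ n c ∧ ∃ g : Equiv.Perm (Fin (n c)), ∀ a : Fin (n c),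
        (a : ℕ) < M → (⟨c, g a⟩ : Var n) = γ a := by
    intro c M γ hM hγ hinj
    have h3 : ∀ a, ∃ b : Fin (n c), a < M → γ a = ⟨c, b⟩ := by
      intro a
      by_cases ha : a < M
      · have h4 := hγ a ha
        rcases hv : γ a with ⟨c', b⟩
        rw [hv] at h4
        change c' = c at h4
        subst h4
        exact ⟨b, fun _ => rfl⟩
      · have h4 := hγ 0 hM
        rcases hv : γ 0 with ⟨c', b⟩
        rw [hv] at h4
        change c' = c at h4
        subst h4
        exact ⟨b, fun h => absurd h ha⟩
    choose f hf using h3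
    have hfi : Set.InjOn f (Set.Iio M) := by
      intro a ha b hb hab
      apply hinj ha hb
      rw [hf a ha, hf b hb, hab]
    refine ⟨?_, ?_⟩
    · have := Fintype.card_le_of_injective (fun a : Fin M => f a)
        (fun a b hab => Fin.ext (hfi a.2 b.2 hab))
      simpa using this
    · obtain ⟨g, hg⟩ := exists_perm_extending f hfi
      exact ⟨g, fun a ha => by rw [hg a ha, hf _ ha]⟩
  obtain ⟨hi, gi, hgi⟩ := hcol i (k + m) α (by omega) hα iα
  obtain ⟨hj, gj, hgj⟩ := hcol j (l + m) β (by omega) hβ iβ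
  obtain ⟨g, hg1, hg2⟩ : ∃ g : ∀ c, Equiv.Perm (Fin (n c)), g i = gi ∧ g j = gj :=
    ⟨Function.update (Function.update (fun _ => 1) i gi) j gj, by simp [hij], by simp⟩
  let u : Bool ⊕ Var n → (Laurent K (Var n))ˣ :=
    Sum.elim (fun b => if b then Y else X)
      fun v => Units.map φ.toMonoidHom (laurentVar K (colourPerm g v))
  have hspec := hw i j x (x + 2 * (k + m - 1)) y (y + 2 * (l + m - 1)) m hij
    ⟨hm, k, l, by linarith, rfl, rfl, by linarith, by linarith⟩ (by omega) (by omega)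
  have hψ := map_dvd (laurentSubst u) hspec
  rw [map_pow, map_sub, laurentSubst_laurentVar, laurentSubst_laurentVar] at hψ
  have h3 : laurentSubst u (laurentSubst (K := K) (zigzagValue q n i j x (x + 2 * (k + m - 1)) y
      (y + 2 * (l + m - 1))) r) = φ r := by
    have h4 := hr g
    conv_rhs => rw [← h4]
    rw [algHom_laurentSubst φ _ (fun v => Units.map φ.toMonoidHom (laurentVar K (colourPerm g v)))
      (fun v => rfl)]
    refine algHom_laurentSubst (laurentSubst u) _ _ (fun v => ?_) r
    rw [← laurentSubst_laurentVar (K := K) (zigzagValue q n i j x (x + 2 * (k + m - 1)) y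
      (y + 2 * (l + m - 1))) v]
    by_cases hv : v.1 = i ∧ x + 2 * (v.2 : ℕ) ≤ x + 2 * (k + m - 1)
    · have h5 := val_zigzagValue_left (K := K) (q := q) (j := j) (s' := y)
        (t' := y + 2 * (l + m - 1)) hv
      rw [h5, map_smul, laurentSubst_laurentVar]
      obtain ⟨c, a⟩ := v
      obtain ⟨rfl, hv⟩ := hv
      simp only at hv
      have h6 := sα a (by omega)
      rw [← hgi a (by omega), ← hg1] at h6
      exact h6.symm
    · by_cases hv' : v.1 = j ∧ y + 2 * (v.2 : ℕ) ≤ y + 2 * (l + m - 1)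
      · have h5 := val_zigzagValue_right (K := K) (q := q) (s := x)
          (t := x + 2 * (k + m - 1)) hij hv'
        rw [h5, map_smul, laurentSubst_laurentVar]
        obtain ⟨c, a⟩ := v
        obtain ⟨rfl, hv'⟩ := hv'
        simp only at hv'
        have h6 := sβ a (by omega)
        rw [← hgj a (by omega), ← hg2] at h6
        exact h6.symm
      · rw [val_zigzagValue_other hv hv', laurentSubst_laurentVar]
        rfl
  rwa [h3] at hψ

variable (q d) in
/-- The functions of degree `n` which are quotients of colour-antisymmetric elements of the ideal
`orderIdeal` by the product of all differences of variables. -/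
def IsOrderQuotient {n : I → ℕ} {N : ℕ} (e : Var n ≃ Fin N) (R : RatFun K (Var n)) : Prop :=
  ∃ p ∈ orderIdeal q d (Var n) colour N, IsAnti (labelPerms (colour : Var n → I)) p ∧
    R = laurentToRat K _ p / laurentToRat K _ (fullVander K e)

theorem IsOrderQuotient.of_order {n : I → ℕ} {N : ℕ} {e : Var n ≃ Fin N} {R : RatFun K (Var n)}
    (hR : IsOrderQuotient q d e R) (e' : Var n ≃ Fin N) : IsOrderQuotient q d e' R := by
  obtain ⟨p, hp, ha, rfl⟩ := hR
  obtain ⟨ε, hε⟩ := exists_fullVander_eq (K := K) e' e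
  refine ⟨((ε⁻¹ : Kˣ) : K) • p, Submodule.smul_of_tower_mem _ _ hp, isAnti_smul _ ha, ?_⟩
  rw [hε, map_smul, map_smul, Algebra.smul_def, Algebra.smul_def, Units.val_inv_eq_inv_val,
    map_inv₀]
  have h1 : algebraMap K (RatFun K (Var n)) ε ≠ 0 := by simp
  have h2 := laurentToRat_fullVander_ne_zero (K := K) e'
  field_simp

theorem exists_numerator_of_isOrderQuotient [CharZero K] (hq : ∀ n : ℕ, n ≠ 0 → q ^ n ≠ 1)
    (hd : IsSymmetricCartan d) {n : I → ℕ} {N : ℕ} {e : Var n ≃ Fin N}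
    (he : ∀ u v : Var n, u.1 < v.1 → e u < e v) {R : RatFun K (Var n)}
    (hR : IsOrderQuotient q d e R) : ∃ r, IsNumerator K R r ∧ WheelCondition q d r := by
  obtain ⟨p, hp, ha, rfl⟩ := hR
  obtain ⟨r, rfl⟩ := vander_dvd_of_anti e colour ha
    fun u v huv => swap_mem_labelPerms huv
  have hV := vander_ne_zero (K := K) e (colour : Var n → I)
  refine ⟨r, ⟨fun g => ?_, ?_⟩, wheelCondition_of_mem_orderIdeal hq hd e hp⟩
  · have hg : colourPerm g ∈ labelPerms (colour : Var n → I) := (colourPermEquiv n g).2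
    have h1 := ha _ hg
    rw [map_mul, isAnti_vander_colour e he _ hg, mul_assoc] at h1
    have h2 : ((Equiv.Perm.sign (colourPerm g) : ℤ) : Laurent K (Var n)) ≠ 0 := by
      rcases Int.units_eq_one_or (Equiv.Perm.sign (colourPerm g)) with h | h <;> simp [h]
    exact mul_left_cancel₀ hV (mul_left_cancel₀ h2 h1)
  · have h3 := laurentToRat_fullVander_ne_zero (K := K) e
    have h4 := congrArg (laurentToRat K _) (fullVander_eq_mul_colourVander (K := K) e he)
    rw [map_mul, laurentToRat_colourVander] at h4
    rw [h4] at h3 ⊢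
    rw [map_mul, mul_div_mul_left _ _ (left_ne_zero_of_mul h3)]

theorem isOrderQuotient_of_numerator [CharZero K] (hq : ∀ n : ℕ, n ≠ 0 → q ^ n ≠ 1)
    (hd : IsSymmetricCartan d) {n : I → ℕ} {N : ℕ} {e : Var n ≃ Fin N}
    (he : ∀ u v : Var n, u.1 < v.1 → e u < e v) {R : RatFun K (Var n)} {r : Laurent K (Var n)}
    (hr : IsNumerator K R r) (hw : WheelCondition q d r) : IsOrderQuotient q d e R := by
  have ha : IsAnti (labelPerms (colour : Var n → I)) (r * vander K e colour) := by
    refine isAnti_mul (fun g hg => ?_) (isAnti_vander_colour e he)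
    obtain ⟨g', hg'⟩ := (colourPermEquiv n).surjective ⟨g, hg⟩
    have h1 := hr.1 g'
    rwa [← coe_colourPermEquiv, hg'] at h1
  refine ⟨r * vander K e colour, mem_orderIdeal_of_mem_wheelIdeal hq hd e
    (Ideal.mul_mem_right _ _ (mem_wheelIdeal_of_wheelCondition hr.1 hw)) ha, ha, ?_⟩
  have h3 := laurentToRat_fullVander_ne_zero (K := K) e
  have h4 := congrArg (laurentToRat K _) (fullVander_eq_mul_colourVander (K := K) e he)
  rw [map_mul, laurentToRat_colourVander] at h4
  rw [h4] at h3 ⊢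
  rw [map_mul, mul_comm (laurentToRat K _ r), mul_div_mul_left _ _ (left_ne_zero_of_mul h3), hr.2]

theorem isOrderQuotient_symSum (hd : IsSymmetricCartan d) {N : ℕ} {n : I → ℕ}
    {w : Fin N → I × ℤ} (e : Enumeration n fun a => (w a).1) :
    IsOrderQuotient q d (halfOrder h e.1)
      (symSum n (fun a => (w a).1) (wordKernel q d h w)) := by
  classical
  refine ⟨_, ?_, isAnti_antisym _ _, symSum_wordKernel hd e⟩
  exact antisym_mem_orderIdeal (fun g hg => mem_labelPerms.1 hg)
    (Ideal.mul_mem_left _ _ (Ideal.subset_span ⟨_, rfl⟩))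

variable (q d h) in
/-- The span of the shuffle products of `N` elements of degree one which have degree `n`. -/
def wordSpan (n : I → ℕ) (N : ℕ) : Submodule K (RatFun K (Var n)) :=
  Submodule.span K {R | ∃ w : Fin N → I × ℤ, Nonempty (Enumeration n fun a => (w a).1) ∧
    R = symSum n (fun a => (w a).1) (wordKernel q d h w)}

theorem mem_wordSpan_of_isOrderQuotient [CharZero K] (hd : IsSymmetricCartan d) {n : I → ℕ}
    {N : ℕ} {e : Var n ≃ Fin N} {R : RatFun K (Var n)} (hR : IsOrderQuotient q d e R) :
    R ∈ wordSpan q d h n N := by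
  classical
  have key : ∀ p ∈ orderIdeal q d (Var n) colour N, ∀ a : Laurent K (Var n),
      laurentToRat K _ (antisym (labelPerms (colour : Var n → I)) (a * p)) /
        laurentToRat K _ (fullVander K e) ∈ wordSpan q d h n N := by
    intro p hp
    refine Submodule.span_induction ?_ ?_ ?_ ?_ hp
    · rintro _ ⟨e', rfl⟩ a
      induction a using AddMonoidAlgebra.induction_linear with
      | zero => simp
      | add f g hf hg => rw [add_mul, map_add, map_add, add_div]; exact add_mem hf hg
      | single κ c =>
        have h1 : (AddMonoidAlgebra.single κ c : Laurent K (Var n)) =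
            c • AddMonoidAlgebra.single κ 1 := by simp
        obtain ⟨ε, hε⟩ := exists_fullVander_eq (K := K) e' e
        let e'' : Enumeration n fun a => colour ((halfOrder h e').symm a) :=
          ⟨halfOrder h e', fun v => by simp⟩
        have h2 := symSum_wordKernel (q := q) (h := h) hd (w := fun a =>
          (colour ((halfOrder h e').symm a), κ ((halfOrder h e').symm a))) e''
        have h3 : halfOrder h e''.1 = e' := halfOrder_halfOrder e'
        have h4 : (fun v => κ ((halfOrder h e').symm (e''.1 v))) = κ := by
          funext v; simp [e'']
        rw [h3, h4] at h2
        have h5 : laurentToRat K _ (antisym (labelPerms (colour : Var n → I))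
            (AddMonoidAlgebra.single κ c * orderProd q d colour e')) /
              laurentToRat K _ (fullVander K e) = (c * ((ε⁻¹ : Kˣ) : K)) •
            (laurentToRat K _ (antisym (labelPerms (colour : Var n → I))
            (AddMonoidAlgebra.single κ 1 * orderProd q d colour e')) /
              laurentToRat K _ (fullVander K e')) := by
          rw [h1, hε, smul_mul_assoc, map_smul, map_smul, map_smul, Algebra.smul_def,
            Algebra.smul_def, Algebra.smul_def, Units.val_inv_eq_inv_val, RingHom.map_mul, map_inv₀]
          have h6 : algebraMap K (RatFun K (Var n)) ε ≠ 0 := by simp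
          have h7 := laurentToRat_fullVander_ne_zero (K := K) e'
          field_simp
        rw [h5, ← h2]
        exact Submodule.smul_mem _ _ (Submodule.subset_span ⟨_, ⟨e''⟩, rfl⟩)
    · intro a; simp
    · intro f g _ _ hf hg a
      rw [mul_add, map_add, map_add, add_div]
      exact add_mem (hf a) (hg a)
    · intro b f _ hf a
      rw [smul_eq_mul, ← mul_assoc]
      exact hf (a * b)
  obtain ⟨p, hp, ha, rfl⟩ := hR
  have h1 := key p hp 1
  rw [one_mul, antisym_of_isAnti ha, map_smul, smul_div_assoc] at h1
  exact (Submodule.smul_mem_iff _ (Nat.cast_ne_zero.2 Fintype.card_ne_zero)).1 h1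

end Characterization

/-! ### The homomorphisms to the shuffle algebras and their image -/

section Upsilon

variable {K : Type*} [Field K] {q : Kˣ} {I : Type*} [Fintype I] [LinearOrder I] {d : I → I → ℤ}
  {h : Half}

theorem wordKernel_two (w : Fin 2 → I × ℤ) : wordKernel q d h w =
    ratVar K 0 ^ (w 0).2 * ratVar K 1 ^ (w 1).2 *
      zetaFactor q d h (w 0).1 (w 1).1 (ratVar K 0) (ratVar K 1) := by
  have h0 : Finset.univ.filter (fun b : Fin 2 => 0 < b) = {1} := by decide
  have h1 : Finset.univ.filter (fun b : Fin 2 => 1 < b) = ∅ := by decide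
  rw [wordKernel, Fin.prod_univ_two, Fin.prod_univ_two, h0, h1]
  simp

theorem smul_zetaFactor (hd : IsSymmetricCartan d) {L : Type*} [Field L] [Algebra K L] (i j : I)
    {x y : L} (hx : x ≠ 0) (hy : y ≠ 0) :
    (((q ^ (-d i j) : Kˣ) : K) • x - y) * zetaFactor q d .plus i j x y =
      (x - ((q ^ (-d i j) : Kˣ) : K) • y) * zetaFactor q d .minus i j x y := by
  rw [zetaFactor, zetaFactor, zeta_div _ _ hy, zeta_div _ _ hx, hd.symm j i]
  by_cases hxy : x = y
  · simp [hxy]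
  · have h1 := sub_ne_zero.2 hxy
    have h2 := sub_ne_zero.2 (Ne.symm hxy)
    field_simp
    ring

theorem zetaFactor_minus {L : Type*} [Field L] [Algebra K L] (i j : I) (x y : L) :
    zetaFactor q d .minus i j x y = zetaFactor q d .plus j i y x := rfl

variable (q d h) in
/-- The shuffle product of elements of degree one, extended linearly to the free algebra. -/
def freeUpsilon : FreeAlgebra K (I × ℤ) →ₗ[K] RatSum K I :=
  wordLinear fun _ w => wordElement q d h w

theorem freeUpsilon_mul [CharZero K] (x y : FreeAlgebra K (I × ℤ)) :
    freeUpsilon q d h (x * y) = shuffleMul q d h (freeUpsilon q d h x) (freeUpsilon q d h y) := by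
  have h1 : (LinearMap.mul K (FreeAlgebra K (I × ℤ))).compr₂ (freeUpsilon q d h) =
      (shuffleMul q d h).compl₁₂ (freeUpsilon q d h) (freeUpsilon q d h) := by
    apply freeAlgebra_linearMap_ext
    intro N w
    apply freeAlgebra_linearMap_ext
    intro M w'
    simp only [LinearMap.compr₂_apply, LinearMap.mul_apply', LinearMap.compl₁₂_apply]
    rw [← word_append, freeUpsilon, wordLinear_word, wordLinear_word, wordLinear_word,
      wordElement_append]
  exact LinearMap.congr_fun₂ h1 x y

theorem freeUpsilon_two {i j : I} (k l : ℤ) {n : I → ℕ} (e : Enumeration n ![i, j]) :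
    freeUpsilon q d h (FreeAlgebra.ι K (i, k) * FreeAlgebra.ι K (j, l)) =
      DirectSum.lof K (I → ℕ) (fun n => RatFun K (Var n)) n (symSum n ![i, j]
        (ratVar K 0 ^ k * ratVar K 1 ^ l * zetaFactor q d h i j (ratVar K 0) (ratVar K 1))) := by
  have h1 : FreeAlgebra.ι K (i, k) * FreeAlgebra.ι K (j, l) =
      word K (fun a : Fin 2 => (![i, j] a, ![k, l] a)) := by simp [word]
  rw [h1, freeUpsilon, wordLinear_word, wordElement_eq _ e, wordKernel_two]
  rfl

theorem freeUpsilon_two_swap {i j : I} (k l : ℤ) {n : I → ℕ} (e : Enumeration n ![i, j]) :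
    freeUpsilon q d h (FreeAlgebra.ι K (j, l) * FreeAlgebra.ι K (i, k)) =
      DirectSum.lof K (I → ℕ) (fun n => RatFun K (Var n)) n (symSum n ![i, j]
        (ratVar K 0 ^ k * ratVar K 1 ^ l * zetaFactor q d h j i (ratVar K 1) (ratVar K 0))) := by
  have h1 : ![j, i] = ![i, j] ∘ Equiv.swap 0 1 := by
    funext a; fin_cases a <;> simp
  have e' : Enumeration n ![j, i] := ⟨e.1.trans (Equiv.swap 0 1), fun v => by
    rw [h1, ← e.2]; simp⟩
  rw [freeUpsilon_two l k e', h1, symSum_comp]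
  congr 2
  simp only [map_mul, map_zpow₀, ratRename_ratVar, map_zetaFactor, Equiv.coe_toEmbedding,
    Equiv.swap_apply_left, Equiv.swap_apply_right]
  rw [mul_comm (ratVar K 1 ^ l)]

theorem freeUpsilon_quadRel (hd : IsSymmetricCartan d) {x y : FreeAlgebra K (I × ℤ)}
    (hxy : QuadRel q d h x y) : freeUpsilon q d h x = freeUpsilon q d h y := by
  have x0 := ratVar_ne_zero K (0 : Fin 2)
  have x1 := ratVar_ne_zero K (1 : Fin 2)
  cases hxy with
  | e i j k l =>
    obtain ⟨e⟩ := nonempty_enumeration ![i, j]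
    simp only [map_sub, map_smul]
    rw [freeUpsilon_two _ _ e, freeUpsilon_two _ _ e, freeUpsilon_two_swap _ _ e,
      freeUpsilon_two_swap _ _ e]
    simp only [← map_smul, ← map_sub]
    congr 2
    have h1 := smul_zetaFactor (q := q) hd i j x0 x1
    rw [zetaFactor_minus] at h1
    rw [zpow_add_one₀ x0, zpow_add_one₀ x1]
    simp only [Algebra.smul_def] at h1 ⊢
    linear_combination ratVar K (0 : Fin 2) ^ k * ratVar K 1 ^ l * h1
  | f i j k l =>
    obtain ⟨e⟩ := nonempty_enumeration ![i, j]
    simp only [map_sub, map_smul]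
    rw [freeUpsilon_two _ _ e, freeUpsilon_two _ _ e, freeUpsilon_two_swap _ _ e,
      freeUpsilon_two_swap _ _ e]
    simp only [← map_smul, ← map_sub]
    congr 2
    have h1 := smul_zetaFactor (q := q) hd i j x0 x1
    rw [zetaFactor_minus j i, zpow_add_one₀ x0, zpow_add_one₀ x1]
    simp only [Algebra.smul_def] at h1 ⊢
    linear_combination - (ratVar K (0 : Fin 2) ^ k * ratVar K 1 ^ l * h1)

theorem IsUpsilon.apply_word {Υ : QuadAlg q d h →ₗ[K] bigShuffle K I} [CharZero K]
    (hΥ : IsUpsilon q d h Υ) {N : ℕ} (w : Fin N → I × ℤ) :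
    (Υ (List.ofFn fun a => gen q d h (w a).1 (w a).2).prod : RatSum K I) =
      wordElement q d h w := by
  induction N with
  | zero => rw [List.ofFn_zero, List.prod_nil, hΥ.map_one, wordElement_nil]
  | succ N ih =>
    have h1 : ∃ w₁ : Fin 1 → I × ℤ, ∃ w₂ : Fin N → I × ℤ, ∃ hN : N + 1 = 1 + N,
        w = Fin.append w₁ w₂ ∘ Fin.cast hN := by
      refine ⟨fun _ => w 0, fun a => w a.succ, Nat.add_comm _ _, ?_⟩
      funext a
      refine Fin.cases ?_ (fun a => ?_) a
      · rfl
      · have h2 : Fin.cast (Nat.add_comm N 1) a.succ = Fin.natAdd 1 a := by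
          ext; simp [Nat.add_comm]
        rw [Function.comp_apply, h2, Fin.append_right]
    have h3 : ∀ {M : ℕ} (hM : N + 1 = M) (w' : Fin M → I × ℤ),
        wordElement q d h (w' ∘ Fin.cast hM) = wordElement q d h w' := by
      rintro _ rfl w'; rfl
    rw [List.ofFn_succ, List.prod_cons, hΥ.map_mul, hΥ.map_gen, ih fun a => w a.succ]
    obtain ⟨w₁, w₂, hN, rfl⟩ := h1
    rw [h3, wordElement_append, wordElement_single]
    have h4 : (Fin.append w₁ w₂ ∘ Fin.cast hN) 0 = w₁ 0 := by
      have : Fin.cast hN 0 = Fin.castAdd N 0 := by ext; simp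
      rw [Function.comp_apply, this, Fin.append_left]
    have h5 : (fun a : Fin N => (Fin.append w₁ w₂ ∘ Fin.cast hN) a.succ) = w₂ := by
      funext a
      have : Fin.cast hN a.succ = Fin.natAdd 1 a := by
        ext; simp [Nat.add_comm]
      rw [Function.comp_apply, this, Fin.append_right]
    rw [h4, h5]

theorem exists_numerator_lof {n : I → ℕ} {R : RatFun K (Var n)}
    (P : ∀ {m : I → ℕ}, Laurent K (Var m) → Prop) (h0 : ∀ m : I → ℕ, P (0 : Laurent K (Var m)))
    (hR : ∃ r, IsNumerator K R r ∧ P r) (m : I → ℕ) :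
    ∃ r, IsNumerator K ((DirectSum.lof K (I → ℕ) (fun n => RatFun K (Var n)) n R) m) r ∧ P r := by
  by_cases hm : n = m
  · subst hm
    rw [DirectSum.lof_apply]
    exact hR
  · rw [DirectSum.lof_eq_of, DirectSum.of_eq_of_ne _ _ _ (Ne.symm hm)]
    exact ⟨0, IsNumerator.zero m, h0 m⟩

theorem wheelCondition_zero (n : I → ℕ) : WheelCondition q d (0 : Laurent K (Var n)) :=
  fun _ _ _ _ _ _ _ _ _ _ _ => by simp

theorem exists_numerator_wordElement [CharZero K] (hq : ∀ n : ℕ, n ≠ 0 → q ^ n ≠ 1)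
    (hd : IsSymmetricCartan d) {N : ℕ} (w : Fin N → I × ℤ) (m : I → ℕ) :
    ∃ r, IsNumerator K (wordElement q d h w m) r ∧ WheelCondition q d r := by
  obtain ⟨e⟩ := nonempty_enumeration fun a => (w a).1
  obtain ⟨e₀, he₀⟩ := exists_lexOrder (wordDegree fun a => (w a).1)
  have hN : Fintype.card (Var (wordDegree fun a => (w a).1)) = N := by
    simpa using Fintype.card_congr e.1
  let e₁ : Var (wordDegree fun a => (w a).1) ≃ Fin N := e₀.trans (finCongr hN)
  have he₁ : ∀ u v : Var (wordDegree fun a => (w a).1), u.1 < v.1 → e₁ u < e₁ v :=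
    fun u v huv => he₀ u v huv
  exact exists_numerator_lof (fun r => WheelCondition q d r) (fun m => wheelCondition_zero m)
    (exists_numerator_of_isOrderQuotient hq hd he₁
      ((isOrderQuotient_symSum (h := h) hd e).of_order e₁)) m

theorem freeUpsilon_mem [CharZero K] (hq : ∀ n : ℕ, n ≠ 0 → q ^ n ≠ 1)
    (hd : IsSymmetricCartan d) (x : FreeAlgebra K (I × ℤ)) :
    freeUpsilon q d h x ∈ bigShuffle K I := by
  refine mem_of_word_mem (p := (bigShuffle K I).comap (freeUpsilon q d h)) (fun N w => ?_) x
  rw [Submodule.mem_comap, freeUpsilon, wordLinear_word]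
  intro m
  obtain ⟨r, hr, -⟩ := exists_numerator_wordElement (h := h) hq hd w m
  exact ⟨r, hr⟩

theorem existsUnique_isUpsilon [CharZero K] (hq : ∀ n : ℕ, n ≠ 0 → q ^ n ≠ 1)
    (hd : IsSymmetricCartan d) (h : Half) : ∃! Υ, IsUpsilon q d h Υ := by
  obtain ⟨T, hT⟩ := exists_ringQuot_linearMap (QuadRel q d h)
    ((freeUpsilon q d h).codRestrict (bigShuffle K I) (freeUpsilon_mem hq hd))
    (fun x y hxy a b => Subtype.ext (by
      simp only [LinearMap.codRestrict_apply, freeUpsilon_mul, freeUpsilon_quadRel hd hxy]))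
  have hT' : ∀ x, (T (RingQuot.mkAlgHom K (QuadRel q d h) x) : RatSum K I) =
      freeUpsilon q d h x := fun x => by rw [hT]; rfl
  refine ⟨T, ⟨?_, ?_, ?_⟩, fun T' hT'' => ?_⟩
  · have h1 : (1 : FreeAlgebra K (I × ℤ)) = word K (fun a : Fin 0 => a.elim0) := by simp [word]
    rw [← map_one (RingQuot.mkAlgHom K (QuadRel q d h)), hT', h1, freeUpsilon, wordLinear_word,
      wordElement_nil]
  · intro x y
    obtain ⟨x, rfl⟩ := RingQuot.mkAlgHom_surjective K (QuadRel q d h) x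
    obtain ⟨y, rfl⟩ := RingQuot.mkAlgHom_surjective K (QuadRel q d h) y
    rw [← map_mul, hT', hT', hT', freeUpsilon_mul]
  · intro i k
    have h1 : FreeAlgebra.ι K (i, k) = word K (fun _ : Fin 1 => (i, k)) := by simp [word]
    rw [gen, hT', h1, freeUpsilon, wordLinear_word, wordElement_single]
  · apply quadAlg_linearMap_ext
    intro N w
    apply Subtype.ext
    rw [hT''.apply_word, ← mkAlgHom_word, hT', freeUpsilon, wordLinear_word]

/-- The wheel conditions describe the subalgebra generated by the elements of degree one. -/
theorem IsUpsilon.range_eq [CharZero K] (hq : ∀ n : ℕ, n ≠ 0 → q ^ n ≠ 1)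
    (hd : IsSymmetricCartan d) {Υ : QuadAlg q d h →ₗ[K] bigShuffle K I}
    (hΥ : IsUpsilon q d h Υ) : LinearMap.range Υ = wheelShuffle q d := by
  apply le_antisymm
  · rintro _ ⟨x, rfl⟩
    refine mem_of_gen_prod_mem (p := (wheelShuffle q d).comap Υ) (fun N w m => ?_) x
    rw [hΥ.apply_word]
    exact exists_numerator_wordElement hq hd w m
  · have hword : ∀ n (N : ℕ) (R : RatFun K (Var n)), R ∈ wordSpan q d h n N →
        DirectSum.lof K (I → ℕ) (fun n => RatFun K (Var n)) n R ∈
          (LinearMap.range Υ).map (bigShuffle K I).subtype := by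
      intro n N R hR
      have hle : wordSpan q d h n N ≤ ((LinearMap.range Υ).map (bigShuffle K I).subtype).comap
          (DirectSum.lof K (I → ℕ) (fun n => RatFun K (Var n)) n) := by
        rw [wordSpan, Submodule.span_le]
        rintro _ ⟨w, ⟨e⟩, rfl⟩
        refine ⟨_, ⟨_, rfl⟩, (hΥ.apply_word w).trans ?_⟩
        rw [wordElement_eq _ e]
      exact hle hR
    intro R hR
    have h1 : (R : RatSum K I) ∈ (LinearMap.range Υ).map (bigShuffle K I).subtype := by
      classical
      rw [← DirectSum.sum_support_of (R : RatSum K I)]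
      refine Submodule.sum_mem _ fun n _ => ?_
      obtain ⟨r, hr, hw⟩ := hR n
      obtain ⟨e, he⟩ := exists_lexOrder n
      exact hword n _ _ (mem_wordSpan_of_isOrderQuotient hd
        (isOrderQuotient_of_numerator hq hd he hr hw))
    obtain ⟨R', hR', hR''⟩ := h1
    rwa [← Subtype.ext hR'']

end Upsilon

/-! ### The pairings -/

section Pairings

variable {K : Type*} [Field K] {q : Kˣ} {I : Type*} [Fintype I] [LinearOrder I] {d : I → I → ℤ}

/-- The other half. -/
def Half.opp : Half → Half
  | .plus => .minus
  | .minus => .plus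

/-- The sign of the region in which the reciprocals of the factors `zetaFactor h` are expanded. -/
def halfSign : Half → ℤˣ
  | .plus => 1
  | .minus => -1

variable (h : Half)

theorem dominates_halfSign {V : Type*} {N : ℕ} (e : V ≃ Fin N) (u v : V) :
    Dominates (halfSign h) e u v ↔ halfOrder h e v < halfOrder h e u := by
  cases h
  · simp [Dominates, halfSign, halfOrder]
  · simp [Dominates, halfSign, halfOrder]

variable (q d) in
/-- The factor `(z_v - q^{-d} z_u) / (z_v - z_u)`, the pole of its reciprocal being expanded in the
region `|z_u| ≫ |z_v|`. -/
def poleFactor {n : I → ℕ} (u v : Var n) : RatFun K (Var n) :=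
  (ratVar K v - ((q ^ (-d u.1 v.1) : Kˣ) : K) • ratVar K u) / (ratVar K v - ratVar K u)

theorem poleFactor_ne_zero {n : I → ℕ} {u v : Var n} (huv : u ≠ v) : poleFactor q d u v ≠ 0 :=
  div_ne_zero (ratVar_sub_smul_ne_zero huv.symm _) (ratVar_sub_ne_zero huv.symm)

variable {h}

theorem zetaFactor_plus_ratVar (hd : IsSymmetricCartan d) {n : I → ℕ} (u v : Var n) :
    zetaFactor q d .plus u.1 v.1 (ratVar K u) (ratVar K v) = poleFactor q d v u := by
  rw [zetaFactor, zeta_div _ _ (ratVar_ne_zero K v), hd.symm, poleFactor]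

theorem zetaFactor_minus_ratVar (hd : IsSymmetricCartan d) {n : I → ℕ} (u v : Var n) :
    zetaFactor q d .minus u.1 v.1 (ratVar K u) (ratVar K v) = poleFactor q d u v := by
  rw [zetaFactor, zeta_div _ _ (ratVar_ne_zero K u), hd.symm, poleFactor]

instance {V : Type*} {N : ℕ} (ε : ℤˣ) (e : V ≃ Fin N) (u v : V) : Decidable (Dominates ε e u v) :=
  inferInstanceAs (Decidable ((ε = -1 ∧ e u < e v) ∨ (ε = 1 ∧ e v < e u)))

/-- The pairs of variables `u`, `v` with `|z_u| ≫ |z_v|`. -/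
def dominatedPairs {V : Type*} [Fintype V] {N : ℕ} (ε : ℤˣ) (e : V ≃ Fin N) : Finset (V × V) :=
  Finset.univ.filter fun p => Dominates ε e p.1 p.2

theorem mem_dominatedPairs {V : Type*} [Fintype V] {N : ℕ} {ε : ℤˣ} {e : V ≃ Fin N} {p : V × V} :
    p ∈ dominatedPairs ε e ↔ Dominates ε e p.1 p.2 := by
  simp [dominatedPairs]

theorem prod_zetaFactor_eq_prod_poleFactor (hd : IsSymmetricCartan d) {n : I → ℕ} {N : ℕ}
    (e : Var n ≃ Fin N) :
    ∏ p ∈ Finset.univ.filter (fun p : Var n × Var n => e p.1 < e p.2),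
      zetaFactor q d h p.1.1 p.2.1 (ratVar K p.1) (ratVar K p.2) =
    ∏ p ∈ dominatedPairs (halfSign h) e, poleFactor q d p.1 p.2 := by
  rw [dominatedPairs]
  cases h
  · simp only [zetaFactor_plus_ratVar hd]
    rw [← prod_pairs_swap e fun u v => poleFactor q d u v]
    refine Finset.prod_congr (Finset.filter_congr fun p _ => ?_) fun _ _ => rfl
    simp [Dominates, halfSign]
  · simp only [zetaFactor_minus_ratVar hd]
    refine Finset.prod_congr (Finset.filter_congr fun p _ => ?_) fun _ _ => rfl
    simp [Dominates, halfSign]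

/-- Elements of the big shuffle algebra become Laurent polynomials after multiplication by all
differences of variables. -/
theorem exists_laurent_mul {n : I → ℕ} {R : RatFun K (Var n)} {r : Laurent K (Var n)}
    (hr : IsNumerator K R r) {N : ℕ} (e : Var n ≃ Fin N) :
    ∃ s, R * ∏ p ∈ dominatedPairs (halfSign h) e, (ratVar K p.2 - ratVar K p.1) =
      laurentToRat K _ s := by
  obtain ⟨e₀, he₀⟩ := exists_lexOrder n
  have hN : Fintype.card (Var n) = N := by simpa using Fintype.card_congr e
  let e₁ : Var n ≃ Fin N := e₀.trans (finCongr hN)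
  have he₁ : ∀ u v : Var n, u.1 < v.1 → e₁ u < e₁ v := fun u v huv => he₀ u v huv
  obtain ⟨c, hc⟩ := exists_fullVander_eq (K := K) e₁ (halfOrder h e)
  have h1 : ∏ p ∈ dominatedPairs (halfSign h) e, (ratVar K p.2 - ratVar K p.1) =
      laurentToRat K _ (fullVander K (halfOrder h e)) := by
    rw [laurentToRat_fullVander,
      ← prod_pairs_swap (halfOrder h e) fun u v => ratVar K v - ratVar K u, dominatedPairs]
    exact Finset.prod_congr (Finset.filter_congr fun p _ => dominates_halfSign h e _ _)
      fun _ _ => rfl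
  refine ⟨(c : K) • (r * vander K e₁ colour), ?_⟩
  rw [h1, hc, fullVander_eq_mul_colourVander e₁ he₁, hr.2, map_smul, map_smul, map_mul, map_mul,
    laurentToRat_colourVander, mul_smul_comm]
  congr 1
  have := shuffleDen_ne_zero (K := K) n
  field_simp

theorem ratRename_colourPerm_of_isNumerator {n : I → ℕ} {R : RatFun K (Var n)}
    {r : Laurent K (Var n)} (hr : IsNumerator K R r) (g : ∀ i, Equiv.Perm (Fin (n i))) :
    ratRename K (colourPerm g).toEmbedding R = R := by
  have h1 : permute (colourPerm g) r = r := hr.1 g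
  have h2 : permute (colourPerm g) (colourVander K n) = colourVander K n :=
    permute_colourVander (colourPermEquiv n g).2
  rw [hr.2, ← laurentToRat_colourVander, map_div₀, ratRename_laurentToRat, ratRename_laurentToRat,
    h1, h2]

theorem prod_ratVar_zpow_add_single {V : Type*} [Fintype V] [DecidableEq V] (κ : V → ℤ) (u : V) :
    ∏ v, ratVar K v ^ (κ v + (Pi.single u 1 : V → ℤ) v) =
      (∏ v, ratVar K v ^ κ v) * ratVar K u := by
  simp only [zpow_add₀ (ratVar_ne_zero K _), Finset.prod_mul_distrib]
  congr 1
  rw [Finset.prod_eq_single u]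
  · simp
  · intro v _ hv; simp [Pi.single_eq_of_ne hv]
  · simp

/-- Without a pole along `z_a = q^{-d} z_b` and `z_b = q^{-d} z_a`, an integrand can be expanded in
the region for either relative order of `z_a` and `z_b`. -/
theorem constTerm_swap {n : I → ℕ} {R : RatFun K (Var n)} {r : Laurent K (Var n)}
    (hr : IsNumerator K R r) {N : ℕ} {e e' : Var n ≃ Fin N} {a b : Var n}
    (hab : Dominates (halfSign h) e a b)
    (he' : ∀ p ∈ (dominatedPairs (halfSign h) e).erase (a, b),
      Dominates (halfSign h) e' p.1 p.2) (κ : Var n → ℤ) :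
    constTerm K (halfSign h) (ratRename K e.toEmbedding
      ((∏ v, ratVar K v ^ κ v) * R * (ratVar K b - ratVar K a) /
        ∏ p ∈ (dominatedPairs (halfSign h) e).erase (a, b), poleFactor q d p.1 p.2)) =
    constTerm K (halfSign h) (ratRename K e'.toEmbedding
      ((∏ v, ratVar K v ^ κ v) * R * (ratVar K b - ratVar K a) /
        ∏ p ∈ (dominatedPairs (halfSign h) e).erase (a, b), poleFactor q d p.1 p.2)) := by
  obtain ⟨s, hs⟩ := exists_laurent_mul (h := h) hr e
  rw [← Finset.mul_prod_erase _ _ ((mem_dominatedPairs (p := (a, b))).2 hab)] at hs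
  refine constTerm_eq ((dominatedPairs (halfSign h) e).erase (a, b))
    (fun p => q ^ (-d p.1.1 p.2.1))
    (fun p hp => mem_dominatedPairs.1 (Finset.mem_of_mem_erase hp)) he'
    (AddMonoidAlgebra.single κ 1 * s) ?_
  rw [map_mul, laurentToRat_single, ← hs]
  simp only [poleFactor, Finset.prod_div_distrib]
  rw [div_div_eq_mul_div]
  ring

variable (q d h) in
/-- The integrand of the pairings, as a function of the variables of `R`: here `e` is the order of
the variables, and `κ` are the exponents. -/
def pairIntegrand {n : I → ℕ} {N : ℕ} (e : Var n ≃ Fin N) (κ : Var n → ℤ) (R : RatFun K (Var n)) :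
    RatFun K (Var n) :=
  (∏ v, ratVar K v ^ κ v) * R / ∏ p ∈ dominatedPairs (halfSign h) e, poleFactor q d p.1 p.2

theorem ratRename_pairIntegrand (hd : IsSymmetricCartan d) {n : I → ℕ} {N : ℕ} {i : Fin N → I}
    (e : Enumeration n i) (k : Fin N → ℤ) (R : RatFun K (Var n)) :
    ratRename K e.1.toEmbedding (pairIntegrand q d h e.1 (fun v => k (e.1 v)) R) =
      ((∏ a, ratVar K a ^ k a) * ratRename K e.1.toEmbedding R) /
        ∏ a, ∏ b ∈ Finset.univ.filter (fun b => a < b),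
          zetaFactor q d h (i a) (i b) (ratVar K a) (ratVar K b) := by
  rw [pairIntegrand, ← prod_zetaFactor_eq_prod_poleFactor hd, map_div₀, map_mul,
    prod_pairs e.1 fun u v => zetaFactor q d h u.1 v.1 (ratVar K u) (ratVar K v)]
  have h1 : ∀ a, (e.1.symm a).1 = i a := fun a => by
    rw [← e.2, Equiv.apply_symm_apply]
  simp only [map_prod, map_zpow₀, ratRename_ratVar, map_zetaFactor, h1, Equiv.coe_toEmbedding,
    Equiv.apply_symm_apply]
  rw [← e.1.prod_comp fun a => ratVar K a ^ k a]

/-- The two integrands for the orders of two consecutive variables `z_u`, `z_v`, combined as in the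
quadratic relations. -/
theorem smul_pairIntegrand {n : I → ℕ} {N : ℕ} (e : Var n ≃ Fin N)
    {a b : Var n} (hab : Dominates (halfSign h) e a b) (κ : Var n → ℤ) (R : RatFun K (Var n)) :
    pairIntegrand q d h e (fun x => κ x + (Pi.single b 1 : Var n → ℤ) x) R -
      ((q ^ (-d a.1 b.1) : Kˣ) : K) •
        pairIntegrand q d h e (fun x => κ x + (Pi.single a 1 : Var n → ℤ) x) R =
      (∏ v, ratVar K v ^ κ v) * R * (ratVar K b - ratVar K a) /
        ∏ p ∈ (dominatedPairs (halfSign h) e).erase (a, b), poleFactor q d p.1 p.2 := by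
  have hne : b ≠ a := by
    rintro rfl
    rw [dominates_halfSign] at hab
    exact lt_irrefl _ hab
  have h1 := ratVar_sub_smul_ne_zero hne (((q ^ (-d a.1 b.1) : Kˣ) : K))
  have h2 := ratVar_sub_ne_zero (K := K) hne
  have h3 : ∏ p ∈ (dominatedPairs (halfSign h) e).erase (a, b), poleFactor q d p.1 p.2 ≠ 0 := by
    refine Finset.prod_ne_zero_iff.2 fun p hp => poleFactor_ne_zero ?_
    intro h4
    have h5 := mem_dominatedPairs.1 (Finset.mem_of_mem_erase hp)
    rw [dominates_halfSign, h4] at h5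
    exact lt_irrefl _ h5
  rw [pairIntegrand, pairIntegrand, prod_ratVar_zpow_add_single, prod_ratVar_zpow_add_single,
    ← Finset.mul_prod_erase _ _ ((mem_dominatedPairs (p := (a, b))).2 hab)]
  simp only [poleFactor] at h3 ⊢
  rw [Algebra.smul_def] at h1 ⊢
  rw [Algebra.smul_def]
  field_simp

/-- The constant term, as a linear map. -/
def constTermLin (K : Type*) [Field K] (ε : ℤˣ) (N : ℕ) : RatFun K (Fin N) →ₗ[K] K where
  toFun := constTerm K ε
  map_add' := fun f g => by simp [constTerm]
  map_smul' := fun c f => by simp [constTerm]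

theorem constTermLin_apply (ε : ℤˣ) {N : ℕ} (f : RatFun K (Fin N)) :
    constTermLin K ε N f = constTerm K ε f := rfl

variable (q d h) in
/-- The value of the pairings on a word. -/
def wordPairing {N : ℕ} (w : Fin N → I × ℤ) : bigShuffle K I →ₗ[K] K where
  toFun R := constTerm K (halfSign h)
    (((∏ a, ratVar K a ^ (w a).2) * ratRename K
        (nonempty_enumeration fun a => (w a).1).some.1.toEmbedding
          ((R : RatSum K I) (wordDegree fun a => (w a).1))) /
      ∏ a, ∏ b ∈ Finset.univ.filter (fun b => a < b),
        zetaFactor q d h (w a).1 (w b).1 (ratVar K a) (ratVar K b))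
  map_add' R R' := by
    simp only [← constTermLin_apply, ← map_add]
    rw [Submodule.coe_add, DirectSum.add_apply, map_add, mul_add, add_div]
  map_smul' c R := by
    simp only [← constTermLin_apply, RingHom.id_apply, ← map_smul]
    rw [Submodule.coe_smul, DirectSum.smul_apply, map_smul, mul_smul_comm, smul_div_assoc]

theorem wordPairing_apply {N : ℕ} (w : Fin N → I × ℤ) {n : I → ℕ}
    (e : Enumeration n fun a => (w a).1) (R : bigShuffle K I) :
    wordPairing q d h w R = constTerm K (halfSign h)
      (((∏ a, ratVar K a ^ (w a).2) * ratRename K e.1.toEmbedding ((R : RatSum K I) n)) /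
        ∏ a, ∏ b ∈ Finset.univ.filter (fun b => a < b),
          zetaFactor q d h (w a).1 (w b).1 (ratVar K a) (ratVar K b)) := by
  have := e.degree_eq
  subst this
  obtain ⟨g, hg⟩ := (enumerationEquiv (nonempty_enumeration fun a => (w a).1).some).surjective e
  obtain ⟨r, hr⟩ := R.2 (wordDegree fun a => (w a).1)
  have h1 : ratRename K e.1.toEmbedding ((R : RatSum K I) (wordDegree fun a => (w a).1)) =
      ratRename K (nonempty_enumeration fun a => (w a).1).some.1.toEmbedding
        ((R : RatSum K I) (wordDegree fun a => (w a).1)) := by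
    conv_lhs => rw [← ratRename_colourPerm_of_isNumerator hr g]
    rw [ratRename_ratRename, ← hg, coe_enumerationEquiv]
    congr 2
    ext v : 1
    exact congrArg _ ((colourPerm g).symm_apply_apply v)
  rw [h1]
  rfl

theorem wordPairing_eq (hd : IsSymmetricCartan d) {N : ℕ} (w : Fin N → I × ℤ) {n : I → ℕ}
    (e : Enumeration n fun a => (w a).1) (R : bigShuffle K I) :
    wordPairing q d h w R = constTerm K (halfSign h) (ratRename K e.1.toEmbedding
      (pairIntegrand q d h e.1 (fun v => (w (e.1 v)).2) ((R : RatSum K I) n))) := by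
  rw [wordPairing_apply w e, ratRename_pairIntegrand hd e fun a => (w a).2]

/-- The word obtained by raising the exponent of one letter by one. -/
def raise {N : ℕ} (w : Fin N → I × ℤ) (p : Fin N) : Fin N → I × ℤ :=
  fun a => ((w a).1, (w a).2 + (Pi.single p 1 : Fin N → ℤ) a)

theorem wordPairing_raise (hd : IsSymmetricCartan d) {N : ℕ} (w : Fin N → I × ℤ) {n : I → ℕ}
    (e : Enumeration n fun a => (w a).1) (R : bigShuffle K I) (p : Fin N) :
    wordPairing q d h (raise w p) R = constTerm K (halfSign h) (ratRename K e.1.toEmbedding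
      (pairIntegrand q d h e.1
        (fun v => (w (e.1 v)).2 + (Pi.single (e.1.symm p) 1 : Var n → ℤ) v)
          ((R : RatSum K I) n))) := by
  rw [wordPairing_eq hd (raise w p) e]
  congr 3
  funext v
  simp only [raise, Pi.single_apply, Equiv.eq_symm_apply]

theorem wordPairing_raise_swap (hd : IsSymmetricCartan d) {N : ℕ} (w : Fin N → I × ℤ)
    {n : I → ℕ} (e : Enumeration n fun a => (w a).1) (R : bigShuffle K I) (p : Fin N)
    (σ : Equiv.Perm (Fin N)) (hσ : ∀ a, σ (σ a) = a) :
    wordPairing q d h (raise w p ∘ σ) R = constTerm K (halfSign h)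
      (ratRename K (e.1.trans σ).toEmbedding (pairIntegrand q d h (e.1.trans σ)
        (fun v => (w (e.1 v)).2 + (Pi.single (e.1.symm p) 1 : Var n → ℤ) v)
          ((R : RatSum K I) n))) := by
  let e' : Enumeration n fun a => ((raise w p ∘ σ) a).1 := ⟨e.1.trans σ, fun v => by
    have := e.2 v
    simpa [raise, hσ] using this⟩
  rw [wordPairing_eq hd (raise w p ∘ σ) e']
  have h1 : (fun v => ((raise w p ∘ σ) (e'.1 v)).2) =
      fun v => (w (e.1 v)).2 + (Pi.single (e.1.symm p) 1 : Var n → ℤ) v := by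
    funext v
    simp only [e', raise, Pi.single_apply, Equiv.eq_symm_apply, Function.comp_apply,
      Equiv.trans_apply, hσ]
  rw [h1]

theorem swap_lt_swap_iff {N : ℕ} {p p' : Fin N} (hp : (p' : ℕ) = p + 1) (a b : Fin N) :
    Equiv.swap p p' a < Equiv.swap p p' b ∧ ¬(a = p' ∧ b = p) ↔ a < b ∧ ¬(a = p ∧ b = p') := by
  simp only [Equiv.swap_apply_def, Fin.lt_def, Fin.ext_iff]
  split_ifs <;> omega

theorem dominates_swap_iff {V : Type*} {N : ℕ} {p p' : Fin N} (hp : (p' : ℕ) = p + 1)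
    (e : V ≃ Fin N) (ε : ℤˣ) {a b : V}
    (hab : (a = e.symm p ∧ b = e.symm p') ∨ (a = e.symm p' ∧ b = e.symm p))
    (hdom : Dominates ε e a b) (x y : V) :
    Dominates ε (e.trans (Equiv.swap p p')) x y ∧ ¬(x = b ∧ y = a) ↔
      Dominates ε e x y ∧ ¬(x = a ∧ y = b) := by
  have h1 := swap_lt_swap_iff hp (e x) (e y)
  have h2 := swap_lt_swap_iff hp (e y) (e x)
  have h3 : p < p' := by rw [Fin.lt_def]; omega
  have h4 : (1 : ℤˣ) ≠ -1 := by decide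
  rcases hab with ⟨rfl, rfl⟩ | ⟨rfl, rfl⟩ <;>
    rcases Int.units_eq_one_or ε with rfl | rfl <;>
    simp only [Dominates, Equiv.apply_symm_apply, Equiv.trans_apply, Equiv.eq_symm_apply] at * <;>
    grind

/-- The pairings respect the quadratic relations between two consecutive letters of a word. -/
theorem wordPairing_relation (hd : IsSymmetricCartan d) {N : ℕ} (w : Fin N → I × ℤ)
    {p p' : Fin N} (hp : (p' : ℕ) = p + 1) (u v : Fin N)
    (huv : match h with | .plus => u = p' ∧ v = p | .minus => u = p ∧ v = p') :
    wordPairing q d h (raise w v) -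
        ((q ^ (-d (w p).1 (w p').1) : Kˣ) : K) • wordPairing q d h (raise w u) =
      ((q ^ (-d (w p).1 (w p').1) : Kˣ) : K) •
          wordPairing q d h (raise w v ∘ Equiv.swap p p') -
        wordPairing q d h (raise w u ∘ Equiv.swap p p') := by
  obtain ⟨e⟩ := nonempty_enumeration fun a => (w a).1
  ext R
  have hσ : ∀ a, Equiv.swap p p' (Equiv.swap p p' a) = a := fun a => by
    rw [← Equiv.Perm.mul_apply, Equiv.swap_mul_self]; rfl
  simp only [LinearMap.sub_apply, LinearMap.smul_apply]
  rw [wordPairing_raise hd w e, wordPairing_raise hd w e,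
    wordPairing_raise_swap hd w e R v _ hσ, wordPairing_raise_swap hd w e R u _ hσ]
  simp only [← constTermLin_apply, ← map_smul, ← map_sub]
  obtain ⟨r, hr⟩ := R.2 (wordDegree fun a => (w a).1)
  have hlt : p < p' := by rw [Fin.lt_def]; omega
  have huv' : (e.1.symm u = e.1.symm p ∧ e.1.symm v = e.1.symm p') ∨
      (e.1.symm u = e.1.symm p' ∧ e.1.symm v = e.1.symm p) := by
    cases h <;> simp [huv.1, huv.2]
  have hdom : Dominates (halfSign h) e.1 (e.1.symm u) (e.1.symm v) := by
    cases h <;> obtain ⟨rfl, rfl⟩ := huv <;> simp [Dominates, halfSign, hlt]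
  have hdom' : Dominates (halfSign h) (e.1.trans (Equiv.swap p p')) (e.1.symm v)
      (e.1.symm u) := by
    cases h <;> obtain ⟨rfl, rfl⟩ := huv <;> simp [Dominates, halfSign, hlt]
  have hcol : ∀ a, (e.1.symm a).1 = (w a).1 := fun a => by
    rw [← e.2, Equiv.apply_symm_apply]
  have hd1 : d (e.1.symm u).1 (e.1.symm v).1 = d (w p).1 (w p').1 := by
    rw [hcol, hcol]
    cases h
    · rw [huv.1, huv.2, hd.symm]
    · rw [huv.1, huv.2]
  have hd2 : d (e.1.symm v).1 (e.1.symm u).1 = d (w p).1 (w p').1 := by rw [hd.symm, hd1]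
  have hE : (dominatedPairs (halfSign h) (e.1.trans (Equiv.swap p p'))).erase
      (e.1.symm v, e.1.symm u) = (dominatedPairs (halfSign h) e.1).erase
        (e.1.symm u, e.1.symm v) := by
    ext x
    rw [Finset.mem_erase, Finset.mem_erase, mem_dominatedPairs, mem_dominatedPairs, ne_eq,
      ne_eq, Prod.ext_iff, Prod.ext_iff, and_comm, dominates_swap_iff hp e.1 _ huv' hdom, and_comm]
  have hs := smul_pairIntegrand (q := q) (d := d) (h := h) e.1 hdom (fun v => (w (e.1 v)).2)
    ((R : RatSum K I) (wordDegree fun a => (w a).1))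
  have hs' := smul_pairIntegrand (q := q) (d := d) (h := h) (e.1.trans (Equiv.swap p p')) hdom'
    (fun v => (w (e.1 v)).2) ((R : RatSum K I) (wordDegree fun a => (w a).1))
  rw [hd1] at hs
  rw [hd2, hE] at hs'
  have hct := constTerm_swap (q := q) (d := d) hr (e' := e.1.trans (Equiv.swap p p')) hdom
    (fun x hx => ?_) (fun v => (w (e.1 v)).2)
  · rw [← constTermLin_apply, ← constTermLin_apply] at hct
    rw [hs, hct]
    congr 2
    rw [← neg_sub (pairIntegrand _ _ _ _ _ _), hs', ← neg_div]
    congr 1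
    ring
  · rw [← hE] at hx
    exact mem_dominatedPairs.1 (Finset.mem_of_mem_erase hx)

/-- A word with two consecutive letters singled out. -/
def insertPair {N M : ℕ} (w : Fin N → I × ℤ) (x y : I × ℤ) (w' : Fin M → I × ℤ) :
    Fin (N + 2 + M) → I × ℤ :=
  Fin.append (Fin.append w ![x, y]) w'

theorem word_insertPair {N M : ℕ} (w : Fin N → I × ℤ) (x y : I × ℤ) (w' : Fin M → I × ℤ) :
    word K (insertPair w x y w') =
      word K w * (FreeAlgebra.ι K x * FreeAlgebra.ι K y) * word K w' := by
  rw [insertPair, word_append, word_append]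
  congr 2
  simp [word]

/-- The position of the first of the two letters. -/
def pairFst (N M : ℕ) : Fin (N + 2 + M) := Fin.castAdd M (Fin.natAdd N 0)

/-- The position of the second of the two letters. -/
def pairSnd (N M : ℕ) : Fin (N + 2 + M) := Fin.castAdd M (Fin.natAdd N 1)

theorem insertPair_fst {N M : ℕ} (w : Fin N → I × ℤ) (x y : I × ℤ) (w' : Fin M → I × ℤ) :
    insertPair w x y w' (pairFst N M) = x := by simp [insertPair, pairFst]

theorem insertPair_snd {N M : ℕ} (w : Fin N → I × ℤ) (x y : I × ℤ) (w' : Fin M → I × ℤ) :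
    insertPair w x y w' (pairSnd N M) = y := by simp [insertPair, pairSnd]

theorem insertPair_congr {N M : ℕ} (w : Fin N → I × ℤ) (x y x' y' : I × ℤ) (w' : Fin M → I × ℤ)
    {a : Fin (N + 2 + M)} (h1 : a ≠ pairFst N M) (h2 : a ≠ pairSnd N M) :
    insertPair w x y w' a = insertPair w x' y' w' a := by
  revert h1 h2
  refine Fin.addCases (fun a => ?_) (fun a => ?_) a
  · refine Fin.addCases (fun a => ?_) (fun a => ?_) a
    · simp [insertPair]
    · fin_cases a
      · exact fun h1 => absurd rfl h1
      · exact fun _ h2 => absurd rfl h2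
  · simp [insertPair]

theorem insertPair_raise_fst {N M : ℕ} (w : Fin N → I × ℤ) (i j : I) (k l : ℤ)
    (w' : Fin M → I × ℤ) :
    insertPair w (i, k + 1) (j, l) w' = raise (insertPair w (i, k) (j, l) w') (pairFst N M) := by
  funext a
  by_cases h1 : a = pairFst N M
  · subst h1; simp [raise, insertPair_fst]
  · by_cases h2 : a = pairSnd N M
    · subst h2; simp [raise, insertPair_snd, Pi.single_eq_of_ne h1]
    · rw [insertPair_congr w _ _ (i, k) (j, l) w' h1 h2]
      simp [raise, Pi.single_eq_of_ne h1]

theorem insertPair_raise_snd {N M : ℕ} (w : Fin N → I × ℤ) (i j : I) (k l : ℤ)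
    (w' : Fin M → I × ℤ) :
    insertPair w (i, k) (j, l + 1) w' = raise (insertPair w (i, k) (j, l) w') (pairSnd N M) := by
  funext a
  by_cases h1 : a = pairSnd N M
  · subst h1; simp [raise, insertPair_snd]
  · by_cases h2 : a = pairFst N M
    · subst h2; simp [raise, insertPair_fst, Pi.single_eq_of_ne h1]
    · rw [insertPair_congr w _ _ (i, k) (j, l) w' h2 h1]
      simp [raise, Pi.single_eq_of_ne h1]

theorem insertPair_swap {N M : ℕ} (w : Fin N → I × ℤ) (x y : I × ℤ) (w' : Fin M → I × ℤ) :
    insertPair w y x w' =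
      insertPair w x y w' ∘ Equiv.swap (pairFst N M) (pairSnd N M) := by
  funext a
  by_cases h1 : a = pairFst N M
  · subst h1; simp [insertPair_fst, insertPair_snd]
  · by_cases h2 : a = pairSnd N M
    · subst h2; simp [insertPair_fst, insertPair_snd]
    · rw [insertPair_congr w _ _ x y w' h1 h2]
      simp [Equiv.swap_apply_of_ne_of_ne h1 h2]

variable (q d h) in
/-- The pairing with the words of the half `h`, extended linearly to the free algebra. -/
def freePairing : FreeAlgebra K (I × ℤ) →ₗ[K] bigShuffle K I →ₗ[K] K :=
  wordLinear fun _ w => wordPairing q d h.opp w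

theorem freePairing_quadRel (hd : IsSymmetricCartan d) {x y : FreeAlgebra K (I × ℤ)}
    (hxy : QuadRel q d h x y) (a b : FreeAlgebra K (I × ℤ)) :
    freePairing q d h (a * x * b) = freePairing q d h (a * y * b) := by
  have hw : ∀ (N : ℕ) (w : Fin N → I × ℤ) (M : ℕ) (w' : Fin M → I × ℤ),
      freePairing q d h (word K w * x * word K w') =
        freePairing q d h (word K w * y * word K w') := by
    intro N w M w'
    have hp : ((pairSnd N M : Fin (N + 2 + M)) : ℕ) = pairFst N M + 1 := rfl
    cases hxy with
    | e i j k l =>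
      have h1 := wordPairing_relation (q := q) (h := .minus) hd (insertPair w (i, k) (j, l) w') hp
        (pairFst N M) (pairSnd N M) ⟨rfl, rfl⟩
      rw [insertPair_fst, insertPair_snd, ← insertPair_raise_fst, ← insertPair_raise_snd,
        ← insertPair_swap, ← insertPair_swap] at h1
      simp only [mul_sub, sub_mul, mul_smul_comm, smul_mul_assoc, map_sub, map_smul,
        ← word_insertPair, freePairing, wordLinear_word, Half.opp]
      rw [← neg_sub, h1, neg_sub]
    | f i j k l =>
      have h1 := wordPairing_relation (q := q) (h := .plus) hd (insertPair w (i, k) (j, l) w') hp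
        (pairSnd N M) (pairFst N M) ⟨rfl, rfl⟩
      rw [insertPair_fst, insertPair_snd, ← insertPair_raise_fst, ← insertPair_raise_snd,
        ← insertPair_swap, ← insertPair_swap] at h1
      simp only [mul_sub, sub_mul, mul_smul_comm, smul_mul_assoc, map_sub, map_smul,
        ← word_insertPair, freePairing, wordLinear_word, Half.opp]
      exact h1
  have hb : ∀ (N : ℕ) (w : Fin N → I × ℤ), freePairing q d h (word K w * x * b) =
      freePairing q d h (word K w * y * b) := fun N w =>
    mem_of_word_mem (p := LinearMap.eqLocus
      (freePairing q d h ∘ₗ LinearMap.mulLeft K (word K w * x))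
      (freePairing q d h ∘ₗ LinearMap.mulLeft K (word K w * y))) (hw N w) b
  have ha := mem_of_word_mem (p := LinearMap.eqLocus
      (freePairing q d h ∘ₗ LinearMap.mulRight K (x * b))
      (freePairing q d h ∘ₗ LinearMap.mulRight K (y * b))) (fun N w => by
        rw [LinearMap.mem_eqLocus, LinearMap.comp_apply, LinearMap.comp_apply,
          LinearMap.mulRight_apply, LinearMap.mulRight_apply, ← mul_assoc, ← mul_assoc]
        exact hb N w) a
  rw [LinearMap.mem_eqLocus, LinearMap.comp_apply, LinearMap.comp_apply,
    LinearMap.mulRight_apply, LinearMap.mulRight_apply, ← mul_assoc, ← mul_assoc] at ha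
  exact ha

theorem exists_pairing (hd : IsSymmetricCartan d) (h : Half) :
    ∃ P : QuadAlg q d h →ₗ[K] bigShuffle K I →ₗ[K] K, ∀ (N : ℕ) (w : Fin N → I × ℤ),
      P (List.ofFn fun a => gen q d h (w a).1 (w a).2).prod = wordPairing q d h.opp w := by
  obtain ⟨P, hP⟩ := exists_ringQuot_linearMap (QuadRel q d h) (freePairing q d h)
    (fun x y hxy a b => freePairing_quadRel hd hxy a b)
  refine ⟨P, fun N w => ?_⟩
  rw [← mkAlgHom_word]
  exact (hP _).trans (wordLinear_word _ w)

theorem IsPairingUV.apply_word {P : QuadAlg q d .plus →ₗ[K] bigShuffle K I →ₗ[K] K}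
    (hP : IsPairingUV q d P) {N : ℕ} (w : Fin N → I × ℤ) :
    P (List.ofFn fun a => gen q d .plus (w a).1 (w a).2).prod = wordPairing q d .minus w := by
  ext R
  obtain ⟨e⟩ := nonempty_enumeration fun a => (w a).1
  rw [wordPairing_apply w e]
  exact hP N (fun a => (w a).1) (fun a => (w a).2) R _ e.1 e.2

theorem IsPairingVU.apply_word {P : bigShuffle K I →ₗ[K] QuadAlg q d .minus →ₗ[K] K}
    (hP : IsPairingVU q d P) {N : ℕ} (w : Fin N → I × ℤ) (R : bigShuffle K I) :
    P R (List.ofFn fun a => gen q d .minus (w a).1 (w a).2).prod = wordPairing q d .plus w R := by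
  obtain ⟨e⟩ := nonempty_enumeration fun a => (w a).1
  rw [wordPairing_apply w e]
  have h1 := hP N (fun a => (w a).1) (fun a => -(w a).2) R _ e.1 e.2
  simp only [neg_neg] at h1
  exact h1

theorem existsUnique_isPairingUV (hd : IsSymmetricCartan d) :
    ∃! P : QuadAlg q d .plus →ₗ[K] bigShuffle K I →ₗ[K] K, IsPairingUV q d P := by
  obtain ⟨P, hP⟩ := exists_pairing (q := q) hd .plus
  refine ⟨P, fun N i k R n e he => ?_, fun P' hP' => ?_⟩
  · have h1 := hP N fun a => (i a, k a)
    simp only at h1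
    rw [h1]
    exact wordPairing_apply (fun a => (i a, k a)) ⟨e, he⟩ R
  · apply quadAlg_linearMap_ext
    intro N w
    rw [hP, hP'.apply_word]
    rfl

theorem existsUnique_isPairingVU (hd : IsSymmetricCartan d) :
    ∃! P : bigShuffle K I →ₗ[K] QuadAlg q d .minus →ₗ[K] K, IsPairingVU q d P := by
  obtain ⟨P, hP⟩ := exists_pairing (q := q) hd .minus
  refine ⟨P.flip, fun N i k R n e he => ?_, fun P' hP' => ?_⟩
  · have h1 := hP N fun a => (i a, -k a)
    simp only at h1
    rw [LinearMap.flip_apply, h1]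
    exact wordPairing_apply (fun a => (i a, -k a)) ⟨e, he⟩ R
  · ext R : 1
    apply quadAlg_linearMap_ext
    intro N w
    rw [LinearMap.flip_apply, hP, hP'.apply_word]
    rfl

end Pairings

/-! ### Compatibility of the pairings and the homomorphisms -/

section Compatibility

variable {K : Type*} [Field K] {q : Kˣ} {I : Type*} [Fintype I] [LinearOrder I] {d : I → I → ℤ}
  {h : Half}

variable (q d h) in
/-- The product of the factors `ζ` of the kernel of a shuffle product, for an order of the
variables. -/
def poleProd {n : I → ℕ} {N : ℕ} (e : Var n ≃ Fin N) : RatFun K (Var n) :=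
  ∏ p ∈ dominatedPairs (halfSign h) e, poleFactor q d p.1 p.2

theorem poleProd_ne_zero {n : I → ℕ} {N : ℕ} (e : Var n ≃ Fin N) : poleProd q d h e ≠ 0 := by
  refine Finset.prod_ne_zero_iff.2 fun p hp => poleFactor_ne_zero fun h1 => ?_
  rw [mem_dominatedPairs, dominates_halfSign, h1] at hp
  exact lt_irrefl _ hp

theorem poleProd_plus_mul_minus {n : I → ℕ} {N : ℕ} (e : Var n ≃ Fin N) :
    poleProd q d .plus e * poleProd q d .minus e =
      ∏ p ∈ Finset.univ.filter (fun p : Var n × Var n => p.1 ≠ p.2), poleFactor q d p.1 p.2 := by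
  rw [poleProd, poleProd, ← Finset.prod_union]
  · refine Finset.prod_congr ?_ fun _ _ => rfl
    ext p
    have h1 : p.1 ≠ p.2 ↔ e p.1 ≠ e p.2 := e.injective.ne_iff.symm
    simp only [Finset.mem_union, mem_dominatedPairs, Finset.mem_filter, Finset.mem_univ, true_and,
      h1, Dominates, halfSign]
    rw [ne_iff_lt_or_gt]
    simp [or_comm]
  · rw [Finset.disjoint_left]
    intro p h1 h2
    rw [mem_dominatedPairs] at h1 h2
    simp only [Dominates, halfSign] at h1 h2
    have h3 : e p.2 < e p.1 := by simpa using h1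
    have h4 : e p.1 < e p.2 := by simpa using h2
    exact lt_asymm h3 h4

theorem poleProd_div {n : I → ℕ} {N M : ℕ} (e : Var n ≃ Fin N) (e' : Var n ≃ Fin M) :
    poleProd q d .minus e' / poleProd q d .minus e =
      poleProd q d .plus e / poleProd q d .plus e' := by
  have h1 := poleProd_plus_mul_minus (q := q) (d := d) e
  rw [← poleProd_plus_mul_minus e'] at h1
  rw [div_eq_div_iff (poleProd_ne_zero e) (poleProd_ne_zero e'), mul_comm, ← h1]

/-- The summand, for the orders `e` and `e'` of the variables, of the pairing of two words. -/
theorem constTerm_poleProd_div (hd : IsSymmetricCartan d) {n : I → ℕ} {N M : ℕ}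
    (e : Var n ≃ Fin N) (e' : Var n ≃ Fin M) (κ : Var n → ℤ) :
    constTerm K (halfSign .minus) (ratRename K e.toEmbedding
      ((∏ v, ratVar K v ^ κ v) * (poleProd q d .minus e' / poleProd q d .minus e))) =
    constTerm K (halfSign .plus) (ratRename K e'.toEmbedding
      ((∏ v, ratVar K v ^ κ v) * (poleProd q d .minus e' / poleProd q d .minus e))) := by
  -- The pairs for which the two orders differ are the only poles.
  let E := Finset.univ.filter fun p : Var n × Var n => e p.1 < e p.2 ∧ e' p.2 < e' p.1
  let C := Finset.univ.filter fun p : Var n × Var n => e p.1 < e p.2 ∧ e' p.1 < e' p.2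
  have hD : ∀ {N : ℕ} (e : Var n ≃ Fin N), poleProd q d .minus e =
      ∏ p ∈ Finset.univ.filter (fun p : Var n × Var n => e p.1 < e p.2),
        poleFactor q d p.1 p.2 := by
    intro N e
    refine Finset.prod_congr (Finset.filter_congr fun p _ => ?_) fun _ _ => rfl
    simp [Dominates, halfSign]
  have hlt : ∀ {N M : ℕ} (e : Var n ≃ Fin N) (e' : Var n ≃ Fin M) (p : Var n × Var n),
      e p.1 < e p.2 → (e' p.2 < e' p.1 ∨ e' p.1 < e' p.2) := by
    intro N M e e' p hp
    apply lt_or_gt_of_ne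
    intro h1
    rw [e'.injective h1] at hp
    exact lt_irrefl _ hp
  have h1 : poleProd q d .minus e = (∏ p ∈ E, poleFactor q d p.1 p.2) *
      ∏ p ∈ C, poleFactor q d p.1 p.2 := by
    rw [hD, ← Finset.prod_union]
    · refine Finset.prod_congr ?_ fun _ _ => rfl
      ext p
      simp only [E, C, Finset.mem_union, Finset.mem_filter, Finset.mem_univ, true_and,
        ← and_or_left]
      exact ⟨fun hp => ⟨hp, hlt e e' p hp⟩, fun hp => hp.1⟩
    · rw [Finset.disjoint_filter]
      exact fun p _ h1 h2 => lt_asymm h1.2 h2.2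
  have h2 : poleProd q d .minus e' = (∏ p ∈ E, poleFactor q d p.2 p.1) *
      ∏ p ∈ C, poleFactor q d p.1 p.2 := by
    have h3 : ∏ p ∈ E, poleFactor q d p.2 p.1 = ∏ p ∈ Finset.univ.filter
        (fun p : Var n × Var n => e' p.1 < e' p.2 ∧ e p.2 < e p.1), poleFactor q d p.1 p.2 := by
      simp only [E, Finset.prod_filter]
      rw [← (Equiv.prodComm (Var n) (Var n)).prod_comp]
      exact Finset.prod_congr rfl fun p _ => if_congr and_comm rfl rfl
    rw [hD, h3, ← Finset.prod_union]
    · refine Finset.prod_congr ?_ fun _ _ => rfl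
      ext p
      simp only [C, Finset.mem_union, Finset.mem_filter, Finset.mem_univ, true_and]
      constructor
      · intro hp
        rcases hlt e' e p hp with h4 | h4
        · exact Or.inl ⟨hp, h4⟩
        · exact Or.inr ⟨h4, hp⟩
      · rintro (hp | hp)
        · exact hp.1
        · exact hp.2
    · rw [Finset.disjoint_filter]
      exact fun p _ h1 h2 => lt_asymm h1.2 h2.1
  refine constTerm_eq E (fun p => q ^ (-d p.1.1 p.2.1)) (fun p hp => ?_) (fun p hp => ?_)
    (AddMonoidAlgebra.single κ 1 *
      ∏ p ∈ E, (((q ^ (-d p.1.1 p.2.1) : Kˣ) : K) • lvar K p.2 - lvar K p.1)) ?_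
  · exact Or.inl ⟨rfl, (Finset.mem_filter.1 hp).2.1⟩
  · exact Or.inr ⟨rfl, (Finset.mem_filter.1 hp).2.2⟩
  · have hC : ∏ p ∈ C, poleFactor q d p.1 p.2 ≠ 0 :=
      right_ne_zero_of_mul (h1 ▸ poleProd_ne_zero e)
    rw [h1, h2, mul_div_mul_right _ _ hC, map_mul, laurentToRat_single, map_prod,
      ← Finset.prod_div_distrib, mul_div_assoc, ← Finset.prod_div_distrib]
    congr 1
    refine Finset.prod_congr rfl fun p hp => ?_
    have hne : p.2 ≠ p.1 := fun h3 => by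
      have := (Finset.mem_filter.1 hp).2.1
      rw [h3] at this
      exact lt_irrefl _ this
    have h3 := ratVar_sub_ne_zero (K := K) hne
    have h4 := ratVar_sub_ne_zero (K := K) hne.symm
    have h5 := ratVar_sub_smul_ne_zero hne (((q ^ (-d p.1.1 p.2.1) : Kˣ) : K))
    rw [poleFactor, poleFactor, map_sub, map_smul, laurentToRat_lvar, laurentToRat_lvar,
      hd.symm p.2.1 p.1.1]
    rw [Algebra.smul_def] at h5
    simp only [Algebra.smul_def]
    field_simp
    ring

theorem ratRename_wordKernel (hd : IsSymmetricCartan d) {N : ℕ} {n : I → ℕ} {w : Fin N → I × ℤ}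
    (e : Enumeration n fun a => (w a).1) :
    ratRename K e.1.symm.toEmbedding (wordKernel q d h w) =
      (∏ v, ratVar K v ^ (w (e.1 v)).2) * poleProd q d h e.1 := by
  rw [prod_wordKernel, prod_zetaFactor_eq_prod_poleFactor hd, poleProd]

theorem wordPairing_eq_zero (hd : IsSymmetricCartan d) {N : ℕ} (w : Fin N → I × ℤ)
    {R : bigShuffle K I} (hR : (R : RatSum K I) (wordDegree fun a => (w a).1) = 0) :
    wordPairing q d h w R = 0 := by
  obtain ⟨e⟩ := nonempty_enumeration fun a => (w a).1
  rw [wordPairing_eq hd w e, hR, pairIntegrand, mul_zero, zero_div, map_zero,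
    ← constTermLin_apply, map_zero]

theorem wordElement_apply_of_ne {N : ℕ} (w : Fin N → I × ℤ) {n : I → ℕ}
    (hn : n ≠ wordDegree fun a => (w a).1) : wordElement q d h w n = 0 := by
  rw [wordElement, DirectSum.lof_eq_of, DirectSum.of_eq_of_ne _ _ _ hn]

theorem wordElement_apply {N : ℕ} (w : Fin N → I × ℤ) {n : I → ℕ}
    (e : Enumeration n fun a => (w a).1) :
    wordElement q d h w n = symSum n (fun a => (w a).1) (wordKernel q d h w) := by
  rw [wordElement_eq w e, DirectSum.lof_apply]

theorem wordPairing_wordElement_eq_sum (hd : IsSymmetricCartan d) {N M : ℕ}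
    (w : Fin N → I × ℤ) (w' : Fin M → I × ℤ) {R : bigShuffle K I}
    (hR : (R : RatSum K I) = wordElement q d h w') {n : I → ℕ}
    (e : Enumeration n fun a => (w a).1) (e₀ : Enumeration n fun a => (w' a).1) :
    wordPairing q d h w R = ∑ e' : Enumeration n fun a => (w' a).1,
      constTerm K (halfSign h) (ratRename K e.1.toEmbedding
        ((∏ v, ratVar K v ^ ((w (e.1 v)).2 + (w' (e'.1 v)).2)) *
          (poleProd q d h e'.1 / poleProd q d h e.1))) := by
  have h1 : pairIntegrand q d h e.1 (fun v => (w (e.1 v)).2) ((R : RatSum K I) n) =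
      ∑ e' : Enumeration n fun a => (w' a).1,
        (∏ v, ratVar K v ^ ((w (e.1 v)).2 + (w' (e'.1 v)).2)) *
          (poleProd q d h e'.1 / poleProd q d h e.1) := by
    rw [hR, wordElement_apply w' e₀, symSum_apply, pairIntegrand, Finset.mul_sum, Finset.sum_div]
    refine Finset.sum_congr rfl fun e' _ => ?_
    rw [ratRename_wordKernel hd e', ← poleProd, ← mul_assoc, mul_div_assoc,
      ← Finset.prod_mul_distrib]
    congr 1
    exact Finset.prod_congr rfl fun v _ => (zpow_add₀ (ratVar_ne_zero K v) _ _).symm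
  rw [wordPairing_eq hd w e, h1]
  simp only [← constTermLin_apply, map_sum]

/-- The two ways to pair words: up to the order of the variables, both are sums over pairs of
enumerations of the constant terms of the same functions, expanded in regions which lead to the
same result. -/
theorem wordPairing_wordElement [CharZero K] (hd : IsSymmetricCartan d) {N M : ℕ}
    (w : Fin N → I × ℤ) (w' : Fin M → I × ℤ) {R R' : bigShuffle K I}
    (hR : (R : RatSum K I) = wordElement q d .minus w')
    (hR' : (R' : RatSum K I) = wordElement q d .plus w) :
    wordPairing q d .minus w R = wordPairing q d .plus w' R' := by
  by_cases hn : wordDegree (fun a => (w a).1) = wordDegree fun a => (w' a).1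
  · obtain ⟨e₀⟩ := nonempty_enumeration fun a => (w a).1
    obtain ⟨e₀'⟩ := nonempty_enumeration fun a => (w' a).1
    rw [← hn] at e₀'
    generalize wordDegree (fun a => (w a).1) = n at e₀ e₀'
    -- Averaging over the auxiliary enumeration makes both sides sums over pairs.
    have h3 : ∑ e : Enumeration n fun a => (w a).1, wordPairing q d .minus w R =
        ∑ e' : Enumeration n fun a => (w' a).1, wordPairing q d .plus w' R' := by
      rw [Finset.sum_congr rfl fun e _ => wordPairing_wordElement_eq_sum hd w w' hR e e₀',
        Finset.sum_congr rfl fun e' _ => wordPairing_wordElement_eq_sum hd w' w hR' e' e₀,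
        Finset.sum_comm]
      refine Finset.sum_congr rfl fun e' _ => Finset.sum_congr rfl fun e _ => ?_
      rw [constTerm_poleProd_div hd e.1 e'.1, poleProd_div]
      simp only [add_comm]
    rw [Finset.sum_const, Finset.sum_const, Finset.card_univ, Finset.card_univ,
      card_enumeration e₀, card_enumeration e₀'] at h3
    have h4 : (∏ i, (n i).factorial) ≠ 0 :=
      Finset.prod_ne_zero_iff.2 fun i _ => Nat.factorial_ne_zero (n i)
    rw [nsmul_eq_mul, nsmul_eq_mul] at h3
    exact mul_left_cancel₀ (Nat.cast_ne_zero.2 h4) h3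
  · rw [wordPairing_eq_zero hd w (by rw [hR, wordElement_apply_of_ne w' hn]),
      wordPairing_eq_zero hd w' (by rw [hR', wordElement_apply_of_ne w (Ne.symm hn)])]

theorem pairing_compatible [CharZero K] (hd : IsSymmetricCartan d)
    {Υp : QuadAlg q d .plus →ₗ[K] bigShuffle K I} {Υm : QuadAlg q d .minus →ₗ[K] bigShuffle K I}
    {PUV : QuadAlg q d .plus →ₗ[K] bigShuffle K I →ₗ[K] K}
    {PVU : bigShuffle K I →ₗ[K] QuadAlg q d .minus →ₗ[K] K}
    (hp : IsUpsilon q d .plus Υp) (hm : IsUpsilon q d .minus Υm)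
    (hUV : IsPairingUV q d PUV) (hVU : IsPairingVU q d PVU)
    (x : QuadAlg q d .plus) (y : QuadAlg q d .minus) : PUV x (Υm y) = PVU (Υp x) y := by
  have h1 : ∀ (N : ℕ) (w : Fin N → I × ℤ),
      PUV (List.ofFn fun a => gen q d .plus (w a).1 (w a).2).prod (Υm y) =
        PVU (Υp (List.ofFn fun a => gen q d .plus (w a).1 (w a).2).prod) y := by
    intro N w
    refine mem_of_gen_prod_mem (p := LinearMap.eqLocus
      (PUV (List.ofFn fun a => gen q d .plus (w a).1 (w a).2).prod ∘ₗ Υm)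
      (PVU (Υp (List.ofFn fun a => gen q d .plus (w a).1 (w a).2).prod))) (fun M w' => ?_) y
    rw [LinearMap.mem_eqLocus, LinearMap.comp_apply, hUV.apply_word, hVU.apply_word]
    exact wordPairing_wordElement hd w w' (hm.apply_word w') (hp.apply_word w)
  exact mem_of_gen_prod_mem (p := LinearMap.eqLocus (PUV.flip (Υm y)) (PVU.flip y ∘ₗ Υp)) h1 x

theorem exists_range_linearMap {A B M : Type*} [AddCommMonoid A] [Module K A] [AddCommMonoid B]
    [Module K B] [AddCommMonoid M] [Module K M] (f : A →ₗ[K] B) (T : A →ₗ[K] M)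
    (hT : ∀ x y, f x = f y → T x = T y) :
    ∃ Q : LinearMap.range f →ₗ[K] M, ∀ x, Q (f.rangeRestrict x) = T x := by
  have hs := f.surjective_rangeRestrict
  have hi := Function.surjInv_eq hs
  have hT' : ∀ x y, f.rangeRestrict x = f.rangeRestrict y → T x = T y :=
    fun x y hxy => hT x y (congrArg Subtype.val hxy)
  refine ⟨{ toFun := fun b => T (Function.surjInv hs b), map_add' := fun b b' => ?_,
            map_smul' := fun c b => ?_ }, fun x => hT' _ _ (hi _)⟩
  · rw [← map_add]
    exact hT' _ _ (by rw [map_add, hi, hi, hi])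
  · rw [RingHom.id_apply, ← map_smul]
    exact hT' _ _ (by rw [map_smul, hi, hi])

end Compatibility

end QLoop
end

open QLoop in
theorem proposition2p8 {K : Type*} [Field K] [CharZero K] (q : Kˣ)
    (hq : ∀ n : ℕ, n ≠ 0 → q ^ n ≠ 1) {I : Type*} [Fintype I] [LinearOrder I] (d : I → I → ℤ)
    (hd : IsSymmetricCartan d) :
    (∃! Υ, IsUpsilon q d .plus Υ) ∧ (∃! Υ, IsUpsilon q d .minus Υ) ∧
    (∃! P, IsPairingUV q d P) ∧ (∃! P, IsPairingVU q d P) ∧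
    ∀ (Υp : QuadAlg q d .plus →ₗ[K] bigShuffle K I)
      (Υm : QuadAlg q d .minus →ₗ[K] bigShuffle K I)
      (PUV : QuadAlg q d .plus →ₗ[K] bigShuffle K I →ₗ[K] K)
      (PVU : bigShuffle K I →ₗ[K] QuadAlg q d .minus →ₗ[K] K),
      IsUpsilon q d .plus Υp → IsUpsilon q d .minus Υm →
      IsPairingUV q d PUV → IsPairingVU q d PVU →
      (∀ x ∈ LinearMap.ker Υp, ∀ R ∈ wheelShuffle q d, PUV x R = 0) ∧
      (∀ R ∈ wheelShuffle q d, ∀ x ∈ LinearMap.ker Υm, PVU R x = 0) ∧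
      ∃ (Q₁ : LinearMap.range Υp →ₗ[K] wheelShuffle q d →ₗ[K] K)
        (Q₂ : wheelShuffle q d →ₗ[K] LinearMap.range Υm →ₗ[K] K)
        (hp : LinearMap.range Υp ≤ wheelShuffle q d)
        (hm : LinearMap.range Υm ≤ wheelShuffle q d),
        (∀ x R, Q₁ (Υp.rangeRestrict x) R = PUV x R) ∧
        (∀ R x, Q₂ R (Υm.rangeRestrict x) = PVU R x) ∧
        ∀ A B, Q₁ A (Submodule.inclusion hm B) = Q₂ (Submodule.inclusion hp A) B := by
  refine ⟨existsUnique_isUpsilon hq hd _, existsUnique_isUpsilon hq hd _,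
    existsUnique_isPairingUV hd, existsUnique_isPairingVU hd, ?_⟩
  intro Υp Υm PUV PVU hp hm hUV hVU
  have hcomp := pairing_compatible hd hp hm hUV hVU
  have rp := hp.range_eq hq hd
  have rm := hm.range_eq hq hd
  -- Both statements reduce to elements of the form `PUV x (Υm y)`.
  have hUV' : ∀ x x', Υp x = Υp x' → ∀ R ∈ wheelShuffle q d, PUV x R = PUV x' R := by
    intro x x' hx R hR
    rw [← rm] at hR
    obtain ⟨y, rfl⟩ := hR
    rw [hcomp, hcomp, hx]
  have hVU' : ∀ y y', Υm y = Υm y' → ∀ R ∈ wheelShuffle q d, PVU R y = PVU R y' := by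
    intro y y' hy R hR
    rw [← rp] at hR
    obtain ⟨x, rfl⟩ := hR
    rw [← hcomp, ← hcomp, hy]
  obtain ⟨Q₁, hQ₁⟩ := exists_range_linearMap Υp
    (PUV.compl₁₂ LinearMap.id (wheelShuffle q d).subtype)
    (fun x x' hx => LinearMap.ext fun R => hUV' x x' hx R R.2)
  obtain ⟨Q₂, hQ₂⟩ := exists_range_linearMap Υm
    (PVU.flip.compl₁₂ LinearMap.id (wheelShuffle q d).subtype)
    (fun y y' hy => LinearMap.ext fun R => hVU' y y' hy R R.2)
  have e₁ : ∀ x (R : wheelShuffle q d), Q₁ (Υp.rangeRestrict x) R = PUV x R := fun x R => by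
    rw [hQ₁]; rfl
  have e₂ : ∀ (R : wheelShuffle q d) y, Q₂.flip R (Υm.rangeRestrict y) = PVU R y := fun R y => by
    rw [LinearMap.flip_apply, hQ₂]; rfl
  refine ⟨fun x hx R hR => ?_, fun R hR y hy => ?_, Q₁, Q₂.flip, rp.le, rm.le, e₁, e₂, ?_⟩
  · rw [hUV' x 0 (by rw [LinearMap.mem_ker.1 hx, map_zero]) R hR, map_zero, LinearMap.zero_apply]
  · rw [hVU' y 0 (by rw [LinearMap.mem_ker.1 hy, map_zero]) R hR, map_zero]
  · intro A B
    obtain ⟨x, rfl⟩ := Υp.surjective_rangeRestrict A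
    obtain ⟨y, rfl⟩ := Υm.surjective_rangeRestrict B
    rw [e₁, e₂]
    exact hcomp x y
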